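/- Let $R$ be a commutative ring, let $(\mathcal X,\diamond,\mathbf 1)$ be an essentially small symmetric monoidal category enriched in $R$-modules (so $\diamond$ is $R$-bilinear), and let $\mathcal F$ be the category of $R$-linear functors $\mathcal X\to R\text{-Mod}$, with its symmetric monoidal structure $\otimes$ (Day convolution). A monoid $A$ in $\mathcal F$ is given by natural, associative $R$-bilinear products $A(x)\times A(y)\to A(x\diamond y)$, $(a,b)\mapsto a\times b$, with a unit $\varepsilon\in A(\mathbf 1)$. The commutant $CA(\mathbf 1)$ is the set of $b\in A(\mathbf 1)$ that commute, up to the symmetry of $\mathcal X$, with all elements of all $A(y)$. The monoid $A$ is tensor idempotent if $\mu_A:A\otimes A\to A$ is an isomorphism. For variables $t_1,\dots,t_n$, $A_n=A[t_1,\dots,t_n]$ is the monoid with $A_n(x)=A(x)[t_1,\dots,t_n]$ and product $(\sum_i a_it^i)\times(\sum_j b_jt^j)=\sum_{i,j}(a_i\times b_j)t^{i+j}$. For a monoid $C$ in $\mathcal F$ and $\alpha=(\alpha_1,\dots,\alpha_n)$ in the commutant $CC(\mathbf 1)$, let $C\langle\alpha\rangle$ be the $C$-submodule of $C$ generated by $\alpha$.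 The sequence $\alpha$ is regular if, for each $i$ and with $M=C/C\langle\alpha_1,\dots,\alpha_{i-1}\rangle$, one has $\alpha_i\times m\neq0$ for all $x$ and all nonzero $m\in M(x)$, and if $C/C\langle\alpha\rangle\ne0$. Put $K^n_p(C)=\bigoplus_{S\subseteq\{1,\dots,n\},|S|=p}C$; the Koszul differential $d:K^n_p(C)\to K^n_{p-1}(C)$ is, on the summand of index $S=\{i_1<\dots<i_p\}$, the sum over $k$ of $(-1)^{k+1}(\alpha_{i_k}\times{-})$ with values in the summand of index $S\setminus\{i_k\}$. A $C$-module $P$ is $\mathcal F$-projective if every morphism $P\to Q$ of $C$-modules lifts along every morphism $N\to Q$ of $C$-modules that is a split epimorphism in $\mathcal F$. An $\mathcal F$-split resolution of a $C$-module is an exact complex $\cdots\to L_1\to L_0\to M\to0$ of $C$-modules that is split as a complex in $\mathcal F$. For a monoid $B$ in $\mathcal F$ and a $B$-bimodule $M$, $\mathcal HH^p(B,M)\in\mathcal F$ is the degree $p$ cohomology of the Hochschild cochain complex with terms $\mathcal H(B^{\otimes p},M)$, where $\mathcal H$ is the internal hom of $\mathcal F$, that is, $\mathcal H(F,M)(x)=\mathrm{Hom}_{\mathcal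 F}(F,M(x\diamond-))$. **Theorem.** Let $A$ be a tensor idempotent commutative monoid in $\mathcal F$, let $n\ge0$, let $C=A[u_1,\dots,u_n,v_1,\dots,v_n]$ and $\alpha_i=u_i-v_i$ for $i=1,\dots,n$. 1. If $A\neq0$, then $\alpha=(\alpha_1,\dots,\alpha_n)$ is a regular sequence for $C$. The morphism $A_n\otimes A_n\to C$ given by $(p,q)\mapsto p(u)\times q(v)$ is an isomorphism; under it, the product $\mu_{A_n}$ corresponds to the morphism of monoids $C\to A_n$ that is the identity on $A$ and maps $u_i$ and $v_i$ to $t_i$; and this morphism induces an isomorphism of $C$-modules $C/C\langle\alpha\rangle\cong A_n$. The augmented Koszul complex $$0\to K_n^n(C)\xrightarrow{d}\cdots\xrightarrow{d}K_2^n(C)\xrightarrow{d}K_1^n(C)\xrightarrow{d}C\xrightarrow{\mu_{A_n}}A_n\to0$$ is an $\mathcal F$-split resolution of $A_n$ by $\mathcal F$-projective $C$-modules. 2. For every $A_n$-bimodule $M$ and every $p>n$, $\mathcal HH^p(A_n,M)=0$. For $0\le p\le n$, $\mathcal HH^p(A_n,A_n)\cong K^n_p(A_n)=A_n^{\binom np}$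 in $\mathcal F$. -/

import Mathlib

open CategoryTheory MonoidalCategory

universe r u v t s t₁ t₂ t₃

namespace FunctorMonoid

section LinearFunctors

variable (R : Type r) [CommRing R] (X : Type u) [Category.{v} X] [Preadditive X] [Linear R X]

/-- An object of the category `𝓕` of `R`-linear functors from `X` to `R`-modules. No smallness of
`X` is needed: constructions that involve all the objects of `X` may enlarge the universe. -/
structure LinFun where
  toFunctor : X ⥤ ModuleCat.{t} R
  additive : toFunctor.Additive
  linear : toFunctor.Linear R

variable {R X}

namespace LinFun

/-- The value `F(x)`. -/
abbrev obj (F : LinFun.{r, u, v, t} R X) (x : X) : ModuleCat.{t} R := F.toFunctor.obj x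

/-- The `R`-linear map `F(φ) : F(x) → F(y)`. -/
def map (F : LinFun.{r, u, v, t} R X) {x y : X} (φ : x ⟶ y) : F.obj x →ₗ[R] F.obj y :=
  (F.toFunctor.map φ).hom

theorem map_id (F : LinFun.{r, u, v, t} R X) (x : X) (a : F.obj x) : F.map (𝟙 x) a = a := by
  simp [map]

theorem map_comp (F : LinFun.{r, u, v, t} R X) {x y z : X} (φ : x ⟶ y) (ψ : y ⟶ z)
    (a : F.obj x) : F.map (φ ≫ ψ) a = F.map ψ (F.map φ a) := by
  simp [map]

theorem map_add (F : LinFun.{r, u, v, t} R X) {x y : X} (φ ψ : x ⟶ y) (a : F.obj x) :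
    F.map (φ + ψ) a = F.map φ a + F.map ψ a := by
  have := F.additive
  simp [map, Functor.map_add]

theorem map_smul (F : LinFun.{r, u, v, t} R X) {x y : X} (c : R) (φ : x ⟶ y) (a : F.obj x) :
    F.map (c • φ) a = c • F.map φ a := by
  have := F.additive
  have := F.linear
  simp [map, Functor.map_smul]

/-- Build an `R`-linear functor from its values and its action on arrows. -/
def of (V : X → Type t) [∀ x, AddCommGroup (V x)] [∀ x, Module R (V x)]
    (m : ∀ {x y : X}, (x ⟶ y) → (V x →ₗ[R] V y))
    (m_id : ∀ (x : X) (a : V x), m (𝟙 x) a = a)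
    (m_comp : ∀ {x y z : X} (φ : x ⟶ y) (ψ : y ⟶ z) (a : V x), m (φ ≫ ψ) a = m ψ (m φ a))
    (m_add : ∀ {x y : X} (φ ψ : x ⟶ y) (a : V x), m (φ + ψ) a = m φ a + m ψ a)
    (m_smul : ∀ {x y : X} (c : R) (φ : x ⟶ y) (a : V x), m (c • φ) a = c • m φ a) :
    LinFun.{r, u, v, t} R X where
  toFunctor :=
    { obj := fun x => ModuleCat.of R (V x)
      map := fun φ => ModuleCat.ofHom (m φ)
      map_id := fun x => by ext a; exact m_id x a
      map_comp := fun φ ψ => by ext a; exact m_comp φ ψ a }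
  additive := ⟨fun {_ _ φ ψ} => by ext a; exact m_add φ ψ a⟩
  linear := ⟨fun φ c => by ext a; exact m_smul c φ a⟩

/-- Morphisms of `𝓕`: natural transformations. -/
@[ext]
structure Hom (F : LinFun.{r, u, v, t₁} R X) (G : LinFun.{r, u, v, t₂} R X) where
  app : ∀ x : X, F.obj x →ₗ[R] G.obj x
  naturality : ∀ {x y : X} (φ : x ⟶ y) (a : F.obj x), app y (F.map φ a) = G.map φ (app x a)

/-- The morphism `f` is an isomorphism of functors: its components are bijective. -/
def Hom.IsIso {F : LinFun.{r, u, v, t₁} R X} {G : LinFun.{r, u, v, t₂} R X} (f : Hom F G) :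
    Prop :=
  ∀ x : X, Function.Bijective (f.app x)

instance : Category (LinFun.{r, u, v, t} R X) where
  Hom F G := Hom F G
  id F := ⟨fun _ => LinearMap.id, fun _ _ => rfl⟩
  comp f g := ⟨fun x => g.app x ∘ₗ f.app x, fun φ a => by
    simp [f.naturality, g.naturality]⟩

/-- `F` seen in a larger universe. -/
def ulift (F : LinFun.{r, u, v, t} R X) : LinFun.{r, u, v, max s t} R X :=
  of (fun x => ULift.{s} (F.obj x))
    (fun φ => ULift.moduleEquiv.symm.toLinearMap ∘ₗ F.map φ ∘ₗ ULift.moduleEquiv.toLinearMap)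
    (fun x a => by ext; exact F.map_id x a.down)
    (fun φ ψ a => by ext; exact F.map_comp φ ψ a.down)
    (fun φ ψ a => by ext; exact F.map_add φ ψ a.down)
    (fun c φ a => by ext; exact F.map_smul c φ a.down)

/-- The direct sum of copies of `F` indexed by a finite type `ι`. -/
def copies (F : LinFun.{r, u, v, t} R X) (ι : Type) [Finite ι] : LinFun.{r, u, v, t} R X :=
  of (fun x => ι → F.obj x)
    (fun φ => LinearMap.pi fun i => F.map φ ∘ₗ LinearMap.proj i)
    (fun x a => by ext i; exact F.map_id x (a i))
    (fun φ ψ a => by ext i; exact F.map_comp φ ψ (a i))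
    (fun φ ψ a => by ext i; exact F.map_add φ ψ (a i))
    (fun c φ a => by ext i; exact F.map_smul c φ (a i))

/-- The functor of polynomials `F[t_i : i ∈ σ]`. A polynomial with coefficients in the module
`F(x)` is the finitely supported function sending a multi-index to its coefficient. -/
noncomputable def poly (F : LinFun.{r, u, v, t} R X) (σ : Type) : LinFun.{r, u, v, t} R X :=
  of (fun x => (σ →₀ ℕ) →₀ F.obj x)
    (fun φ => Finsupp.mapRange.linearMap (F.map φ))
    (fun x a => by ext i; exact F.map_id x (a i))
    (fun φ ψ a => by ext i; exact F.map_comp φ ψ (a i))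
    (fun φ ψ a => by ext i; exact F.map_add φ ψ (a i))
    (fun c φ a => by ext i; exact F.map_smul c φ (a i))

end LinFun

end LinearFunctors

section TensorProduct

variable {R : Type r} [CommRing R] {X : Type u} [Category.{v} X] [Preadditive X] [Linear R X]
  [MonoidalCategory X]

/-- A natural `R`-bilinear pairing `F(x) × G(y) → H(x ⋄ y)`. By the universal property of the
tensor product of `𝓕`, this is the same thing as a morphism `F ⊗ G ⟶ H`, see `Pairing.desc`. -/
structure Pairing (F : LinFun.{r, u, v, t₁} R X) (G : LinFun.{r, u, v, t₂} R X)
    (H : LinFun.{r, u, v, t₃} R X) where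
  toFun : ∀ x y : X, F.obj x →ₗ[R] G.obj y →ₗ[R] H.obj (x ⊗ y)
  naturality : ∀ {x x' y y' : X} (φ : x ⟶ x') (ψ : y ⟶ y') (a : F.obj x) (b : G.obj y),
    toFun x' y' (F.map φ a) (G.map ψ b) = H.map (φ ⊗ₘ ψ) (toFun x y a b)

open scoped TensorProduct in
/-- The direct sum over all pairs of objects `x`, `y` of
`X(x ⋄ y, z) ⊗ (F(x) ⊗ G(y))`. -/
abbrev DaySum (F : LinFun.{r, u, v, t₁} R X) (G : LinFun.{r, u, v, t₂} R X) (z : X) : Type _ :=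
  DirectSum (X × X) fun p => (p.1 ⊗ p.2 ⟶ z) ⊗[R] (F.obj p.1 ⊗[R] G.obj p.2)

open scoped TensorProduct Classical in
/-- The generator `θ ⊗ (a ⊗ b)`. -/
noncomputable def DaySum.gen (F : LinFun.{r, u, v, t₁} R X) (G : LinFun.{r, u, v, t₂} R X)
    {z x y : X} (θ : x ⊗ y ⟶ z) (a : F.obj x) (b : G.obj y) : DaySum F G z :=
  DirectSum.lof R (X × X) (fun p => (p.1 ⊗ p.2 ⟶ z) ⊗[R] (F.obj p.1 ⊗[R] G.obj p.2)) (x, y)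
    (θ ⊗ₜ (a ⊗ₜ b))

/-- The coend relations `((φ ⋄ ψ) ≫ θ) ⊗ (a ⊗ b) = θ ⊗ (F(φ)(a) ⊗ G(ψ)(b))`. -/
def DaySum.rel (F : LinFun.{r, u, v, t₁} R X) (G : LinFun.{r, u, v, t₂} R X) (z : X) :
    Submodule R (DaySum F G z) :=
  Submodule.span R
    {w | ∃ (x x' y y' : X) (φ : x ⟶ x') (ψ : y ⟶ y') (θ : x' ⊗ y' ⟶ z) (a : F.obj x)
      (b : G.obj y),
      w = DaySum.gen F G ((φ ⊗ₘ ψ) ≫ θ) a b - DaySum.gen F G θ (F.map φ a) (G.map ψ b)}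

open scoped TensorProduct in
/-- Two linear maps that agree on the generators are equal. -/
theorem DaySum.hom_ext {F : LinFun.{r, u, v, t₁} R X} {G : LinFun.{r, u, v, t₂} R X} {z : X}
    {W : Type*} [AddCommGroup W] [Module R W] {f g : DaySum F G z →ₗ[R] W}
    (h : ∀ (x y : X) (θ : x ⊗ y ⟶ z) (a : F.obj x) (b : G.obj y),
      f (DaySum.gen F G θ a b) = g (DaySum.gen F G θ a b)) : f = g := by
  classical
  refine DirectSum.linearMap_ext R fun p => TensorProduct.ext' fun θ w => ?_
  induction w using TensorProduct.induction_on with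
  | zero => simp
  | tmul a b =>
    have := h p.1 p.2 θ a b
    unfold DaySum.gen at this
    rw [LinearMap.comp_apply, LinearMap.comp_apply]
    convert this
  | add w w' hw hw' => simp only [TensorProduct.tmul_add, map_add, hw, hw']

open scoped TensorProduct Classical in
/-- The map `θ ⊗ (a ⊗ b) ↦ (θ ≫ ξ) ⊗ (a ⊗ b)` induced by an arrow `ξ : z ⟶ z'`. -/
noncomputable def DaySum.map (F : LinFun.{r, u, v, t₁} R X) (G : LinFun.{r, u, v, t₂} R X)
    {z z' : X} (ξ : z ⟶ z') : DaySum F G z →ₗ[R] DaySum F G z' :=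
  DirectSum.toModule R (X × X) _ fun p =>
    DirectSum.lof R (X × X) (fun p => (p.1 ⊗ p.2 ⟶ z') ⊗[R] (F.obj p.1 ⊗[R] G.obj p.2)) p ∘ₗ
      TensorProduct.map (Linear.rightComp R (p.1 ⊗ p.2) ξ) LinearMap.id

theorem DaySum.map_gen (F : LinFun.{r, u, v, t₁} R X) (G : LinFun.{r, u, v, t₂} R X)
    {x y z z' : X} (ξ : z ⟶ z') (θ : x ⊗ y ⟶ z) (a : F.obj x) (b : G.obj y) :
    DaySum.map F G ξ (DaySum.gen F G θ a b) = DaySum.gen F G (θ ≫ ξ) a b := by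
  classical
  unfold DaySum.map DaySum.gen
  rw [DirectSum.toModule_lof]
  simp

theorem DaySum.gen_add (F : LinFun.{r, u, v, t₁} R X) (G : LinFun.{r, u, v, t₂} R X)
    {x y z : X} (θ θ' : x ⊗ y ⟶ z) (a : F.obj x) (b : G.obj y) :
    DaySum.gen F G (θ + θ') a b = DaySum.gen F G θ a b + DaySum.gen F G θ' a b := by
  simp [DaySum.gen, TensorProduct.add_tmul]

theorem DaySum.gen_smul (F : LinFun.{r, u, v, t₁} R X) (G : LinFun.{r, u, v, t₂} R X)
    {x y z : X} (c : R) (θ : x ⊗ y ⟶ z) (a : F.obj x) (b : G.obj y) :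
    DaySum.gen F G (c • θ) a b = c • DaySum.gen F G θ a b := by
  unfold DaySum.gen
  rw [← TensorProduct.smul_tmul', map_smul]

/-- The value at `z` of the tensor product `F ⊗ G` of `𝓕` (Day convolution): the coend
`∫^{x,y} X(x ⋄ y, z) ⊗ F(x) ⊗ G(y)`. -/
abbrev DayObj (F : LinFun.{r, u, v, t₁} R X) (G : LinFun.{r, u, v, t₂} R X) (z : X) : Type _ :=
  DaySum F G z ⧸ DaySum.rel F G z

/-- The arrows of the functor `F ⊗ G`. -/
noncomputable def DayObj.map (F : LinFun.{r, u, v, t₁} R X) (G : LinFun.{r, u, v, t₂} R X)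
    {z z' : X} (ξ : z ⟶ z') : DayObj F G z →ₗ[R] DayObj F G z' :=
  Submodule.mapQ _ _ (DaySum.map F G ξ) (by
    refine Submodule.span_le.2 ?_
    rintro w ⟨x, x', y, y', φ, ψ, θ, a, b, rfl⟩
    refine Submodule.subset_span ⟨x, x', y, y', φ, ψ, θ ≫ ξ, a, b, ?_⟩
    rw [map_sub, DaySum.map_gen, DaySum.map_gen, Category.assoc])

/-- The tensor product `F ⊗ G` of `𝓕`. -/
noncomputable def LinFun.tensor (F : LinFun.{r, u, v, t₁} R X) (G : LinFun.{r, u, v, t₂} R X) :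
    LinFun.{r, u, v, max u v t₁ t₂} R X :=
  LinFun.of (fun z => DayObj F G z) (fun ξ => DayObj.map F G ξ)
    (fun z a => by
      obtain ⟨a, rfl⟩ := Submodule.mkQ_surjective _ a
      refine congrArg (Submodule.mkQ _) (LinearMap.congr_fun (f := DaySum.map F G (𝟙 z))
        (g := LinearMap.id) (DaySum.hom_ext fun x y θ a b => ?_) a)
      rw [DaySum.map_gen, Category.comp_id, LinearMap.id_apply])
    (fun φ ψ a => by
      obtain ⟨a, rfl⟩ := Submodule.mkQ_surjective _ a
      refine congrArg (Submodule.mkQ _) (LinearMap.congr_fun (f := DaySum.map F G (φ ≫ ψ))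
        (g := DaySum.map F G ψ ∘ₗ DaySum.map F G φ) (DaySum.hom_ext fun x y θ a b => ?_) a)
      rw [LinearMap.comp_apply, DaySum.map_gen, DaySum.map_gen, DaySum.map_gen, Category.assoc])
    (fun φ ψ a => by
      obtain ⟨a, rfl⟩ := Submodule.mkQ_surjective _ a
      refine congrArg (Submodule.mkQ _) (LinearMap.congr_fun (f := DaySum.map F G (φ + ψ))
        (g := DaySum.map F G φ + DaySum.map F G ψ) (DaySum.hom_ext fun x y θ a b => ?_) a)
      rw [LinearMap.add_apply, DaySum.map_gen, DaySum.map_gen, DaySum.map_gen,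
        Preadditive.comp_add, DaySum.gen_add])
    (fun c φ a => by
      obtain ⟨a, rfl⟩ := Submodule.mkQ_surjective _ a
      refine congrArg (Submodule.mkQ _) (LinearMap.congr_fun (f := DaySum.map F G (c • φ))
        (g := c • DaySum.map F G φ) (DaySum.hom_ext fun x y θ a b => ?_) a)
      rw [LinearMap.smul_apply, DaySum.map_gen, DaySum.map_gen, Linear.comp_smul,
        DaySum.gen_smul])

namespace Pairing

variable {F : LinFun.{r, u, v, t₁} R X} {G : LinFun.{r, u, v, t₂} R X}
  {H : LinFun.{r, u, v, t₃} R X}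

open scoped Classical in
/-- `θ ⊗ (a ⊗ b) ↦ H(θ)(P(a, b))`, on the direct sum. -/
noncomputable def sumDesc (P : Pairing F G H) (z : X) : DaySum F G z →ₗ[R] H.obj z :=
  DirectSum.toModule R (X × X) _ fun p =>
    TensorProduct.lift
      { toFun := fun θ => H.map θ ∘ₗ TensorProduct.lift (P.toFun p.1 p.2)
        map_add' := fun θ θ' => by ext1; ext a b; simp [H.map_add]
        map_smul' := fun c θ => by ext1; ext a b; simp [H.map_smul] }

theorem sumDesc_gen (P : Pairing F G H) {z x y : X} (θ : x ⊗ y ⟶ z) (a : F.obj x)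
    (b : G.obj y) : P.sumDesc z (DaySum.gen F G θ a b) = H.map θ (P.toFun x y a b) := by
  classical
  unfold sumDesc DaySum.gen
  rw [DirectSum.toModule_lof]
  simp

/-- The component at `z` of the morphism `F ⊗ G ⟶ H` that corresponds to the pairing. -/
noncomputable def descApp (P : Pairing F G H) (z : X) : DayObj F G z →ₗ[R] H.obj z :=
  (DaySum.rel F G z).liftQ (P.sumDesc z) (by
    refine Submodule.span_le.2 ?_
    rintro w ⟨x, x', y, y', φ, ψ, θ, a, b, rfl⟩
    simp [sumDesc_gen, P.naturality, H.map_comp])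

/-- The morphism `F ⊗ G ⟶ H` that corresponds to the pairing `P`. It sends the class of
`θ ⊗ (a ⊗ b)` to `H(θ)(P(a, b))`. -/
noncomputable def desc (P : Pairing F G H) : LinFun.Hom (F.tensor G) H where
  app := P.descApp
  naturality {z z'} ξ w := by
    obtain ⟨w, rfl⟩ := Submodule.mkQ_surjective _ w
    refine LinearMap.congr_fun (f := P.sumDesc z' ∘ₗ DaySum.map F G ξ)
      (g := H.map ξ ∘ₗ P.sumDesc z) (DaySum.hom_ext fun x y θ a b => ?_) w
    rw [LinearMap.comp_apply, LinearMap.comp_apply, DaySum.map_gen, sumDesc_gen, sumDesc_gen,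
      H.map_comp]

end Pairing

end TensorProduct

section Monoids

variable (R : Type r) [CommRing R] (X : Type u) [Category.{v} X] [Preadditive X] [Linear R X]
  [MonoidalCategory X]

/-- A monoid in `𝓕`, given by its product `(a, b) ↦ a × b` from `A(x) × A(y)` to `A(x ⋄ y)`,
that is, a morphism `A ⊗ A ⟶ A`, and by its unit element `ε ∈ A(𝟏)`, that is, a morphism
`X(𝟏, _) ⟶ A`. -/
structure FMon extends LinFun.{r, u, v, t} R X where
  mul : Pairing toLinFun toLinFun toLinFun
  one : toLinFun.obj (𝟙_ X)
  mul_assoc : ∀ {x y z : X} (a : toLinFun.obj x) (b : toLinFun.obj y) (c : toLinFun.obj z),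
    toLinFun.map (α_ x y z).hom (mul.toFun _ _ (mul.toFun _ _ a b) c) =
      mul.toFun _ _ a (mul.toFun _ _ b c)
  one_mul : ∀ {x : X} (a : toLinFun.obj x), toLinFun.map (λ_ x).hom (mul.toFun _ _ one a) = a
  mul_one : ∀ {x : X} (a : toLinFun.obj x), toLinFun.map (ρ_ x).hom (mul.toFun _ _ a one) = a

variable {R X}

namespace FMon

/-- The product `a × b`. -/
abbrev times (A : FMon.{r, u, v, t} R X) {x y : X} (a : A.obj x) (b : A.obj y) : A.obj (x ⊗ y) :=
  A.mul.toFun x y a b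

/-- The monoid `A` is tensor idempotent: `μ_A : A ⊗ A ⟶ A` is an isomorphism. -/
def IsTensorIdempotent (A : FMon.{r, u, v, t} R X) : Prop := A.mul.desc.IsIso

/-- Membership in the commutant `CA(x)`. -/
def InCommutant [BraidedCategory X] (A : FMon.{r, u, v, t} R X) {x : X} (b : A.obj x) : Prop :=
  ∀ (y : X) (a : A.obj y), A.times a b = A.map (β_ x y).hom (A.times b a)

/-- The monoid `A` is commutative. -/
def IsCommutative [BraidedCategory X] (A : FMon.{r, u, v, t} R X) : Prop :=
  ∀ (x : X) (b : A.obj x), A.InCommutant b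

end FMon

/-- A morphism of monoids of `𝓕`. -/
structure FMon.Hom (A : FMon.{r, u, v, t} R X) (B : FMon.{r, u, v, t} R X) extends
    LinFun.Hom A.toLinFun B.toLinFun where
  map_one : app (𝟙_ X) A.one = B.one
  map_mul : ∀ {x y : X} (a : A.obj x) (b : A.obj y),
    app (x ⊗ y) (A.times a b) = B.times (app x a) (app y b)

/-- A (left) module over the monoid `A`. -/
structure FMod (A : FMon.{r, u, v, t} R X) extends LinFun.{r, u, v, s} R X where
  act : Pairing A.toLinFun toLinFun toLinFun
  act_assoc : ∀ {x y z : X} (a : A.obj x) (b : A.obj y) (m : toLinFun.obj z),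
    toLinFun.map (α_ x y z).hom (act.toFun _ _ (A.times a b) m) =
      act.toFun _ _ a (act.toFun _ _ b m)
  one_act : ∀ {x : X} (m : toLinFun.obj x),
    toLinFun.map (λ_ x).hom (act.toFun _ _ A.one m) = m

/-- A bimodule over the monoid `A`. -/
structure FBimod (A : FMon.{r, u, v, t} R X) extends FMod.{r, u, v, t, s} A where
  ract : Pairing toLinFun A.toLinFun toLinFun
  ract_assoc : ∀ {x y z : X} (m : toLinFun.obj x) (a : A.obj y) (b : A.obj z),
    toLinFun.map (α_ x y z).hom (ract.toFun _ _ (ract.toFun _ _ m a) b) =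
      ract.toFun _ _ m (A.times a b)
  ract_one : ∀ {x : X} (m : toLinFun.obj x),
    toLinFun.map (ρ_ x).hom (ract.toFun _ _ m A.one) = m
  act_ract : ∀ {x y z : X} (a : A.obj x) (m : toLinFun.obj y) (b : A.obj z),
    toLinFun.map (α_ x y z).hom (ract.toFun _ _ (act.toFun _ _ a m) b) =
      act.toFun _ _ a (ract.toFun _ _ m b)

namespace FMod

variable {A : FMon.{r, u, v, t} R X}

/-- The product `a × m`. -/
abbrev smul (M : FMod.{r, u, v, t, s} A) {x y : X} (a : A.obj x) (m : M.obj y) : M.obj (x ⊗ y) :=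
  M.act.toFun x y a m

/-- Morphisms of `A`-modules. -/
@[ext]
structure Hom (M N : FMod.{r, u, v, t, s} A) extends LinFun.Hom M.toLinFun N.toLinFun where
  map_smul : ∀ {x y : X} (a : A.obj x) (m : M.obj y),
    app (x ⊗ y) (M.smul a m) = N.smul a (app y m)

instance : Category (FMod.{r, u, v, t, s} A) where
  Hom M N := Hom M N
  id M := ⟨𝟙 M.toLinFun, fun _ _ => rfl⟩
  comp {M N P} f g := ⟨CategoryStruct.comp (X := M.toLinFun) (Y := N.toLinFun)
    (Z := P.toLinFun) f.toHom g.toHom, fun a m =>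
      (congrArg (g.app _) (f.map_smul a m)).trans (g.map_smul a _)⟩

variable (A) in
/-- The restriction functor `𝓡_A` from `A`-modules to `𝓕`. -/
def restr : FMod.{r, u, v, t, s} A ⥤ LinFun.{r, u, v, s} R X where
  obj M := M.toLinFun
  map f := f.toHom

/-- The action on a direct sum of copies of `M`. -/
def copiesAct (M : FMod.{r, u, v, t, s} A) (ι : Type) (x y : X) :
    A.obj x →ₗ[R] (ι → M.obj y) →ₗ[R] (ι → M.obj (x ⊗ y)) :=
  LinearMap.mk₂ R (fun a m i => M.smul a (m i))
    (fun a a' m => by funext i; simp [smul]) (fun c a m => by funext i; simp [smul])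
    (fun a m m' => by funext i; simp [smul]) (fun c a m => by funext i; simp [smul])

/-- The direct sum of copies of `M` indexed by a finite type `ι`. -/
def copies (M : FMod.{r, u, v, t, s} A) (ι : Type) [Finite ι] : FMod.{r, u, v, t, s} A where
  toLinFun := M.toLinFun.copies ι
  act :=
    { toFun := fun x y => copiesAct M ι x y
      naturality := fun φ ψ a m => by
        funext i; exact M.act.naturality φ ψ a (m i) }
  act_assoc := fun a b m => by funext i; exact M.act_assoc a b (m i)
  one_act := fun m => by funext i; exact M.one_act (m i)

/-- The projection of a direct sum of copies of `M` onto the summand of index `i`. -/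
def copiesProj (M : FMod.{r, u, v, t, s} A) {ι : Type} [Finite ι] (i : ι) : M.copies ι ⟶ M :=
  ⟨⟨fun _ => LinearMap.proj i, fun _ _ => rfl⟩, fun _ _ => rfl⟩

end FMod

/-- The monoid `A` as a bimodule over itself. -/
def FMon.selfBimod (A : FMon.{r, u, v, t} R X) : FBimod.{r, u, v, t, t} A where
  toLinFun := A.toLinFun
  act := A.mul
  act_assoc := A.mul_assoc
  one_act := A.one_mul
  ract := A.mul
  ract_assoc := A.mul_assoc
  ract_one := A.mul_one
  act_ract := A.mul_assoc

/-- The monoid `A` as a module over itself. -/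
abbrev FMon.self (A : FMon.{r, u, v, t} R X) : FMod.{r, u, v, t, t} A := A.selfBimod.toFMod

/-- Restriction of modules along a morphism of monoids. -/
def FMod.restrictAlong {A B : FMon.{r, u, v, t} R X} (f : FMon.Hom A B)
    (M : FMod.{r, u, v, t, s} B) : FMod.{r, u, v, t, s} A where
  toLinFun := M.toLinFun
  act :=
    { toFun := fun x y => M.act.toFun x y ∘ₗ f.app x
      naturality := fun φ ψ a m => by
        simp only [LinearMap.comp_apply, f.naturality]; exact M.act.naturality φ ψ _ m }
  act_assoc := fun a b m => by
    simp only [LinearMap.comp_apply, f.map_mul]; exact M.act_assoc _ _ m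
  one_act := fun m => by
    simp only [LinearMap.comp_apply, f.map_one]; exact M.one_act m

/-- A morphism of monoids `A ⟶ B` as a morphism of `A`-modules. -/
def FMon.Hom.toModHom {A B : FMon.{r, u, v, t} R X} (f : FMon.Hom A B) :
    A.self ⟶ B.self.restrictAlong f :=
  ⟨f.toHom, fun a m => f.map_mul a m⟩

end Monoids

section Submodules

variable {R : Type r} [CommRing R] {X : Type u} [Category.{v} X] [Preadditive X] [Linear R X]
  [MonoidalCategory X] {A : FMon.{r, u, v, t} R X}

/-- A submodule of an `A`-module. -/
structure FSub (M : FMod.{r, u, v, t, s} A) where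
  carrier : ∀ x : X, Submodule R (M.obj x)
  map_mem : ∀ {x y : X} (φ : x ⟶ y) (m : M.obj x), m ∈ carrier x → M.map φ m ∈ carrier y
  smul_mem : ∀ {x y : X} (a : A.obj x) (m : M.obj y), m ∈ carrier y →
    M.smul a m ∈ carrier (x ⊗ y)

/-- The submodule of `M` generated by a set `Γ` of elements of `M(x₀)`: the intersection of all
the submodules that contain it. -/
def FSub.span (M : FMod.{r, u, v, t, s} A) (x₀ : X) (Γ : Set (M.obj x₀)) : FSub M where
  carrier x := sInf {V | ∃ N : FSub M, Γ ⊆ N.carrier x₀ ∧ V = N.carrier x}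
  map_mem {x y} φ m hm := by
    rw [Submodule.mem_sInf] at hm ⊢
    rintro V ⟨N, hN, rfl⟩
    exact N.map_mem φ m (hm _ ⟨N, hN, rfl⟩)
  smul_mem a m hm := by
    rw [Submodule.mem_sInf] at hm ⊢
    rintro V ⟨N, hN, rfl⟩
    exact N.smul_mem a m (hm _ ⟨N, hN, rfl⟩)

/-- The arrows of the quotient `M / N`. -/
def FMod.quotMap (M : FMod.{r, u, v, t, s} A) (N : FSub M) {x y : X} (φ : x ⟶ y) :
    (M.obj x ⧸ N.carrier x) →ₗ[R] (M.obj y ⧸ N.carrier y) :=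
  (N.carrier x).mapQ (N.carrier y) (M.map φ) (fun m hm => N.map_mem φ m hm)

/-- The action of `A` on the quotient `M / N`. -/
def FMod.quotAct (M : FMod.{r, u, v, t, s} A) (N : FSub M) (x y : X) :
    A.obj x →ₗ[R] (M.obj y ⧸ N.carrier y) →ₗ[R] (M.obj (x ⊗ y) ⧸ N.carrier (x ⊗ y)) where
  toFun a := (N.carrier y).mapQ (N.carrier (x ⊗ y)) (M.act.toFun x y a)
    (fun m hm => N.smul_mem a m hm)
  map_add' a b := by
    refine LinearMap.ext fun m => ?_
    obtain ⟨m, rfl⟩ := Submodule.mkQ_surjective _ m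
    simp
  map_smul' c a := by
    refine LinearMap.ext fun m => ?_
    obtain ⟨m, rfl⟩ := Submodule.mkQ_surjective _ m
    simp

/-- The quotient module `M / N`. -/
def FMod.quot (M : FMod.{r, u, v, t, s} A) (N : FSub M) : FMod.{r, u, v, t, s} A where
  toLinFun := LinFun.of (fun x => M.obj x ⧸ N.carrier x) (fun φ => M.quotMap N φ)
    (fun x a => by
      obtain ⟨a, rfl⟩ := Submodule.mkQ_surjective _ a
      simp [quotMap, LinFun.map_id])
    (fun φ ψ a => by
      obtain ⟨a, rfl⟩ := Submodule.mkQ_surjective _ a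
      simp [quotMap, LinFun.map_comp])
    (fun φ ψ a => by
      obtain ⟨a, rfl⟩ := Submodule.mkQ_surjective _ a
      simp [quotMap, LinFun.map_add])
    (fun c φ a => by
      obtain ⟨a, rfl⟩ := Submodule.mkQ_surjective _ a
      simp [quotMap, LinFun.map_smul])
  act :=
    { toFun := fun x y => M.quotAct N x y
      naturality := fun {x x' y y'} φ ψ a m =>
        Submodule.Quotient.induction_on (C := fun m : M.obj y ⧸ N.carrier y =>
          M.quotAct N x' y' (A.map φ a) (M.quotMap N ψ m) =
            M.quotMap N (φ ⊗ₘ ψ) (M.quotAct N x y a m)) _ m fun m =>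
          congrArg (Submodule.mkQ (N.carrier (x' ⊗ y'))) (M.act.naturality φ ψ a m) }
  act_assoc := fun {x y z} a b m =>
    Submodule.Quotient.induction_on (C := fun m : M.obj z ⧸ N.carrier z =>
      M.quotMap N (α_ x y z).hom (M.quotAct N _ _ (A.times a b) m) =
        M.quotAct N _ _ a (M.quotAct N _ _ b m)) _ m fun m =>
      congrArg (Submodule.mkQ (N.carrier (x ⊗ (y ⊗ z)))) (M.act_assoc a b m)
  one_act := fun {x} m =>
    Submodule.Quotient.induction_on (C := fun m : M.obj x ⧸ N.carrier x =>
      M.quotMap N (λ_ x).hom (M.quotAct N _ _ A.one m) = m) _ m fun m =>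
      congrArg (Submodule.mkQ (N.carrier x)) (M.one_act m)

/-- The projection `M ⟶ M / N`. -/
def FMod.quotMk (M : FMod.{r, u, v, t, s} A) (N : FSub M) : M ⟶ M.quot N :=
  ⟨⟨fun x => (N.carrier x).mkQ, fun _ _ => rfl⟩, fun _ _ => rfl⟩

/-- The submodule `A⟨α_i : i ∈ J⟩` of `A` generated by elements of `A(𝟏)`. -/
abbrev FMon.ideal (A : FMon.{r, u, v, t} R X) {n : ℕ} (α : Fin n → A.obj (𝟙_ X))
    (J : Set (Fin n)) : FSub A.self :=
  FSub.span A.self (𝟙_ X) (α '' J)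

/-- The element `a ∈ A(𝟏)` is `M`-regular. -/
def FMod.IsRegularElement (M : FMod.{r, u, v, t, s} A) (a : A.obj (𝟙_ X)) : Prop :=
  ∀ (x : X) (m : M.obj x), m ≠ 0 → M.smul a m ≠ 0

/-- The sequence `α_1, …, α_n` of elements of the commutant `CA(𝟏)` is regular. -/
structure FMon.IsRegularSequence [BraidedCategory X] (A : FMon.{r, u, v, t} R X) {n : ℕ}
    (α : Fin n → A.obj (𝟙_ X)) : Prop where
  commutant : ∀ i, A.InCommutant (α i)
  regular : ∀ i, (A.self.quot (A.ideal α {j | j < i})).IsRegularElement (α i)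
  ne_zero : ∃ (x : X) (m : (A.self.quot (A.ideal α Set.univ)).obj x), m ≠ 0

end Submodules

section Koszul

variable {R : Type r} [CommRing R] {X : Type u} [Category.{v} X] [Preadditive X] [Linear R X]
  [MonoidalCategory X]

/-- The subsets of `{1, …, n}` with `p` elements. -/
abbrev KSub (n p : ℕ) : Type := {S : Finset (Fin n) // S.card = p}

/-- The map `b ↦ A(λ_x)(a × b)`, for `a ∈ A(𝟏)`. -/
def FMon.L (A : FMon.{r, u, v, t} R X) (a : A.obj (𝟙_ X)) (x : X) : A.obj x →ₗ[R] A.obj x :=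
  A.map (λ_ x).hom ∘ₗ A.mul.toFun (𝟙_ X) x a

theorem FMon.L_map (A : FMon.{r, u, v, t} R X) (a : A.obj (𝟙_ X)) {x y : X} (φ : x ⟶ y)
    (b : A.obj x) : A.L a y (A.map φ b) = A.map φ (A.L a x b) := by
  have h := A.mul.naturality (𝟙 (𝟙_ X)) φ a b
  rw [A.map_id] at h
  simp only [FMon.L, LinearMap.comp_apply, h, ← LinFun.map_comp]
  simp

theorem FMon.L_mul [BraidedCategory X] (A : FMon.{r, u, v, t} R X) {a : A.obj (𝟙_ X)}
    (ha : A.InCommutant a) {x y : X} (b : A.obj x) (c : A.obj y) :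
    A.L a (x ⊗ y) (A.times b c) = A.times b (A.L a y c) := by
  have h1 := A.mul_assoc a b c
  have h2 := A.mul_assoc b a c
  have h3 := A.mul.naturality (𝟙 x) (λ_ y).hom b (A.times a c)
  have h4 := A.mul.naturality (β_ (𝟙_ X) x).hom (𝟙 y) (A.times a b) c
  have h5 := ha x b
  rw [A.map_id] at h3 h4
  simp only [times] at h1 h2 h3 h4 h5 ⊢
  simp only [FMon.L, LinearMap.comp_apply]
  rw [h3, ← h2, h5, h4, ← h1]
  simp only [← LinFun.map_comp]
  congr 2
  simp

/-- The `A`-module `K_p^n(A)`. -/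
abbrev FMon.koszul (A : FMon.{r, u, v, t} R X) (n p : ℕ) : FMod.{r, u, v, t, t} A :=
  A.self.copies (KSub n p)

/-- The differential `d`, at the object `x`. On the summand of index `{i_1 < ⋯ < i_{p+1}}`, it is
the sum over `k` of `(-1)^(k+1)` times the product by `α_{i_k}` with values in the summand in which
`i_k` is removed. So the component of `d(f)` of index `S` is the sum, over the `i ∉ S`, of
`(-1)^#{j ∈ S | j < i}` times the product by `α_i` of the component of `f` of index `S ∪ {i}`. -/
def FMon.koszulApp (A : FMon.{r, u, v, t} R X) {n : ℕ} (α : Fin n → A.obj (𝟙_ X)) (p : ℕ)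
    (x : X) : (KSub n (p + 1) → A.obj x) →ₗ[R] (KSub n p → A.obj x) :=
  LinearMap.pi fun S => ∑ i : {i : Fin n // i ∉ S.1}, (-1 : ℤ) ^ (S.1.filter (· < i.1)).card •
    (A.L (α i.1) x ∘ₗ LinearMap.proj
      (⟨insert i.1 S.1, by rw [Finset.card_insert_of_notMem i.2, S.2]⟩ : KSub n (p + 1)))

theorem FMon.koszulApp_apply (A : FMon.{r, u, v, t} R X) {n : ℕ} (α : Fin n → A.obj (𝟙_ X))
    (p : ℕ) (x : X) (f : KSub n (p + 1) → A.obj x) (S : KSub n p) :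
    A.koszulApp α p x f S =
      ∑ i : {i : Fin n // i ∉ S.1}, (-1 : ℤ) ^ (S.1.filter (· < i.1)).card •
        A.L (α i.1) x (f ⟨insert i.1 S.1, by rw [Finset.card_insert_of_notMem i.2, S.2]⟩) := by
  simp [koszulApp]

/-- The differential `d : K_{p+1}^n(A) ⟶ K_p^n(A)`. -/
def FMon.koszulD [BraidedCategory X] (A : FMon.{r, u, v, t} R X) {n : ℕ}
    (α : Fin n → A.obj (𝟙_ X)) (hα : ∀ i, A.InCommutant (α i)) (p : ℕ) :
    A.koszul n (p + 1) ⟶ A.koszul n p where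
  app x := A.koszulApp α p x
  naturality {x y} φ f := by
    funext S
    refine (A.koszulApp_apply α p y _ S).trans ?_
    refine Eq.trans ?_ (congrArg (A.map φ) (A.koszulApp_apply α p x f S).symm)
    rw [map_sum]
    refine Finset.sum_congr rfl fun i _ => ?_
    rw [map_zsmul]
    exact congrArg _ (A.L_map (α i.1) φ _)
  map_smul {x y} a f := by
    funext S
    refine (A.koszulApp_apply α p (x ⊗ y) _ S).trans ?_
    refine Eq.trans ?_ (congrArg (A.mul.toFun x y a) (A.koszulApp_apply α p y f S).symm)
    rw [map_sum]
    refine Finset.sum_congr rfl fun i _ => ?_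
    rw [map_zsmul]
    exact congrArg _ (A.L_mul (hα i.1) a _)

end Koszul

section Relative

/-- The object `P` is projective relative to the functor `U`: morphisms from `P` lift along every
morphism `g` such that `U(g)` is a split epimorphism. -/
def IsRelProjective {C : Type*} [Category* C] {D : Type*} [Category* D] (U : C ⥤ D) (P : C) :
    Prop :=
  ∀ ⦃N Q : C⦄ (g : N ⟶ Q), IsSplitEpi (U.map g) → ∀ f : P ⟶ Q, ∃ h : P ⟶ N, h ≫ g = f

variable {R : Type r} [CommRing R] {X : Type u} [Category.{v} X] [Preadditive X] [Linear R X]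
  [MonoidalCategory X] {A : FMon.{r, u, v, t} R X}

/-- The sequence `⋯ → L_2 → L_1 → L_0 → M → 0` of `A`-modules is an `𝓕`-split resolution of `M`:
it is exact (exactness of `A`-modules is pointwise), and its restriction to `𝓕` is split, that is,
there are morphisms `s` of `𝓕` in the opposite direction such that `d ∘ s ∘ d = d`. -/
structure IsFSplitResolution (L : ℕ → FMod.{r, u, v, t, s} A) (d : ∀ p, L (p + 1) ⟶ L p)
    {M : FMod.{r, u, v, t, s} A} (e : L 0 ⟶ M) : Prop where
  exact : ∀ p x, Function.Exact ((d (p + 1)).app x) ((d p).app x)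
  exact_zero : ∀ x, Function.Exact ((d 0).app x) (e.app x)
  surjective : ∀ x, Function.Surjective (e.app x)
  split : ∃ (s₀ : (FMod.restr A).obj M ⟶ (FMod.restr A).obj (L 0))
    (s : ∀ p, (FMod.restr A).obj (L p) ⟶ (FMod.restr A).obj (L (p + 1))),
    (FMod.restr A).map e ≫ s₀ ≫ (FMod.restr A).map e = (FMod.restr A).map e ∧
    ∀ p, (FMod.restr A).map (d p) ≫ s p ≫ (FMod.restr A).map (d p) = (FMod.restr A).map (d p)

end Relative

section Polynomials

variable {R : Type r} [CommRing R] {X : Type u} [Category.{v} X] [Preadditive X] [Linear R X]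
  [MonoidalCategory X]

namespace FMon

variable (A : FMon.{r, u, v, t} R X) (σ : Type)

/-- The product of polynomials `(∑ a_i t^i, ∑ b_j t^j) ↦ ∑ (a_i × b_j) t^(i+j)`. -/
noncomputable def polyMul (x y : X) :
    ((σ →₀ ℕ) →₀ A.obj x) →ₗ[R] ((σ →₀ ℕ) →₀ A.obj y) →ₗ[R] ((σ →₀ ℕ) →₀ A.obj (x ⊗ y)) :=
  Finsupp.lsum R fun i => LinearMap.flip (Finsupp.lsum R fun j =>
    LinearMap.flip ((A.mul.toFun x y).compr₂ (Finsupp.lsingle (i + j))))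

theorem polyMul_single (x y : X) (i j : σ →₀ ℕ) (a : A.obj x) (b : A.obj y) :
    A.polyMul σ x y (Finsupp.single i a) (Finsupp.single j b) =
      Finsupp.single (i + j) (A.times a b) := by
  simp [polyMul]

/-- The arrows of the functor of polynomials. -/
noncomputable abbrev polyMap {x y : X} (φ : x ⟶ y) :
    ((σ →₀ ℕ) →₀ A.obj x) →ₗ[R] ((σ →₀ ℕ) →₀ A.obj y) :=
  Finsupp.mapRange.linearMap (A.map φ)

theorem polyMap_single {x y : X} (φ : x ⟶ y) (i : σ →₀ ℕ) (a : A.obj x) :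
    A.polyMap σ φ (Finsupp.single i a) = Finsupp.single i (A.map φ a) := by
  simp [polyMap]

theorem polyMul_naturality {x x' y y' : X} (φ : x ⟶ x') (ψ : y ⟶ y')
    (p : (σ →₀ ℕ) →₀ A.obj x) (q : (σ →₀ ℕ) →₀ A.obj y) :
    A.polyMul σ x' y' (A.polyMap σ φ p) (A.polyMap σ ψ q) =
      A.polyMap σ (φ ⊗ₘ ψ) (A.polyMul σ x y p q) := by
  induction p using Finsupp.induction_linear with
  | zero => simp
  | add p p' hp hp' => simp only [map_add, LinearMap.add_apply, hp, hp']
  | single i a =>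
    induction q using Finsupp.induction_linear with
    | zero => simp
    | add p p' hp hp' => simp only [map_add, hp, hp']
    | single j b =>
      rw [polyMap_single, polyMap_single, polyMul_single, polyMul_single, polyMap_single]
      exact congrArg _ (A.mul.naturality φ ψ a b)

theorem polyMul_assoc {x y z : X} (p : (σ →₀ ℕ) →₀ A.obj x) (q : (σ →₀ ℕ) →₀ A.obj y)
    (w : (σ →₀ ℕ) →₀ A.obj z) :
    A.polyMap σ (α_ x y z).hom (A.polyMul σ _ _ (A.polyMul σ _ _ p q) w) =
      A.polyMul σ _ _ p (A.polyMul σ _ _ q w) := by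
  induction p using Finsupp.induction_linear with
  | zero => simp
  | add p p' hp hp' => simp only [map_add, LinearMap.add_apply, hp, hp']
  | single i a =>
    induction q using Finsupp.induction_linear with
    | zero => simp
    | add p p' hp hp' => simp only [map_add, LinearMap.add_apply, hp, hp']
    | single j b =>
      induction w using Finsupp.induction_linear with
      | zero => simp
      | add p p' hp hp' => simp only [map_add, hp, hp']
      | single k c =>
        rw [polyMul_single, polyMul_single, polyMul_single, polyMul_single, polyMap_single,
          add_assoc]
        exact congrArg _ (A.mul_assoc a b c)

theorem polyMul_one_left {x : X} (p : (σ →₀ ℕ) →₀ A.obj x) :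
    A.polyMap σ (λ_ x).hom (A.polyMul σ _ _ (Finsupp.single 0 A.one) p) = p := by
  induction p using Finsupp.induction_linear with
  | zero => simp
  | add p p' hp hp' => simp only [map_add, hp, hp']
  | single i a =>
    rw [polyMul_single, polyMap_single, zero_add]
    exact congrArg _ (A.one_mul a)

theorem polyMul_one_right {x : X} (p : (σ →₀ ℕ) →₀ A.obj x) :
    A.polyMap σ (ρ_ x).hom (A.polyMul σ _ _ p (Finsupp.single 0 A.one)) = p := by
  induction p using Finsupp.induction_linear with
  | zero => simp
  | add p p' hp hp' => simp only [map_add, LinearMap.add_apply, hp, hp']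
  | single i a =>
    rw [polyMul_single, polyMap_single, add_zero]
    exact congrArg _ (A.mul_one a)

/-- The monoid of polynomials `A[t_i : i ∈ σ]`. -/
noncomputable def poly : FMon.{r, u, v, t} R X where
  toLinFun := A.toLinFun.poly σ
  mul :=
    { toFun := A.polyMul σ
      naturality := A.polyMul_naturality σ }
  one := (Finsupp.single 0 A.one : (σ →₀ ℕ) →₀ A.obj (𝟙_ X))
  mul_assoc := A.polyMul_assoc σ
  one_mul := A.polyMul_one_left σ
  mul_one := A.polyMul_one_right σ

/-- The variable `t_i` of `A[t_i : i ∈ σ]`, as the element `ε t_i` of the value at `𝟏`. -/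
noncomputable def polyVar {σ : Type} (i : σ) : (A.poly σ).obj (𝟙_ X) :=
  (Finsupp.single (Finsupp.single i 1) A.one : (σ →₀ ℕ) →₀ A.obj (𝟙_ X))

variable {σ} in
/-- Renaming the variables of a polynomial, at the object `x`. -/
noncomputable def renameApp {τ : Type} (f : σ → τ) (x : X) :
    ((σ →₀ ℕ) →₀ A.obj x) →ₗ[R] ((τ →₀ ℕ) →₀ A.obj x) :=
  Finsupp.lmapDomain (A.obj x) R (Finsupp.mapDomain f)

theorem renameApp_single {σ τ : Type} (f : σ → τ) (x : X) (i : σ →₀ ℕ) (a : A.obj x) :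
    A.renameApp f x (Finsupp.single i a) = Finsupp.single (i.mapDomain f) a := by
  simp [renameApp]

theorem renameApp_naturality {σ τ : Type} (f : σ → τ) {x y : X} (φ : x ⟶ y)
    (p : (σ →₀ ℕ) →₀ A.obj x) :
    A.renameApp f y (A.polyMap σ φ p) = A.polyMap τ φ (A.renameApp f x p) := by
  induction p using Finsupp.induction_linear with
  | zero => simp
  | add p p' hp hp' => simp only [map_add, hp, hp']
  | single i a => rw [polyMap_single, renameApp_single, renameApp_single, polyMap_single]

theorem renameApp_mul {σ τ : Type} (f : σ → τ) {x y : X} (p : (σ →₀ ℕ) →₀ A.obj x)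
    (q : (σ →₀ ℕ) →₀ A.obj y) :
    A.renameApp f (x ⊗ y) (A.polyMul σ x y p q) =
      A.polyMul τ x y (A.renameApp f x p) (A.renameApp f y q) := by
  induction p using Finsupp.induction_linear with
  | zero => simp
  | add p p' hp hp' => simp only [map_add, LinearMap.add_apply, hp, hp']
  | single i a =>
    induction q using Finsupp.induction_linear with
    | zero => simp
    | add p p' hp hp' => simp only [map_add, hp, hp']
    | single j b =>
      rw [polyMul_single, renameApp_single, renameApp_single, renameApp_single, polyMul_single,
        Finsupp.mapDomain_add]

/-- The morphism of monoids `A[t_i : i ∈ σ] ⟶ A[t_j : j ∈ τ]` that is the identity on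
coefficients and sends `t_i` to `t_{f(i)}`. -/
noncomputable def rename {σ τ : Type} (f : σ → τ) : Hom (A.poly σ) (A.poly τ) where
  app := A.renameApp f
  naturality := A.renameApp_naturality f
  map_one := (A.renameApp_single f (𝟙_ X) 0 A.one).trans (by rw [Finsupp.mapDomain_zero]; rfl)
  map_mul := A.renameApp_mul f

theorem one_inCommutant [BraidedCategory X] : A.InCommutant A.one := by
  intro y a
  have h1 : A.times a A.one = A.map (ρ_ y).inv a := by
    conv_rhs => rw [← A.mul_one a]
    rw [← LinFun.map_comp, Iso.hom_inv_id, LinFun.map_id]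
  have h2 : A.times A.one a = A.map (λ_ y).inv a := by
    conv_rhs => rw [← A.one_mul a]
    rw [← LinFun.map_comp, Iso.hom_inv_id, LinFun.map_id]
  rw [h1, h2, ← LinFun.map_comp]
  congr 2
  simp

/-- The variables belong to the commutant. -/
theorem polyVar_inCommutant [BraidedCategory X] {σ : Type} (i : σ) :
    (A.poly σ).InCommutant (A.polyVar i) := by
  intro y p
  change A.polyMul σ _ _ p (Finsupp.single (Finsupp.single i 1) A.one) =
    A.polyMap σ (β_ (𝟙_ X) y).hom
      (A.polyMul σ _ _ (Finsupp.single (Finsupp.single i 1) A.one) p)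
  induction (p : (σ →₀ ℕ) →₀ A.obj y) using Finsupp.induction_linear with
  | zero => simp
  | add p p' hp hp' => simp only [map_add, LinearMap.add_apply, hp, hp']
  | single j a =>
    rw [polyMul_single, polyMul_single, polyMap_single, add_comm]
    exact congrArg _ (A.one_inCommutant y a)

theorem InCommutant.sub [BraidedCategory X] {A : FMon.{r, u, v, t} R X} {x : X} {b c : A.obj x}
    (hb : A.InCommutant b) (hc : A.InCommutant c) : A.InCommutant (b - c) := by
  intro y a
  have h1 := hb y a
  have h2 := hc y a
  simp only [times] at h1 h2 ⊢
  rw [map_sub, h1, h2, map_sub, LinearMap.sub_apply, map_sub]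

/-- The elements `α_i = u_i - v_i` of `A[u_1, …, u_n, v_1, …, v_n](𝟏)`. -/
noncomputable def alpha (n : ℕ) (i : Fin n) : (A.poly (Fin n ⊕ Fin n)).obj (𝟙_ X) :=
  A.polyVar (Sum.inl i) - A.polyVar (Sum.inr i)

theorem alpha_inCommutant [BraidedCategory X] (n : ℕ) (i : Fin n) :
    (A.poly (Fin n ⊕ Fin n)).InCommutant (A.alpha n i) :=
  (A.polyVar_inCommutant _).sub (A.polyVar_inCommutant _)

/-- The morphism of monoids `A[u_1, …, u_n, v_1, …, v_n] ⟶ A[t_1, …, t_n]` that is the identity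
on `A` and sends `u_i` and `v_i` to `t_i`. -/
noncomputable abbrev fold (n : ℕ) : Hom (A.poly (Fin n ⊕ Fin n)) (A.poly (Fin n)) :=
  A.rename (Sum.elim id id)

/-- The pairing `(p(t), q(t)) ↦ p(u) × q(v)`, that is, the canonical morphism
`A[t] ⊗ A[t] ⟶ A[u, v]`. -/
noncomputable def polyPairing (n : ℕ) : Pairing (A.poly (Fin n)).toLinFun (A.poly (Fin n)).toLinFun
    (A.poly (Fin n ⊕ Fin n)).toLinFun where
  toFun x y := (A.polyMul (Fin n ⊕ Fin n) x y).compl₁₂ (A.renameApp Sum.inl x)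
    (A.renameApp Sum.inr y)
  naturality φ ψ p q := by
    refine Eq.trans ?_ (A.polyMul_naturality _ φ ψ _ _)
    exact congrArg₂ (fun p q => A.polyMul (Fin n ⊕ Fin n) _ _ p q)
      (A.renameApp_naturality _ φ p) (A.renameApp_naturality _ ψ q)

/-- The monoid `A[t_1, …, t_n]` as a module over `A[u_1, …, u_n, v_1, …, v_n]`. -/
noncomputable abbrev polyModule (n : ℕ) : FMod.{r, u, v, t, t} (A.poly (Fin n ⊕ Fin n)) :=
  (A.poly (Fin n)).self.restrictAlong (A.fold n)

/-- The augmentation `K_0^n(C) = C ⟶ A[t_1, …, t_n]` of the Koszul complex of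
`C = A[u_1, …, u_n, v_1, …, v_n]`. -/
noncomputable def koszulAug (n : ℕ) :
    (A.poly (Fin n ⊕ Fin n)).koszul n 0 ⟶ A.polyModule n :=
  (A.poly (Fin n ⊕ Fin n)).self.copiesProj ⟨∅, Finset.card_empty⟩ ≫ (A.fold n).toModHom

end FMon

end Polynomials

section Hochschild

variable {R : Type r} [CommRing R] {X : Type u} [Category.{v} X] [Preadditive X] [Linear R X]
  [MonoidalCategory X]

namespace LinFun

/-- The `R`-module of morphisms from `F` to the shifted functor `G_x : y ↦ G(x ⋄ y)`. -/
def homShift (F : LinFun.{r, u, v, t₁} R X) (G : LinFun.{r, u, v, t₂} R X) (x : X) :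
    Submodule R (∀ y : X, F.obj y →ₗ[R] G.obj (x ⊗ y)) where
  carrier := {f | ∀ (y y' : X) (ψ : y ⟶ y') (a : F.obj y),
    f y' (F.map ψ a) = G.map (x ◁ ψ) (f y a)}
  add_mem' {f g} hf hg y y' ψ a := by simp [hf y y' ψ a, hg y y' ψ a]
  zero_mem' y y' ψ a := by simp
  smul_mem' c f hf y y' ψ a := by simp [hf y y' ψ a]

/-- The map `Hom(F, G_x) ⟶ Hom(F, G_{x'})` induced by an arrow `x ⟶ x'`. -/
def homShiftMap (F : LinFun.{r, u, v, t₁} R X) (G : LinFun.{r, u, v, t₂} R X) {x x' : X}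
    (φ : x ⟶ x') : homShift F G x →ₗ[R] homShift F G x' where
  toFun f := ⟨fun y => G.map (φ ▷ y) ∘ₗ f.1 y, fun y y' ψ a => by
    simp only [LinearMap.comp_apply, f.2 y y' ψ a, ← map_comp, whisker_exchange]⟩
  map_add' f g := by ext; simp
  map_smul' c f := by ext; simp

variable [MonoidalPreadditive X] [MonoidalLinear R X]

/-- The internal hom `𝓗(F, G)` of `𝓕`: its value at `x` is `Hom(F, G_x)`. -/
def ihom (F : LinFun.{r, u, v, t₁} R X) (G : LinFun.{r, u, v, t₂} R X) :
    LinFun.{r, u, v, max u t₁ t₂} R X :=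
  of (fun x => homShift F G x) (fun φ => homShiftMap F G φ)
    (fun x f => by ext y a; simp [homShiftMap, map_id])
    (fun φ ψ f => by ext y a; simp [homShiftMap, map_comp])
    (fun φ ψ f => by ext y a; simp [homShiftMap, map_add])
    (fun c φ f => by ext y a; simp [homShiftMap, map_smul])

/-- The morphism `𝓗(F, G) ⟶ 𝓗(F, H)` induced by a morphism `G ⟶ H`. -/
def ihomMap (F : LinFun.{r, u, v, t₁} R X) {G : LinFun.{r, u, v, t₂} R X}
    {H : LinFun.{r, u, v, t₃} R X} (h : Hom G H) : Hom (ihom F G) (ihom F H) where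
  app x :=
    { toFun := fun (f : homShift F G x) => (⟨fun y => h.app (x ⊗ y) ∘ₗ f.1 y, fun y y' ψ a => by
        simp only [LinearMap.comp_apply, f.2 y y' ψ a, h.naturality]⟩ : homShift F H x)
      map_add' := fun f g => Subtype.ext (by
        funext y; exact LinearMap.ext fun a => _root_.map_add (h.app (x ⊗ y)) (f.1 y a) (g.1 y a))
      map_smul' := fun c f => Subtype.ext (by
        funext y; exact LinearMap.ext fun a => _root_.map_smul (h.app (x ⊗ y)) c (f.1 y a)) }
  naturality {x x'} φ f := Subtype.ext (by
    funext y; exact LinearMap.ext fun a => h.naturality (φ ▷ y) (f.1 y a))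

end LinFun

variable {A : FMon.{r, u, v, t} R X}

namespace FMod

/-- The action of `A` on `𝓗(A, G)`, for an `A`-module `G`: it is given by
`(a × f)(b) = a × f(b)`. -/
def ihomAct (G : FMod.{r, u, v, t, s} A) (x y : X) :
    A.obj x →ₗ[R] LinFun.homShift A.toLinFun G.toLinFun y →ₗ[R]
      LinFun.homShift A.toLinFun G.toLinFun (x ⊗ y) :=
  LinearMap.mk₂ R
    (fun a f => ⟨fun z => G.map (α_ x y z).inv ∘ₗ G.act.toFun x (y ⊗ z) a ∘ₗ f.1 z,
      fun z z' ψ b => by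
        have h := G.act.naturality (𝟙 x) (y ◁ ψ) a (f.1 z b)
        rw [A.map_id] at h
        simp only [LinearMap.comp_apply, f.2 z z' ψ b, h, ← LinFun.map_comp]
        congr 2
        simp⟩)
    (fun a a' f => by ext z b; simp) (fun c a f => by ext z b; simp)
    (fun a f f' => by ext z b; simp) (fun c a f => by ext z b; simp)

theorem ihomAct_naturality (G : FMod.{r, u, v, t, s} A) {x x' y y' : X} (φ : x ⟶ x')
    (ψ : y ⟶ y') (a : A.obj x) (f : LinFun.homShift A.toLinFun G.toLinFun y) :
    ihomAct G x' y' (A.map φ a) (LinFun.homShiftMap A.toLinFun G.toLinFun ψ f) =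
      LinFun.homShiftMap A.toLinFun G.toLinFun (φ ⊗ₘ ψ) (ihomAct G x y a f) := by
  refine Subtype.ext (funext fun z => LinearMap.ext fun b => ?_)
  have h := G.act.naturality φ (ψ ▷ z) a (f.1 z b)
  change G.map (α_ x' y' z).inv (G.act.toFun _ _ (A.map φ a) (G.map (ψ ▷ z) (f.1 z b))) =
    G.map ((φ ⊗ₘ ψ) ▷ z) (G.map (α_ x y z).inv (G.act.toFun _ _ a (f.1 z b)))
  rw [h, ← LinFun.map_comp, ← LinFun.map_comp]
  congr 2
  simp [MonoidalCategory.tensorHom_def]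

theorem ihomAct_assoc (G : FMod.{r, u, v, t, s} A) {x y z : X} (a : A.obj x) (b : A.obj y)
    (f : LinFun.homShift A.toLinFun G.toLinFun z) :
    LinFun.homShiftMap A.toLinFun G.toLinFun (α_ x y z).hom (ihomAct G _ z (A.times a b) f) =
      ihomAct G x _ a (ihomAct G y z b f) := by
  refine Subtype.ext (funext fun w => LinearMap.ext fun c => ?_)
  have h := G.act.naturality (𝟙 x) (α_ y z w).inv a (G.act.toFun _ _ b (f.1 w c))
  rw [A.map_id] at h
  change G.map ((α_ x y z).hom ▷ w) (G.map (α_ (x ⊗ y) z w).inv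
      (G.act.toFun _ _ (A.times a b) (f.1 w c))) =
    G.map (α_ x (y ⊗ z) w).inv (G.act.toFun _ _ a (G.map (α_ y z w).inv
      (G.act.toFun _ _ b (f.1 w c))))
  rw [h, ← G.act_assoc a b (f.1 w c)]
  simp only [← LinFun.map_comp]
  congr 2
  simp

theorem one_ihomAct (G : FMod.{r, u, v, t, s} A) {x : X}
    (f : LinFun.homShift A.toLinFun G.toLinFun x) :
    LinFun.homShiftMap A.toLinFun G.toLinFun (λ_ x).hom (ihomAct G _ x A.one f) = f := by
  refine Subtype.ext (funext fun w => LinearMap.ext fun c => ?_)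
  change G.map ((λ_ x).hom ▷ w) (G.map (α_ (𝟙_ X) x w).inv
      (G.act.toFun _ _ A.one (f.1 w c))) = f.1 w c
  rw [← LinFun.map_comp]
  refine Eq.trans ?_ (G.one_act (f.1 w c))
  congr 2
  simp

variable [MonoidalPreadditive X] [MonoidalLinear R X]

/-- The `A`-module `𝓗(A, G)`, for an `A`-module `G`. -/
def ihom (G : FMod.{r, u, v, t, s} A) : FMod.{r, u, v, t, max u t s} A where
  toLinFun := A.toLinFun.ihom G.toLinFun
  act :=
    { toFun := ihomAct G
      naturality := ihomAct_naturality G }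
  act_assoc := ihomAct_assoc G
  one_act := one_ihomAct G

/-- The map `m ↦ (a ↦ a × m)`, at the object `x`. -/
def leftFaceApp [BraidedCategory X] (G : FMod.{r, u, v, t, s} A) (x : X) :
    G.obj x →ₗ[R] LinFun.homShift A.toLinFun G.toLinFun x where
  toFun m := ⟨fun y => G.map (β_ y x).hom ∘ₗ (G.act.toFun y x).flip m, fun y y' ψ a => by
    have h := G.act.naturality ψ (𝟙 x) a m
    rw [G.map_id] at h
    simp only [LinearMap.comp_apply, LinearMap.flip_apply, h, ← LinFun.map_comp]
    congr 2
    simp⟩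
  map_add' m m' := by ext y a; simp
  map_smul' c m := by ext y a; simp

/-- The morphism `G ⟶ 𝓗(A, G)` that sends `m` to `a ↦ a × m`. -/
def leftFace [BraidedCategory X] (G : FMod.{r, u, v, t, s} A) :
    LinFun.Hom G.toLinFun G.ihom.toLinFun where
  app := G.leftFaceApp
  naturality {x x'} φ m := Subtype.ext (funext fun y => LinearMap.ext fun a => by
    have h := G.act.naturality (𝟙 y) φ a m
    rw [A.map_id] at h
    change G.map (β_ y x').hom (G.act.toFun _ _ a (G.map φ m)) =
      G.map (φ ▷ y) (G.map (β_ y x).hom (G.act.toFun _ _ a m))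
    rw [h, ← LinFun.map_comp, ← LinFun.map_comp]
    congr 2
    simp)

end FMod

namespace FMon

/-- The map `b ↦ f(a × b)`, for `f` in `Hom(A, G_x)` and `a` in `A(y)`. -/
def middleAux (A : FMon.{r, u, v, t} R X) (G : LinFun.{r, u, v, s} R X) {x : X}
    (f : LinFun.homShift A.toLinFun G x) (y : X) :
    A.obj y →ₗ[R] LinFun.homShift A.toLinFun G (x ⊗ y) where
  toFun a := ⟨fun z => G.map (α_ x y z).inv ∘ₗ f.1 (y ⊗ z) ∘ₗ A.mul.toFun y z a,
    fun z z' ψ b => by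
      have h := A.mul.naturality (𝟙 y) ψ a b
      have h' := f.2 _ _ (𝟙 y ⊗ₘ ψ) (A.mul.toFun y z a b)
      rw [A.map_id] at h
      simp only [LinearMap.comp_apply, h, h', ← LinFun.map_comp]
      congr 2
      simp⟩
  map_add' a a' := by ext z b; simp
  map_smul' c a := by ext z b; simp

variable [MonoidalPreadditive X] [MonoidalLinear R X]

/-- The map `f ↦ (a ↦ (b ↦ f(a × b)))`, at the object `x`. -/
def middleFaceApp (A : FMon.{r, u, v, t} R X) (G : LinFun.{r, u, v, s} R X) (x : X) :
    LinFun.homShift A.toLinFun G x →ₗ[R] LinFun.homShift A.toLinFun (A.toLinFun.ihom G) x where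
  toFun f := ⟨A.middleAux G f, fun y y' φ a => Subtype.ext (funext fun z =>
    LinearMap.ext fun b => by
      have h := A.mul.naturality φ (𝟙 z) a b
      have h' := f.2 _ _ (φ ⊗ₘ 𝟙 z) (A.mul.toFun y z a b)
      rw [A.map_id] at h
      change G.map (α_ x y' z).inv (f.1 (y' ⊗ z) (A.mul.toFun y' z (A.map φ a) b)) =
        G.map ((x ◁ φ) ▷ z) (G.map (α_ x y z).inv (f.1 (y ⊗ z) (A.mul.toFun y z a b)))
      rw [h, h', ← LinFun.map_comp, ← LinFun.map_comp]
      congr 2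
      simp)⟩
  map_add' f g := Subtype.ext (funext fun y => LinearMap.ext fun a => Subtype.ext
    (funext fun z => LinearMap.ext fun b => map_add (G.map (α_ x y z).inv) _ _))
  map_smul' c f := Subtype.ext (funext fun y => LinearMap.ext fun a => Subtype.ext
    (funext fun z => LinearMap.ext fun b => map_smul (G.map (α_ x y z).inv) c _))

/-- The morphism `𝓗(A, G) ⟶ 𝓗(A, 𝓗(A, G))` that sends `f` to `a ↦ (b ↦ f(a × b))`. -/
def middleFace (A : FMon.{r, u, v, t} R X) (G : LinFun.{r, u, v, s} R X) :
    LinFun.Hom (A.toLinFun.ihom G) (A.toLinFun.ihom (A.toLinFun.ihom G)) where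
  app := A.middleFaceApp G
  naturality {x x'} φ f := Subtype.ext (funext fun y => LinearMap.ext fun a => Subtype.ext
    (funext fun z => LinearMap.ext fun b => by
      change G.map (α_ x' y z).inv (G.map (φ ▷ (y ⊗ z)) (f.1 (y ⊗ z) (A.times a b))) =
        G.map ((φ ▷ y) ▷ z) (G.map (α_ x y z).inv (f.1 (y ⊗ z) (A.times a b)))
      rw [← LinFun.map_comp, ← LinFun.map_comp]
      congr 2
      simp))

end FMon

namespace FBimod

/-- The map `m ↦ (a ↦ m × a)`, at the object `x`. -/
def rightFaceApp (M : FBimod.{r, u, v, t, s} A) (x : X) :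
    M.obj x →ₗ[R] LinFun.homShift A.toLinFun M.toLinFun x where
  toFun m := ⟨fun y => M.ract.toFun x y m, fun y y' ψ a => by
    have h := M.ract.naturality (𝟙 x) ψ m a
    rw [M.map_id] at h
    rw [h]
    congr 2
    simp⟩
  map_add' m m' := by ext y a; simp
  map_smul' c m := by ext y a; simp

/-- The bimodule `M` seen in a larger universe. -/
def ulift (M : FBimod.{r, u, v, t, s} A) : FBimod.{r, u, v, t, max t₁ s} A where
  toLinFun := LinFun.ulift.{r, u, v, s, t₁} M.toLinFun
  act :=
    { toFun := fun x y => (M.act.toFun x y).compl₁₂ LinearMap.id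
        (ULift.moduleEquiv (R := R) (M := M.obj y)).toLinearMap |>.compr₂
          (ULift.moduleEquiv (R := R) (M := M.obj (x ⊗ y))).symm.toLinearMap
      naturality := fun φ ψ a m => ULift.ext _ _ (M.act.naturality φ ψ a m.down) }
  act_assoc := fun a b m => ULift.ext _ _ (M.act_assoc a b m.down)
  one_act := fun m => ULift.ext _ _ (M.one_act m.down)
  ract :=
    { toFun := fun x y => (M.ract.toFun x y).compl₁₂
        (ULift.moduleEquiv (R := R) (M := M.obj x)).toLinearMap LinearMap.id |>.compr₂
          (ULift.moduleEquiv (R := R) (M := M.obj (x ⊗ y))).symm.toLinearMap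
      naturality := fun φ ψ m a => ULift.ext _ _ (M.ract.naturality φ ψ m.down a) }
  ract_assoc := fun m a b => ULift.ext _ _ (M.ract_assoc m.down a b)
  ract_one := fun m => ULift.ext _ _ (M.ract_one m.down)
  act_ract := fun a m b => ULift.ext _ _ (M.act_ract a m.down b)

variable [MonoidalPreadditive X] [MonoidalLinear R X]

/-- The morphism `M ⟶ 𝓗(A, M)` that sends `m` to `a ↦ m × a`. -/
def rightFace (M : FBimod.{r, u, v, t, s} A) :
    LinFun.Hom M.toLinFun (A.toLinFun.ihom M.toLinFun) where
  app := M.rightFaceApp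
  naturality {x x'} φ m := Subtype.ext (funext fun y => LinearMap.ext fun a => by
    have h := M.ract.naturality φ (𝟙 y) m a
    rw [A.map_id] at h
    change M.ract.toFun x' y (M.map φ m) a = M.map (φ ▷ y) (M.ract.toFun x y m a)
    rw [h]
    congr 2
    simp)

/-- The functor of Hochschild cochains of degree `p`, that is `𝓗(A^{⊗ p}, M)`, in the form
`𝓗(A, 𝓗(A, … 𝓗(A, M)))`. An element of its value at `x` is a natural family of `R`-multilinear
maps `f : A(y_1) × ⋯ × A(y_p) → M(((x ⋄ y_1) ⋄ ⋯) ⋄ y_p)`. -/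
def cochains (M : FBimod.{r, u, v, t, s} A) : ℕ → FMod.{r, u, v, t, max u t s} A
  | 0 => (ulift.{r, u, v, t, s, max u t} M).toFMod
  | p + 1 => (M.cochains p).ihom

/-- The faces from the cochains of degree `p` to those of degree `p + 1`:
`a_1 × f(a_2, …)` for the index `0`, `f(…, a_i × a_{i+1}, …)` for the index `1 ≤ i ≤ p`, and
`f(a_1, …, a_p) × a_{p+1}` for the index `p + 1` (the other indices are not used). -/
def face [BraidedCategory X] (M : FBimod.{r, u, v, t, s} A) :
    ∀ p : ℕ, ℕ → LinFun.Hom (M.cochains p).toLinFun (M.cochains (p + 1)).toLinFun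
  | p, 0 => (M.cochains p).leftFace
  | 0, _ + 1 => (ulift.{r, u, v, t, s, max u t} M).rightFace
  | p + 1, 1 => A.middleFace (M.cochains p).toLinFun
  | p + 1, i + 2 => A.toLinFun.ihomMap (M.face p (i + 1))

/-- The differential of the Hochschild cochain complex, at the object `x`:
`(df)(a_1, …, a_{p+1}) = a_1 × f(a_2, …) + ∑ (-1)^i f(…, a_i × a_{i+1}, …)
  + (-1)^(p+1) f(a_1, …, a_p) × a_{p+1}`. -/
def diff [BraidedCategory X] (M : FBimod.{r, u, v, t, s} A) (p : ℕ) (x : X) :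
    (M.cochains p).obj x →ₗ[R] (M.cochains (p + 1)).obj x :=
  ∑ i ∈ Finset.range (p + 2), (-1 : ℤ) ^ i • (M.face p i).app x

theorem diff_map [BraidedCategory X] (M : FBimod.{r, u, v, t, s} A) (p : ℕ) {x y : X}
    (φ : x ⟶ y) (f : (M.cochains p).obj x) :
    M.diff p y ((M.cochains p).map φ f) = (M.cochains (p + 1)).map φ (M.diff p x f) := by
  simp only [diff, LinearMap.sum_apply, LinearMap.smul_apply, map_sum, map_zsmul,
    LinFun.Hom.naturality]

/-- The Hochschild cocycles of degree `p`, at the object `x`. -/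
def cocycles [BraidedCategory X] (M : FBimod.{r, u, v, t, s} A) (p : ℕ) (x : X) :
    Submodule R ((M.cochains p).obj x) :=
  LinearMap.ker (M.diff p x)

/-- The Hochschild coboundaries of degree `p`, at the object `x`. -/
def coboundaries [BraidedCategory X] (M : FBimod.{r, u, v, t, s} A) (x : X) :
    ∀ p : ℕ, Submodule R ((M.cochains p).obj x)
  | 0 => ⊥
  | p + 1 => LinearMap.range (M.diff p x)

theorem map_mem_cocycles [BraidedCategory X] (M : FBimod.{r, u, v, t, s} A) (p : ℕ) {x y : X}
    (φ : x ⟶ y) (f : (M.cochains p).obj x) (hf : f ∈ M.cocycles p x) :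
    (M.cochains p).map φ f ∈ M.cocycles p y := by
  have h : M.diff p x f = 0 := hf
  change M.diff p y _ = 0
  rw [diff_map, h, map_zero]

theorem map_mem_coboundaries [BraidedCategory X] (M : FBimod.{r, u, v, t, s} A) (p : ℕ)
    {x y : X} (φ : x ⟶ y) (f : (M.cochains p).obj x) (hf : f ∈ M.coboundaries x p) :
    (M.cochains p).map φ f ∈ M.coboundaries y p := by
  cases p with
  | zero =>
    have h : f = 0 := hf
    change _ = _
    rw [h, map_zero]
  | succ p =>
    obtain ⟨g, rfl⟩ := hf
    exact ⟨(M.cochains p).map φ g, M.diff_map p φ g⟩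

/-- The value at `x` of the Hochschild cohomology: cocycles modulo coboundaries. -/
abbrev HHObj [BraidedCategory X] (M : FBimod.{r, u, v, t, s} A) (p : ℕ) (x : X) :
    Type (max u t s) :=
  M.cocycles p x ⧸ (M.coboundaries x p).comap (M.cocycles p x).subtype

/-- The arrows of the Hochschild cohomology functor. -/
def HHMap [BraidedCategory X] (M : FBimod.{r, u, v, t, s} A) (p : ℕ) {x y : X} (φ : x ⟶ y) :
    M.HHObj p x →ₗ[R] M.HHObj p y :=
  Submodule.mapQ _ _
    (((M.cochains p).map φ).restrict (p := M.cocycles p x) (q := M.cocycles p y)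
      (fun f hf => M.map_mem_cocycles p φ f hf))
    (fun f hf => M.map_mem_coboundaries p φ f.1 hf)

/-- The Hochschild cohomology functor `HH^p(A, M)`, an object of `𝓕`. -/
def HH [BraidedCategory X] (M : FBimod.{r, u, v, t, s} A) (p : ℕ) :
    LinFun.{r, u, v, max u t s} R X :=
  LinFun.of (fun x => M.HHObj p x) (fun φ => M.HHMap p φ)
    (fun x a => by
      obtain ⟨a, rfl⟩ := Submodule.mkQ_surjective _ a
      exact congrArg (Submodule.mkQ _) (Subtype.ext ((M.cochains p).map_id x a.1)))
    (fun φ ψ a => by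
      obtain ⟨a, rfl⟩ := Submodule.mkQ_surjective _ a
      exact congrArg (Submodule.mkQ _) (Subtype.ext ((M.cochains p).map_comp φ ψ a.1)))
    (fun φ ψ a => by
      obtain ⟨a, rfl⟩ := Submodule.mkQ_surjective _ a
      exact congrArg (Submodule.mkQ _) (Subtype.ext ((M.cochains p).map_add φ ψ a.1)))
    (fun c φ a => by
      obtain ⟨a, rfl⟩ := Submodule.mkQ_surjective _ a
      exact congrArg (Submodule.mkQ _) (Subtype.ext ((M.cochains p).map_smul c φ a.1)))

end FBimod

end Hochschild

end FunctorMonoid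

open FunctorMonoid

/-! Two elementary facts carry the theorem.

The difference `u^q - v^q` is divisible by `u - v`, with quotient `∑ u^l v^(q-1-l)`. So on
polynomials with coefficients in any module the divided difference `s_i : f ↦ (f - f|_{u_i = v_i}) /
(u_i - v_i)` is a left inverse of the product by `α_i`. It commutes with the other `α_j`, it is
natural in the coefficients, and `1 - α_i s_i` is the substitution `u_i ↦ v_i`. Put `P_m = ∏_{i<m}
(1 - α_i s_i)`. Part 1 is then formal: `P_m` is zero exactly on the submodule generated by the `α_i`
with `i < m` (`FMon.mem_ideal_iff`), which gives regularity and the quotient, and the operators `P_i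
s_i` contract the Koszul complex (`IsKoszulContraction.diff_homotopy_succ`). Naturality makes the
contraction a splitting in `𝓕`. Free modules are `𝓕`-projective because a morphism out of them
amounts to finitely many elements over `𝟏`.

If `A` is tensor idempotent, a pairing on `A × A` depends on `(a, b)` only through the product `a ×
b` (`FMon.IsTensorIdempotent.pairing_congr`). This gives `A_n ⊗ A_n ≅ A[u, v]`. It also forces any
natural map `f` out of `A_n` with values in a module to satisfy `f(a t^γ) = a × f(ε t^γ)` up to the
symmetry (`FMod.apply_monomial`). A Hochschild cochain of degree `p` at `x` is therefore an
arbitrary function of `p` exponents with values in `M(x)`. Now `M(x)` is a module over `R[u, v]`,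
with `u` acting on the left and `v` on the right, and the Hochschild complex at `x` becomes
`Hom_{R[u,v]}(Bar, M(x))`, where `Bar` is the bar resolution of `R[t]` (`FBimod.cochainEval_diff`).

So part 2 is a statement on modules over `R[u, v]`. The bar and Koszul resolutions are homotopy
equivalent (`nonempty_barKoszulEquiv`). The Koszul one vanishes above degree `n`, hence so does the
cohomology. When `M = A_n`, each `u_i - v_i` acts by zero, so the complex of maps from the Koszul
resolution has zero differential and the cohomology in degree `p` is one copy of `A_n` for each
subset with `p` elements. -/

namespace FunctorMonoid

/-! ### Koszul complexes of commuting endomorphisms and their contraction. -/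

section AbstractKoszul

variable {k : Type*} [CommRing k] {W : Type*} [AddCommGroup W] [Module k W] {n : ℕ}

/-- Extension by zero of a family indexed by the subsets with `q` elements. -/
def extendKSub {q : ℕ} (f : KSub n q → W) (T : Finset (Fin n)) : W :=
  if h : T.card = q then f ⟨T, h⟩ else 0

theorem extendKSub_coe {q : ℕ} (f : KSub n q → W) (S : KSub n q) : extendKSub f S.1 = f S := by
  simp [extendKSub, S.2]

theorem extendKSub_of_card {q : ℕ} (f : KSub n q → W) {T : Finset (Fin n)} (h : T.card = q) :
    extendKSub f T = f ⟨T, h⟩ := by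
  simp [extendKSub, h]

theorem extendKSub_add {q : ℕ} (f g : KSub n q → W) (T : Finset (Fin n)) :
    extendKSub (f + g) T = extendKSub f T + extendKSub g T := by
  unfold extendKSub; split_ifs <;> simp

theorem extendKSub_smul {q : ℕ} (c : k) (f : KSub n q → W) (T : Finset (Fin n)) :
    extendKSub (c • f) T = c • extendKSub f T := by
  unfold extendKSub; split_ifs <;> simp

theorem extendKSub_map {W' F : Type*} [AddCommGroup W'] [FunLike F W W']
    [AddMonoidHomClass F W W'] (g : F) {q : ℕ} (f : KSub n q → W)
    (T : Finset (Fin n)) : extendKSub (fun S => g (f S)) T = g (extendKSub f T) := by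
  unfold extendKSub; split_ifs <;> simp

/-- The Koszul differential of a family of endomorphisms. -/
def koszulDiff (α : Fin n → Module.End k W) (p : ℕ) :
    (KSub n (p + 1) → W) →ₗ[k] (KSub n p → W) :=
  LinearMap.pi fun S => ∑ i : {i : Fin n // i ∉ S.1}, (-1 : ℤ) ^ (S.1.filter (· < i.1)).card •
    (α i.1 ∘ₗ LinearMap.proj
      (⟨insert i.1 S.1, by rw [Finset.card_insert_of_notMem i.2, S.2]⟩ : KSub n (p + 1)))

theorem koszulDiff_apply' (α : Fin n → Module.End k W) (p : ℕ) (f : KSub n (p + 1) → W)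
    (S : KSub n p) : koszulDiff α p f S =
      ∑ i : {i : Fin n // i ∉ S.1}, (-1 : ℤ) ^ (S.1.filter (· < i.1)).card •
        α i.1 (f ⟨insert i.1 S.1, by rw [Finset.card_insert_of_notMem i.2, S.2]⟩) := by
  simp [koszulDiff]

/-- Extension by zero frees the summands from proofs on cardinalities, so that the sum can be split
and reindexed as a sum over a finset. -/
theorem koszulDiff_apply (α : Fin n → Module.End k W) (p : ℕ) (f : KSub n (p + 1) → W)
    (S : KSub n p) : koszulDiff α p f S =
      ∑ i ∈ S.1ᶜ, (-1 : ℤ) ^ (S.1.filter (· < i)).card •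
        α i (extendKSub f (insert i S.1)) := by
  rw [koszulDiff_apply', Finset.sum_subtype (S.1ᶜ) (p := fun i => i ∉ S.1) (by simp)]
  refine Finset.sum_congr rfl fun i _ => ?_
  rw [extendKSub_of_card]

/-- The sign at `j` counts the elements that precede `j`, so only an insertion below `j` changes it.
All cancellations in the Koszul complex come from this. -/
theorem sign_insert_of_lt {S : Finset (Fin n)} {i j : Fin n} (hi : i ∉ S) (h : i < j) :
    (-1 : ℤ) ^ ((insert i S).filter (· < j)).card = -(-1 : ℤ) ^ (S.filter (· < j)).card := by
  rw [Finset.filter_insert, if_pos h, Finset.card_insert_of_notMem (by simp [hi]), pow_succ]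
  ring

theorem sign_insert_of_gt {S : Finset (Fin n)} {i j : Fin n} (h : j < i) :
    (-1 : ℤ) ^ ((insert i S).filter (· < j)).card = (-1 : ℤ) ^ (S.filter (· < j)).card := by
  rw [Finset.filter_insert, if_neg h.not_gt]

/-- In `d²`, the terms of index `(i, j)` and `(j, i)` insert the same two elements. The operators
commute and exactly one of the signs changes, so swapping is a sign-reversing involution without
fixed points. -/
theorem koszulDiff_comp (α : Fin n → Module.End k W) (hα : ∀ i j, Commute (α i) (α j)) (p : ℕ)
    (f : KSub n (p + 2) → W) : koszulDiff α p (koszulDiff α (p + 1) f) = 0 := by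
  funext S
  let F : Fin n → Fin n → W := fun i j => ((-1 : ℤ) ^ (S.1.filter (· < i)).card *
    (-1 : ℤ) ^ ((insert i S.1).filter (· < j)).card) •
      (α i * α j) (extendKSub f (insert j (insert i S.1)))
  have h1 : koszulDiff α p (koszulDiff α (p + 1) f) S =
      ∑ i ∈ S.1ᶜ, ∑ j ∈ (insert i S.1)ᶜ, F i j := by
    rw [koszulDiff_apply]
    refine Finset.sum_congr rfl fun i hi => ?_
    have hc : (insert i S.1).card = p + 1 := by
      rw [Finset.card_insert_of_notMem (by simpa using hi), S.2]
    rw [extendKSub_of_card _ hc, koszulDiff_apply, map_sum, Finset.smul_sum]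
    refine Finset.sum_congr rfl fun j _ => ?_
    simp only [F, map_zsmul, smul_smul, Module.End.mul_apply]
  have h2 : ∀ i ∈ S.1ᶜ, ∀ j ∈ (insert i S.1)ᶜ, F i j = -F j i := by
    have key : ∀ i j, i ∉ S.1 → j ∉ S.1 → i < j → F i j = - F j i := by
      intro i j hi hj hij
      simp only [F]
      rw [sign_insert_of_lt hi hij, sign_insert_of_gt hij, Finset.insert_comm, (hα i j).eq,
        ← neg_smul]
      congr 1
      ring
    intro i hi j hj
    simp only [Finset.mem_compl, Finset.mem_insert, not_or] at hi hj
    rcases lt_trichotomy i j with h | h | h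
    · exact key i j hi hj.2 h
    · exact absurd h.symm hj.1
    · rw [key j i hj.2 hi h, neg_neg]
  rw [h1, Finset.sum_sigma', Pi.zero_apply]
  refine Finset.sum_involution (fun a _ => ⟨a.2, a.1⟩) ?_ ?_ ?_ ?_
  · rintro ⟨i, j⟩ h
    simp only [Finset.mem_sigma] at h
    simp only [h2 i h.1 j h.2, neg_add_cancel]
  · rintro ⟨i, j⟩ h _ h'
    simp only [Finset.mem_sigma, Finset.mem_compl, Finset.mem_insert, not_or] at h
    simp only [Sigma.mk.injEq, heq_eq_eq] at h'
    exact h.2.1 h'.1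
  · rintro ⟨i, j⟩ h
    simp only [Finset.mem_sigma, Finset.mem_compl, Finset.mem_insert, not_or] at h ⊢
    exact ⟨h.2.2, fun e => h.2.1 e.symm, h.1⟩
  · rintro ⟨i, j⟩ h
    rfl

/-- Endomorphisms `s i` that are left inverse to commuting endomorphisms `α i` and commute with
the other ones. -/
structure IsKoszulContraction (α s : Fin n → Module.End k W) : Prop where
  left_inv : ∀ i, s i * α i = 1
  comm : ∀ i j, Commute (α i) (α j)
  comm_of_ne : ∀ i j, i ≠ j → Commute (α i) (s j)

/-- The product of the idempotents `1 - α_i s_i` with `i < m`. -/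
def contractionProd (α s : Fin n → Module.End k W) : ℕ → Module.End k W
  | 0 => 1
  -- The index is a natural number so that the full product, with `m = n`, is included; beyond `n`
  -- the factors are trivial.
  | m + 1 => contractionProd α s m * if h : m < n then 1 - α ⟨m, h⟩ * s ⟨m, h⟩ else 1

theorem contractionProd_succ (α s : Fin n → Module.End k W) (i : Fin n) :
    contractionProd α s (i + 1) = contractionProd α s i * (1 - α i * s i) := by
  rw [contractionProd, dif_pos i.2]

open Classical in
/-- The contraction of the Koszul complex. -/
noncomputable def koszulHomotopy (α s : Fin n → Module.End k W) (p : ℕ) :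
    (KSub n p → W) →ₗ[k] (KSub n (p + 1) → W) where
  -- With `i = min S`, the value is `P_i s_i f(S ∖ {i})`, where `P_i` removes the part already
  -- contracted by the smaller indices. As `S` has `p + 1` elements, the `else` branch is never
  -- reached.
  toFun f S := if h : S.1.Nonempty then
    contractionProd α s (S.1.min' h) (s (S.1.min' h) (extendKSub f (S.1.erase (S.1.min' h))))
    else 0
  map_add' f g := by
    funext S
    by_cases h : S.1.Nonempty
    · simp only [dif_pos h, Pi.add_apply, extendKSub_add, map_add]
    · simp only [dif_neg h, Pi.add_apply, add_zero]
  map_smul' c f := by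
    funext S
    by_cases h : S.1.Nonempty
    · simp only [dif_pos h, Pi.smul_apply, extendKSub_smul, map_smul, RingHom.id_apply]
    · simp only [dif_neg h, Pi.smul_apply, smul_zero]

theorem koszulHomotopy_apply (α s : Fin n → Module.End k W) (p : ℕ) (f : KSub n p → W)
    (S : KSub n (p + 1)) {i : Fin n} (hi : i ∈ S.1) (hle : ∀ j ∈ S.1, i ≤ j) :
    koszulHomotopy α s p f S = contractionProd α s i (s i (extendKSub f (S.1.erase i))) := by
  have h : S.1.Nonempty := ⟨i, hi⟩
  have e : S.1.min' h = i := le_antisymm (Finset.min'_le _ _ hi) (Finset.le_min' _ _ _ hle)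
  change (if h : S.1.Nonempty then _ else _) = _
  rw [dif_pos h, e]

theorem koszulHomotopy_ext (α s : Fin n → Module.End k W) (p : ℕ) (f : KSub n p → W)
    {T : Finset (Fin n)} (hT : T.card = p + 1) {i : Fin n} (hi : i ∈ T) (hle : ∀ j ∈ T, i ≤ j) :
    extendKSub (koszulHomotopy α s p f) T =
      contractionProd α s i (s i (extendKSub f (T.erase i))) := by
  rw [extendKSub_of_card _ hT]
  exact koszulHomotopy_apply α s p f ⟨T, hT⟩ hi hle

namespace IsKoszulContraction

variable {α s : Fin n → Module.End k W} (h : IsKoszulContraction α s)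
include h

theorem proj_mul_self (i : Fin n) : (1 - α i * s i) * α i = 0 := by
  rw [sub_mul, mul_assoc, h.left_inv, one_mul, mul_one, sub_self]

theorem commute_proj {i j : Fin n} (hij : i ≠ j) : Commute (α i) (1 - α j * s j) :=
  (Commute.one_right _).sub_right ((h.comm i j).mul_right (h.comm_of_ne i j hij))

/-- The bound `m ≤ i` excludes from the product the factor of index `i`, the only one not known to
commute with `α_i`. -/
theorem commute_prod (i : Fin n) (m : ℕ) (hm : m ≤ i) : Commute (α i) (contractionProd α s m) := by
  induction m with
  | zero => exact Commute.one_right _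
  | succ m ih =>
    have hm' : m < n := by omega
    rw [contractionProd, dif_pos hm']
    refine (ih (by omega)).mul_right (h.commute_proj fun e => ?_)
    rw [e] at hm
    simp at hm

/-- The endomorphism `α_i` moves left past the factors of larger index and is killed by its own
factor `1 - α_i s_i`. -/
theorem prod_mul (i : Fin n) (m : ℕ) (hm : i < m) : contractionProd α s m * α i = 0 := by
  induction m with
  | zero => omega
  | succ m ih =>
    by_cases him : (i : ℕ) = m
    · subst him
      rw [contractionProd_succ, mul_assoc, h.proj_mul_self, mul_zero]
    · have ih := ih (by omega)
      rw [contractionProd]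
      split_ifs with hm'
      · rw [mul_assoc, ← (h.commute_proj (i := i) (j := ⟨m, hm'⟩)
          (fun e => him (congrArg Fin.val e))).eq, ← mul_assoc, ih, zero_mul]
      · rw [mul_one, ih]

/-- A telescoping sum: `P_j - P_{j+1} = P_j α_j s_j`, and `α_j` commutes with `P_j`. It makes every
element of the kernel of `P_m` an explicit combination of the `α_j` with `j < m`. -/
theorem sum_prod (m : ℕ) (hm : m ≤ n) :
    ∑ j ∈ Finset.univ.filter (fun j : Fin n => j.1 < m), α j * (contractionProd α s j * s j) =
      1 - contractionProd α s m := by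
  induction m with
  | zero => simp [contractionProd]
  | succ m ih =>
    have e : Finset.univ.filter (fun j : Fin n => j.1 < m + 1) =
        insert (⟨m, hm⟩ : Fin n) (Finset.univ.filter (fun j : Fin n => j.1 < m)) := by
      ext j
      simp [Fin.ext_iff]
      omega
    have e' := contractionProd_succ α s ⟨m, hm⟩
    rw [e, Finset.sum_insert (by simp), ih (by omega), ← mul_assoc,
      (h.commute_prod ⟨m, hm⟩ m le_rfl).eq]
    simp only at e'
    rw [e', mul_sub, mul_one, mul_assoc]
    abel

/-- Each `j` is the minimum of `∅ ∪ {j}`, so `dh` is the full telescoping sum. The defect `P_n` will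
be the projection onto a copy of the resolved module. -/
theorem diff_homotopy_zero (f : KSub n 0 → W) (S : KSub n 0) :
    koszulDiff α 0 (koszulHomotopy α s 0 f) S = f S - contractionProd α s n (f S) := by
  have hS : S.1 = ∅ := Finset.card_eq_zero.1 S.2
  have key := LinearMap.congr_fun (h.sum_prod n le_rfl) (f S)
  rw [LinearMap.sub_apply, Module.End.one_apply] at key
  rw [← key, koszulDiff_apply, LinearMap.sum_apply]
  refine Finset.sum_congr (by ext; simp [hS]) fun j _ => ?_
  rw [koszulHomotopy_ext α s 0 f (i := j) (by simp [hS]) (by simp) (by simp [hS])]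
  rw [show (insert j S.1).erase j = S.1 by simp [hS], extendKSub_coe]
  simp [hS]

/-- Let `i = min S`. In `dh` an inserted `j` either becomes the new minimum, when `j < i`, or leaves
the minimum unchanged, when `j > i`. The first kind sums to `f(S) - P_i f(S)`. The second kind
cancels with the terms `j > i` of `hd`, whose remaining terms are `0` for `j < i` and `P_i f(S)` for
`j = i`. -/
theorem diff_homotopy_succ (p : ℕ) (f : KSub n (p + 1) → W) :
    koszulDiff α (p + 1) (koszulHomotopy α s (p + 1) f) +
      koszulHomotopy α s p (koszulDiff α p f) = f := by
  funext S
  have hne : S.1.Nonempty := Finset.card_pos.1 (by rw [S.2]; omega)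
  obtain ⟨i, hi, hle⟩ : ∃ i ∈ S.1, ∀ j ∈ S.1, i ≤ j :=
    ⟨S.1.min' hne, Finset.min'_mem _ _, fun j hj => Finset.min'_le _ _ hj⟩
  have hcard : (S.1.erase i).card = p := by rw [Finset.card_erase_of_mem hi, S.2]; rfl
  rw [Pi.add_apply, koszulDiff_apply, koszulHomotopy_apply α s p _ S hi hle,
    extendKSub_of_card _ hcard, koszulDiff_apply, map_sum, map_sum]
  have hsplit : S.1ᶜ = Finset.univ.filter (fun j : Fin n => j.1 < i.1) ∪
      (S.1ᶜ).filter (fun j : Fin n => i < j) := by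
    ext j
    simp only [Finset.mem_compl, Finset.mem_union, Finset.mem_filter, Finset.mem_univ, true_and]
    constructor
    · intro hj
      rcases lt_trichotomy i j with h | h | h
      · exact Or.inr ⟨hj, h⟩
      · exact absurd (h ▸ hi) hj
      · exact Or.inl h
    · rintro (hj | hj)
      · exact fun hj' => absurd (hle j hj') (not_le.2 hj)
      · exact hj.1
  have hsplit' : (S.1.erase i)ᶜ = insert i (Finset.univ.filter (fun j : Fin n => j.1 < i.1) ∪
      (S.1ᶜ).filter (fun j : Fin n => i < j)) := by
    rw [← hsplit]
    ext j
    simp only [Finset.mem_compl, Finset.mem_erase, Finset.mem_insert]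
    tauto
  have hdisj : Disjoint (Finset.univ.filter (fun j : Fin n => j.1 < i.1))
      ((S.1ᶜ).filter (fun j : Fin n => i < j)) := by
    rw [Finset.disjoint_left]
    intro j hj hj'
    simp only [Finset.mem_filter, Finset.mem_univ, true_and] at hj hj'
    exact absurd hj'.2 (not_lt.2 (le_of_lt hj))
  have hsum : ∀ F : Fin n → W, ∑ j ∈ S.1ᶜ, F j =
      ∑ j ∈ Finset.univ.filter (fun j : Fin n => j.1 < i.1), F j +
        ∑ j ∈ (S.1ᶜ).filter (fun j : Fin n => i < j), F j := fun F => by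
    rw [← Finset.sum_union hdisj, ← hsplit]
  rw [hsum, hsplit', Finset.sum_insert (by rw [← hsplit]; simpa using hi),
    Finset.sum_union hdisj]
  -- Here `j` is the new minimum and no element of `S` precedes it, so the sign is `1` and the sum
  -- telescopes.
  have t1 : ∑ j ∈ Finset.univ.filter (fun j : Fin n => j.1 < i.1),
      (-1 : ℤ) ^ (S.1.filter (· < j)).card •
        α j (extendKSub (koszulHomotopy α s (p + 1) f) (insert j S.1)) =
      f S - contractionProd α s i (f S) := by
    have key := LinearMap.congr_fun (h.sum_prod i i.2.le) (f S)
    rw [LinearMap.sub_apply, Module.End.one_apply] at key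
    rw [← key, LinearMap.sum_apply]
    refine Finset.sum_congr rfl fun j hj => ?_
    have hji : j < i := by simpa using hj
    have hjS : j ∉ S.1 := fun hj' => absurd (hle j hj') (not_le.2 hji)
    rw [koszulHomotopy_ext α s (p + 1) f (i := j)
      (by rw [Finset.card_insert_of_notMem hjS, S.2]) (by simp)
      (by intro l hl
          rcases Finset.mem_insert.1 hl with rfl | hl
          · exact le_rfl
          · exact hji.le.trans (hle l hl)),
      Finset.erase_insert hjS, extendKSub_coe,
      Finset.filter_false_of_mem (fun l hl => not_lt.2 (hji.le.trans (hle l hl)))]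
    simp
  -- Since `s_i α_j = α_j s_i`, the factor `P_i` meets `α_j` with `j < i` and kills it.
  have t2 : ∑ j ∈ Finset.univ.filter (fun j : Fin n => j.1 < i.1),
      contractionProd α s i (s i ((-1 : ℤ) ^ ((S.1.erase i).filter (· < j)).card •
        α j (extendKSub f (insert j (S.1.erase i))))) = 0 := by
    refine Finset.sum_eq_zero fun j hj => ?_
    have hji : j < i := by simpa using hj
    rw [map_zsmul, map_zsmul, ← Module.End.mul_apply (s i), ← (h.comm_of_ne j i hji.ne).eq,
      Module.End.mul_apply, ← Module.End.mul_apply (contractionProd α s i), h.prod_mul j i hji,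
      LinearMap.zero_apply, smul_zero]
  -- Putting `i` back restores `S`, and `s_i α_i = 1`.
  have t3 : contractionProd α s i (s i ((-1 : ℤ) ^ ((S.1.erase i).filter (· < i)).card •
        α i (extendKSub f (insert i (S.1.erase i))))) = contractionProd α s i (f S) := by
    rw [Finset.filter_false_of_mem (fun l hl => not_lt.2 (hle l (Finset.mem_of_mem_erase hl))),
      Finset.card_empty, pow_zero, one_smul, ← Module.End.mul_apply (s i), h.left_inv,
      Finset.insert_erase hi, extendKSub_coe, Module.End.one_apply]
  -- The operators `α_j` and `P_i s_i` commute for `j > i`, and the presence of `i` below `j`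
  -- changes the sign.
  have t4 : ∑ j ∈ (S.1ᶜ).filter (fun j : Fin n => i < j),
      (-1 : ℤ) ^ (S.1.filter (· < j)).card •
        α j (extendKSub (koszulHomotopy α s (p + 1) f) (insert j S.1)) =
      -∑ j ∈ (S.1ᶜ).filter (fun j : Fin n => i < j),
        contractionProd α s i (s i ((-1 : ℤ) ^ ((S.1.erase i).filter (· < j)).card •
          α j (extendKSub f (insert j (S.1.erase i))))) := by
    rw [← Finset.sum_neg_distrib]
    refine Finset.sum_congr rfl fun j hj => ?_
    simp only [Finset.mem_filter, Finset.mem_compl] at hj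
    have hsgn := sign_insert_of_lt (Finset.notMem_erase i S.1) hj.2
    rw [Finset.insert_erase hi] at hsgn
    rw [hsgn, koszulHomotopy_ext α s (p + 1) f (i := i)
      (by rw [Finset.card_insert_of_notMem hj.1, S.2]) (by simp [hi])
      (by intro l hl
          rcases Finset.mem_insert.1 hl with rfl | hl
          · exact hj.2.le
          · exact hle l hl),
      Finset.erase_insert_of_ne hj.2.ne', map_zsmul, map_zsmul, neg_smul, neg_inj,
      ← Module.End.mul_apply (s i), ← (h.comm_of_ne j i hj.2.ne').eq, Module.End.mul_apply,
      ← Module.End.mul_apply (α j), (h.commute_prod j i hj.2.le).eq, Module.End.mul_apply]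
  rw [t1, t2, t3, t4]
  abel

theorem exact_diff (p : ℕ) : Function.Exact (koszulDiff α (p + 1)) (koszulDiff α p) := by
  intro f
  constructor
  · intro hf
    have := h.diff_homotopy_succ p f
    rw [hf, map_zero, add_zero] at this
    exact ⟨_, this⟩
  · rintro ⟨g, rfl⟩
    exact koszulDiff_comp α h.comm p g

/-- This is the identity that expresses splitness. It follows from `dh + hd = 1` and `d² = 0`, and
only uses `dh + hd = 1` in positive degrees, so it covers `p = 0`. -/
theorem diff_homotopy_diff (p : ℕ) (f : KSub n (p + 1) → W) :
    koszulDiff α p (koszulHomotopy α s p (koszulDiff α p f)) = koszulDiff α p f := by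
  have h1 := congrArg (koszulDiff α p) (h.diff_homotopy_succ p f)
  rwa [map_add, koszulDiff_comp α h.comm, zero_add] at h1

end IsKoszulContraction

section Naturality

variable {W' : Type*} [AddCommGroup W'] [Module k W'] {α s : Fin n → Module.End k W}
  {α' s' : Fin n → Module.End k W'} {g : W →ₗ[k] W'}

theorem contractionProd_map (hα : ∀ i w, g (α i w) = α' i (g w)) (hs : ∀ i w, g (s i w) = s' i (g w))
    (m : ℕ) (w : W) : g (contractionProd α s m w) = contractionProd α' s' m (g w) := by
  induction m generalizing w with
  | zero => rfl
  | succ m ih =>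
    rw [contractionProd, contractionProd, Module.End.mul_apply, Module.End.mul_apply, ih]
    split_ifs with h
    · simp [hα, hs]
    · rfl

/-- The homotopy is built from `α` and `s` alone, so it commutes with every map that respects both.
Applied to the arrows of a functor, this makes it a morphism of `𝓕`. -/
theorem koszulHomotopy_map (hα : ∀ i w, g (α i w) = α' i (g w))
    (hs : ∀ i w, g (s i w) = s' i (g w)) (p : ℕ) (f : KSub n p → W) :
    koszulHomotopy α' s' p (fun S => g (f S)) = fun S => g (koszulHomotopy α s p f S) := by
  funext S
  have hne : S.1.Nonempty := Finset.card_pos.1 (by rw [S.2]; omega)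
  have hi := Finset.min'_mem _ hne
  have hle : ∀ j ∈ S.1, S.1.min' hne ≤ j := fun j hj => Finset.min'_le _ _ hj
  rw [koszulHomotopy_apply α' s' p _ S hi hle, koszulHomotopy_apply α s p _ S hi hle,
    contractionProd_map hα hs, hs, extendKSub_map]

end Naturality

end AbstractKoszul

/-! ### Products by `u_i - v_i` and divided differences on polynomials. -/

section PolynomialOperators

variable {R : Type*} [CommRing R] {n : ℕ} (V : Type*) [AddCommGroup V] [Module R V]

/-- The exponent of the variable `u_i`. -/
noncomputable abbrev expU (i : Fin n) : Fin n ⊕ Fin n →₀ ℕ := Finsupp.single (Sum.inl i) 1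

/-- The exponent of the variable `v_i`. -/
noncomputable abbrev expV (i : Fin n) : Fin n ⊕ Fin n →₀ ℕ := Finsupp.single (Sum.inr i) 1

variable (R) in
/-- The product by a monomial. -/
noncomputable def shiftPoly (e : Fin n ⊕ Fin n →₀ ℕ) :
    Module.End R ((Fin n ⊕ Fin n →₀ ℕ) →₀ V) :=
  Finsupp.lmapDomain V R (e + ·)

variable (R) in
/-- The product by `u_i - v_i`. -/
noncomputable def alphaPoly (i : Fin n) : Module.End R ((Fin n ⊕ Fin n →₀ ℕ) →₀ V) :=
  shiftPoly R V (expU i) - shiftPoly R V (expV i)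

variable (R) in
/-- The divided difference `f ↦ (f - f|_{u_i = v_i}) / (u_i - v_i)`. -/
noncomputable def divDiff (i : Fin n) : Module.End R ((Fin n ⊕ Fin n →₀ ℕ) →₀ V) :=
  -- The power `u_i^q` goes to `∑_{l<q} u_i^l v_i^(q-1-l)` and the other variables are kept. For `q
  -- = 0` the sum is empty, so the truncated subtraction does no harm.
  Finsupp.lsum R fun m => ∑ l ∈ Finset.range (m (Sum.inl i)),
    Finsupp.lsingle (m.erase (Sum.inl i) + l • expU i + (m (Sum.inl i) - 1 - l) • expV i)

theorem shiftPoly_single (e m : Fin n ⊕ Fin n →₀ ℕ) (a : V) :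
    shiftPoly R V e (Finsupp.single m a) = Finsupp.single (e + m) a := by
  simp [shiftPoly]

theorem alphaPoly_single (i : Fin n) (m : Fin n ⊕ Fin n →₀ ℕ) (a : V) :
    alphaPoly R V i (Finsupp.single m a) =
      Finsupp.single (expU i + m) a - Finsupp.single (expV i + m) a := by
  simp [alphaPoly, shiftPoly_single]

theorem divDiff_single (i : Fin n) (m : Fin n ⊕ Fin n →₀ ℕ) (hm : m (Sum.inl i) = 0) (q : ℕ)
    (a : V) : divDiff R V i (Finsupp.single (m + q • expU i) a) =
      ∑ l ∈ Finset.range q, Finsupp.single (m + l • expU i + (q - 1 - l) • expV i) a := by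
  have h1 : (m + q • expU i) (Sum.inl i) = q := by simp [hm]
  have h2 : (m + q • expU i).erase (Sum.inl i) = m := by
    ext j
    by_cases hj : j = Sum.inl i
    · simp [hj, hm]
    · simp [Finsupp.erase_ne hj]
  rw [divDiff, Finsupp.lsum_single, LinearMap.sum_apply, h1, h2]
  rfl

theorem exists_eq_add_expU (i : Fin n) (m : Fin n ⊕ Fin n →₀ ℕ) :
    ∃ (m' : Fin n ⊕ Fin n →₀ ℕ) (q : ℕ), m' (Sum.inl i) = 0 ∧ m = m' + q • expU i :=
  ⟨m.erase (Sum.inl i), m (Sum.inl i), by simp, by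
    rw [Finsupp.smul_single_one, Finsupp.erase_add_single]⟩

/-- Raising the exponent of `u_i` by one multiplies the old terms by `v_i` and adds the term `l =
q`, which is the monomial itself. This is `s_i α_i = 1` in disguise. -/
theorem divDiff_shiftPoly_expU (i : Fin n) (m : Fin n ⊕ Fin n →₀ ℕ) (a : V) :
    divDiff R V i (Finsupp.single (expU i + m) a) =
      divDiff R V i (Finsupp.single (expV i + m) a) + Finsupp.single m a := by
  obtain ⟨m, q, hm, rfl⟩ := exists_eq_add_expU i m
  have hv : (expV i + m) (Sum.inl i) = 0 := by simp [hm]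
  rw [show expU i + (m + q • expU i) = m + (q + 1) • expU i by rw [add_smul, one_smul]; abel,
    divDiff_single V i m hm, ← add_assoc (expV i), divDiff_single V i _ hv,
    Finset.sum_range_succ]
  congr 1
  · refine Finset.sum_congr rfl fun l hl => ?_
    have : q + 1 - 1 - l = (q - 1 - l) + 1 := by
      have := Finset.mem_range.1 hl
      omega
    rw [this, add_smul, one_smul]
    congr 1
    abel
  · simp

/-- The operator `s_i` is linear over the polynomials in all variables except `u_i`. The variable
`v_i` is allowed, but only the case of the other indices is needed for the commutation with `α_j`.
-/
theorem divDiff_shiftPoly {i : Fin n} (e : Fin n ⊕ Fin n →₀ ℕ) (he : e (Sum.inl i) = 0)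
    (f : (Fin n ⊕ Fin n →₀ ℕ) →₀ V) :
    divDiff R V i (shiftPoly R V e f) = shiftPoly R V e (divDiff R V i f) := by
  induction f using Finsupp.induction_linear with
  | zero => simp
  | add f g hf hg => simp only [map_add, hf, hg]
  | single m a =>
    obtain ⟨m, q, hm, rfl⟩ := exists_eq_add_expU i m
    rw [shiftPoly_single, ← add_assoc, divDiff_single V i _ (by simp [hm, he]),
      divDiff_single V i m hm, map_sum]
    refine Finset.sum_congr rfl fun l _ => ?_
    rw [shiftPoly_single, add_assoc, add_assoc, add_assoc]

theorem shiftPoly_comm (e e' : Fin n ⊕ Fin n →₀ ℕ) :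
    Commute (shiftPoly R V e) (shiftPoly R V e') := by
  refine Finsupp.lhom_ext fun m a => ?_
  simp only [Module.End.mul_apply, shiftPoly_single]
  rw [add_left_comm]

theorem alphaPoly_comm (i j : Fin n) : Commute (alphaPoly R V i) (alphaPoly R V j) := by
  unfold alphaPoly
  refine Commute.sub_right (Commute.sub_left ?_ ?_) (Commute.sub_left ?_ ?_) <;>
    exact shiftPoly_comm V _ _

theorem alphaPoly_divDiff_comm {i j : Fin n} (hij : i ≠ j) :
    Commute (alphaPoly R V i) (divDiff R V j) := by
  refine LinearMap.ext fun f => ?_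
  rw [Module.End.mul_apply, Module.End.mul_apply, alphaPoly, LinearMap.sub_apply,
    LinearMap.sub_apply, map_sub, divDiff_shiftPoly V _ (by simp [hij]),
    divDiff_shiftPoly V _ (by simp)]

theorem divDiff_mul_alphaPoly (i : Fin n) : divDiff R V i * alphaPoly R V i = 1 := by
  refine Finsupp.lhom_ext fun m a => ?_
  rw [Module.End.mul_apply, alphaPoly_single, map_sub, divDiff_shiftPoly_expU,
    add_sub_cancel_left, Module.End.one_apply]

theorem isKoszulContraction_alphaPoly :
    IsKoszulContraction (alphaPoly R (n := n) V) (divDiff R V) :=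
  ⟨divDiff_mul_alphaPoly V, alphaPoly_comm V, fun _ _ h => alphaPoly_divDiff_comm V h⟩

/-- The substitution `u_i ↦ v_i` for all `i`, as an idempotent. -/
noncomputable abbrev contractAll : Module.End R ((Fin n ⊕ Fin n →₀ ℕ) →₀ V) :=
  contractionProd (alphaPoly R V) (divDiff R V) n

/-- The relation `P_n α_i = 0` says that `P_n` does not distinguish `u_i` from `v_i`. -/
theorem contractAll_expU (i : Fin n) (m : Fin n ⊕ Fin n →₀ ℕ) (a : V) :
    contractAll (R := R) V (Finsupp.single (expU i + m) a) =
      contractAll (R := R) V (Finsupp.single (expV i + m) a) := by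
  have h := LinearMap.congr_fun
    ((isKoszulContraction_alphaPoly (R := R) (n := n) V).prod_mul i n i.2) (Finsupp.single m a)
  rwa [Module.End.mul_apply, alphaPoly_single, map_sub, LinearMap.zero_apply, sub_eq_zero] at h

/-- Without variables `u`, every divided difference is an empty sum, so each factor of `P_n` acts as
the identity. -/
theorem contractAll_inr (b : Fin n →₀ ℕ) (a : V) :
    contractAll (R := R) V (Finsupp.single (b.mapDomain Sum.inr) a) =
      Finsupp.single (b.mapDomain Sum.inr) a := by
  suffices h : ∀ m, contractionProd (alphaPoly R V) (divDiff R V) m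
      (Finsupp.single (b.mapDomain Sum.inr) a) = Finsupp.single (b.mapDomain Sum.inr) a from h n
  intro m
  induction m with
  | zero => rfl
  | succ m ih =>
    rw [contractionProd, Module.End.mul_apply]
    split_ifs with h
    · have h0 : (b.mapDomain Sum.inr : Fin n ⊕ Fin n →₀ ℕ) (Sum.inl ⟨m, h⟩) = 0 :=
        Finsupp.mapDomain_of_notMem_range _ _ (by simp)
      have := divDiff_single (R := R) V ⟨m, h⟩ _ h0 0 a
      rw [zero_smul, add_zero] at this
      rw [LinearMap.sub_apply, Module.End.mul_apply, this]
      simpa using ih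
    · exact ih

theorem contractAll_inl_add (c : Fin n →₀ ℕ) (m : Fin n ⊕ Fin n →₀ ℕ) (a : V) :
    contractAll (R := R) V (Finsupp.single (c.mapDomain Sum.inl + m) a) =
      contractAll (R := R) V (Finsupp.single (c.mapDomain Sum.inr + m) a) := by
  induction c using Finsupp.induction_linear generalizing m with
  | zero => simp
  | add c c' hc hc' =>
    rw [Finsupp.mapDomain_add, Finsupp.mapDomain_add, add_assoc, hc, add_left_comm, hc', add_assoc,
      add_left_comm]
  | single i q =>
    rw [Finsupp.mapDomain_single, Finsupp.mapDomain_single]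
    induction q generalizing m with
    | zero => simp
    | succ q ih =>
      rw [Finsupp.single_add, Finsupp.single_add, add_assoc, add_assoc, ih, add_left_comm,
        contractAll_expU, add_left_comm]

theorem contractAll_single (c b : Fin n →₀ ℕ) (a : V) :
    contractAll (R := R) V
      (Finsupp.single (c.mapDomain Sum.inl + b.mapDomain Sum.inr) a) =
      Finsupp.single ((c + b).mapDomain Sum.inr) a := by
  rw [contractAll_inl_add, ← Finsupp.mapDomain_add, contractAll_inr]

theorem eq_mapDomain_add (m : Fin n ⊕ Fin n →₀ ℕ) :
    ∃ c b : Fin n →₀ ℕ, m = c.mapDomain Sum.inl + b.mapDomain Sum.inr := by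
  induction m using Finsupp.induction_linear with
  | zero => exact ⟨0, 0, by simp⟩
  | add m m' h h' =>
    obtain ⟨c, b, rfl⟩ := h
    obtain ⟨c', b', rfl⟩ := h'
    exact ⟨c + c', b + b', by rw [Finsupp.mapDomain_add, Finsupp.mapDomain_add]; abel⟩
  | single j q =>
    rcases j with j | j
    · exact ⟨Finsupp.single j q, 0, by simp⟩
    · exact ⟨0, Finsupp.single j q, by simp⟩

variable {V} {V' : Type*} [AddCommGroup V'] [Module R V'] (g : V →ₗ[R] V')

theorem mapRange_divDiff (i : Fin n) (f : (Fin n ⊕ Fin n →₀ ℕ) →₀ V) :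
    Finsupp.mapRange.linearMap g (divDiff R V i f) =
      divDiff R V' i (Finsupp.mapRange.linearMap g f) := by
  induction f using Finsupp.induction_linear with
  | zero => simp
  | add f g hf hg => simp only [map_add, hf, hg]
  | single m a =>
    obtain ⟨m, q, hm, rfl⟩ := exists_eq_add_expU i m
    rw [divDiff_single V i m hm, map_sum, Finsupp.mapRange.linearMap_apply,
      Finsupp.mapRange_single, divDiff_single V' i m hm]
    refine Finset.sum_congr rfl fun l _ => ?_
    simp

end PolynomialOperators

/-! ### Pairings on a tensor idempotent monoid and the isomorphism `A_n ⊗ A_n ≅ A[u, v]`. -/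

section Idempotent

variable {R : Type r} [CommRing R] {X : Type u} [Category.{v} X] [Preadditive X] [Linear R X]
  [MonoidalCategory X]

/-- The class of `θ ⊗ (a ⊗ b)` in the tensor product. -/
noncomputable def DayObj.mk (F : LinFun.{r, u, v, t₁} R X) (G : LinFun.{r, u, v, t₂} R X)
    {x y z : X} (θ : x ⊗ y ⟶ z) (a : F.obj x) (b : G.obj y) : (F.tensor G).obj z :=
  (DaySum.rel F G z).mkQ (DaySum.gen F G θ a b)

theorem Pairing.desc_mk {F : LinFun.{r, u, v, t₁} R X} {G : LinFun.{r, u, v, t₂} R X}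
    {H : LinFun.{r, u, v, t₃} R X} (P : Pairing F G H) {x y z : X} (θ : x ⊗ y ⟶ z) (a : F.obj x)
    (b : G.obj y) : P.desc.app z (DayObj.mk F G θ a b) = H.map θ (P.toFun x y a b) :=
  P.sumDesc_gen θ a b

theorem DayObj.map_mk (F : LinFun.{r, u, v, t₁} R X) (G : LinFun.{r, u, v, t₂} R X)
    {x y z z' : X} (ξ : z ⟶ z') (θ : x ⊗ y ⟶ z) (a : F.obj x) (b : G.obj y) :
    (F.tensor G).map ξ (DayObj.mk F G θ a b) = DayObj.mk F G (θ ≫ ξ) a b :=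
  congrArg (DaySum.rel F G z').mkQ (DaySum.map_gen F G ξ θ a b)

theorem DayObj.mk_comp (F : LinFun.{r, u, v, t₁} R X) (G : LinFun.{r, u, v, t₂} R X)
    {x x' y y' z : X} (φ : x ⟶ x') (ψ : y ⟶ y') (θ : x' ⊗ y' ⟶ z) (a : F.obj x) (b : G.obj y) :
    DayObj.mk F G ((φ ⊗ₘ ψ) ≫ θ) a b = DayObj.mk F G θ (F.map φ a) (G.map ψ b) :=
  (Submodule.Quotient.eq _).2 (Submodule.subset_span ⟨x, x', y, y', φ, ψ, θ, a, b, rfl⟩)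

/-- Two linear maps on the tensor product that agree on the generators are equal. -/
theorem DayObj.hom_ext {F : LinFun.{r, u, v, t₁} R X} {G : LinFun.{r, u, v, t₂} R X} {z : X}
    {W : Type*} [AddCommGroup W] [Module R W] {f g : (F.tensor G).obj z →ₗ[R] W}
    (h : ∀ (x y : X) (θ : x ⊗ y ⟶ z) (a : F.obj x) (b : G.obj y),
      f (DayObj.mk F G θ a b) = g (DayObj.mk F G θ a b)) : f = g := by
  refine LinearMap.ext fun w => ?_
  obtain ⟨w, rfl⟩ := Submodule.mkQ_surjective (DaySum.rel F G z) w
  exact LinearMap.congr_fun (DaySum.hom_ext (f := f ∘ₗ (DaySum.rel F G z).mkQ)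
    (g := g ∘ₗ (DaySum.rel F G z).mkQ) h) w

/-- Every pairing factors through `A ⊗ A`, where injectivity of `μ_A` identifies generators with the
same image in `A`. This is the only way in which idempotence enters; surjectivity of `μ_A` is
automatic from the unit. -/
theorem FMon.IsTensorIdempotent.pairing_congr {A : FMon.{r, u, v, t} R X}
    (hA : A.IsTensorIdempotent) {H : LinFun.{r, u, v, s} R X}
    (P : Pairing A.toLinFun A.toLinFun H) {x y x' y' z : X} (θ : x ⊗ y ⟶ z) (θ' : x' ⊗ y' ⟶ z)
    (a : A.obj x) (b : A.obj y) (a' : A.obj x') (b' : A.obj y')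
    (h : A.map θ (A.times a b) = A.map θ' (A.times a' b')) :
    H.map θ (P.toFun x y a b) = H.map θ' (P.toFun x' y' a' b') := by
  rw [← P.desc_mk, ← P.desc_mk]
  refine congrArg _ ((hA z).1 ?_)
  rw [A.mul.desc_mk, A.mul.desc_mk]
  exact h

/-- The universal pairing `(a, b) ↦ a ⊗ b`. -/
noncomputable def Pairing.univ (F : LinFun.{r, u, v, t₁} R X) (G : LinFun.{r, u, v, t₂} R X) :
    Pairing F G (F.tensor G) where
  toFun x y := LinearMap.mk₂ R (fun a b => DayObj.mk F G (𝟙 (x ⊗ y)) a b)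
    (fun a a' b => by
      simp only [DayObj.mk, DaySum.gen, TensorProduct.add_tmul, TensorProduct.tmul_add, map_add]
      rfl)
    (fun c a b => by
      simp only [DayObj.mk, DaySum.gen, ← TensorProduct.smul_tmul', TensorProduct.tmul_smul,
        map_smul]
      rfl)
    (fun a b b' => by
      simp only [DayObj.mk, DaySum.gen, TensorProduct.tmul_add, map_add]
      rfl)
    (fun c a b => by
      simp only [DayObj.mk, DaySum.gen, TensorProduct.tmul_smul, map_smul]
      rfl)
  naturality {x x' y y'} φ ψ a b := by
    have h := DayObj.mk_comp F G φ ψ (𝟙 _) a b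
    rw [Category.comp_id] at h
    refine h.symm.trans ((DayObj.map_mk F G (φ ⊗ₘ ψ) (𝟙 _) a b).trans ?_).symm
    rw [Category.id_comp]

theorem Pairing.univ_map (F : LinFun.{r, u, v, t₁} R X) (G : LinFun.{r, u, v, t₂} R X)
    {x y z : X} (θ : x ⊗ y ⟶ z) (a : F.obj x) (b : G.obj y) :
    (F.tensor G).map θ ((Pairing.univ F G).toFun x y a b) = DayObj.mk F G θ a b :=
  (DayObj.map_mk F G θ (𝟙 _) a b).trans (by rw [Category.id_comp])

/-- The restriction of a pairing along two morphisms. -/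
def Pairing.comp {F F' : LinFun.{r, u, v, t₁} R X} {G G' : LinFun.{r, u, v, t₂} R X}
    {H : LinFun.{r, u, v, t₃} R X} (P : Pairing F G H)
    (f : LinFun.Hom F' F) (g : LinFun.Hom G' G) : Pairing F' G' H where
  toFun x y := (P.toFun x y).compl₁₂ (f.app x) (g.app y)
  naturality φ ψ a b := by
    simp only [LinearMap.compl₁₂_apply, f.naturality, g.naturality, P.naturality]

/-- The morphism `a ↦ a t^i`. -/
noncomputable def FMon.monomial (A : FMon.{r, u, v, t} R X) {σ : Type} (i : σ →₀ ℕ) :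
    LinFun.Hom A.toLinFun (A.poly σ).toLinFun where
  app x := (Finsupp.lsingle i : A.obj x →ₗ[R] ((σ →₀ ℕ) →₀ A.obj x))
  naturality φ a := (A.polyMap_single σ φ i a).symm

theorem FMon.poly_times (A : FMon.{r, u, v, t} R X) {σ : Type} (i j : σ →₀ ℕ) {x y : X}
    (a : A.obj x) (b : A.obj y) :
    (A.poly σ).times ((A.monomial i).app x a) ((A.monomial j).app y b) =
      (A.monomial (i + j)).app (x ⊗ y) (A.times a b) :=
  A.polyMul_single σ x y i j a b

/-- Two linear maps on polynomials that agree on monomials are equal. -/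
theorem FMon.poly_hom_ext (A : FMon.{r, u, v, t} R X) {σ : Type} {x : X}
    {W : Type*} [AddCommGroup W] [Module R W] {f g : (A.poly σ).obj x →ₗ[R] W}
    (h : ∀ (i : σ →₀ ℕ) (a : A.obj x), f ((A.monomial i).app x a) = g ((A.monomial i).app x a)) :
    f = g :=
  Finsupp.lhom_ext h

theorem FMon.rename_monomial (A : FMon.{r, u, v, t} R X) {σ τ : Type} (f : σ → τ) {x : X}
    (i : σ →₀ ℕ) (a : A.obj x) :
    (A.rename f).app x ((A.monomial i).app x a) = (A.monomial (i.mapDomain f)).app x a :=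
  A.renameApp_single f x i a

theorem FMon.polyPairing_monomial (A : FMon.{r, u, v, t} R X) (n : ℕ) (i j : Fin n →₀ ℕ) {x y : X}
    (a : A.obj x) (b : A.obj y) :
    (A.polyPairing n).toFun x y ((A.monomial i).app x a) ((A.monomial j).app y b) =
      (A.monomial (i.mapDomain Sum.inl + j.mapDomain Sum.inr)).app (x ⊗ y) (A.times a b) :=
  (congrArg₂ (fun p q => A.polyMul (Fin n ⊕ Fin n) x y p q) (A.renameApp_single Sum.inl x i a)
    (A.renameApp_single Sum.inr y j b)).trans (A.polyMul_single _ x y _ _ a b)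

theorem DayObj.hom_ext_poly {A : FMon.{r, u, v, t} R X} {σ : Type} {z : X}
    {W : Type*} [AddCommGroup W] [Module R W]
    {f g : ((A.poly σ).toLinFun.tensor (A.poly σ).toLinFun).obj z →ₗ[R] W}
    (h : ∀ (x y : X) (θ : x ⊗ y ⟶ z) (i j : σ →₀ ℕ) (a : A.obj x) (b : A.obj y),
      f (DayObj.mk _ _ θ ((A.monomial i).app x a) ((A.monomial j).app y b)) =
        g (DayObj.mk _ _ θ ((A.monomial i).app x a) ((A.monomial j).app y b))) : f = g := by
  refine DayObj.hom_ext fun x y θ p q => ?_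
  let P := Pairing.univ (A.poly σ).toLinFun (A.poly σ).toLinFun
  let m := ((A.poly σ).toLinFun.tensor (A.poly σ).toLinFun).map θ
  -- Through the universal pairing both sides become bilinear in the two polynomials, so each of
  -- them can be reduced to monomials.
  have key : (P.toFun x y).compr₂ (f ∘ₗ m) = (P.toFun x y).compr₂ (g ∘ₗ m) := by
    refine A.poly_hom_ext fun i a => A.poly_hom_ext fun j b => ?_
    have := h x y θ i j a b
    rwa [← Pairing.univ_map] at this
  have := LinearMap.congr_fun₂ key p q
  rw [← Pairing.univ_map]
  exact this

theorem FMon.polyPairing_desc_mk (A : FMon.{r, u, v, t} R X) (n : ℕ) (i j : Fin n →₀ ℕ)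
    {x y z : X} (θ : x ⊗ y ⟶ z) (a : A.obj x) (b : A.obj y) :
    (A.polyPairing n).desc.app z
      (DayObj.mk _ _ θ ((A.monomial i).app x a) ((A.monomial j).app y b)) =
      (A.monomial (i.mapDomain Sum.inl + j.mapDomain Sum.inr)).app z (A.map θ (A.times a b)) := by
  rw [Pairing.desc_mk, polyPairing_monomial, LinFun.Hom.naturality]

theorem sumFinsuppEquivProdFinsupp_mapDomain_add {ι : Type} (c b : ι →₀ ℕ) :
    Finsupp.sumFinsuppEquivProdFinsupp (c.mapDomain Sum.inl + b.mapDomain Sum.inr) = (c, b) := by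
  refine Prod.ext (Finsupp.ext fun i => ?_) (Finsupp.ext fun i => ?_)
  · rw [Finsupp.fst_sumFinsuppEquivProdFinsupp, Finsupp.add_apply,
      Finsupp.mapDomain_apply Sum.inl_injective, Finsupp.mapDomain_of_notMem_range _ _ (by simp),
      add_zero]
  · rw [Finsupp.snd_sumFinsuppEquivProdFinsupp, Finsupp.add_apply,
      Finsupp.mapDomain_apply Sum.inr_injective, Finsupp.mapDomain_of_notMem_range _ _ (by simp),
      zero_add]

/-- The inverse of `(p, q) ↦ p(u) × q(v)`. -/
noncomputable def FMon.polyPairingInv (A : FMon.{r, u, v, t} R X) (n : ℕ) (z : X) :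
    (A.poly (Fin n ⊕ Fin n)).obj z →ₗ[R]
      ((A.poly (Fin n)).toLinFun.tensor (A.poly (Fin n)).toLinFun).obj z :=
  -- The monomial `a u^c v^b` goes to `a t^c ⊗ ε t^b`: the whole coefficient is put on the left.
  Finsupp.lsum R fun m =>
    (((A.poly (Fin n)).toLinFun.tensor (A.poly (Fin n)).toLinFun).map (ρ_ z).hom) ∘ₗ
      ((((Pairing.univ (A.poly (Fin n)).toLinFun (A.poly (Fin n)).toLinFun).comp
        (A.monomial (Finsupp.sumFinsuppEquivProdFinsupp m).1)
        (A.monomial (Finsupp.sumFinsuppEquivProdFinsupp m).2)).toFun z (𝟙_ X)).flip A.one)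

theorem FMon.polyPairingInv_monomial (A : FMon.{r, u, v, t} R X) (n : ℕ) (z : X)
    (c b : Fin n →₀ ℕ) (a : A.obj z) :
    A.polyPairingInv n z ((A.monomial (c.mapDomain Sum.inl + b.mapDomain Sum.inr)).app z a) =
      DayObj.mk (A.poly (Fin n)).toLinFun (A.poly (Fin n)).toLinFun (ρ_ z).hom
        ((A.monomial c).app z a) ((A.monomial b).app (𝟙_ X) A.one) := by
  refine (Finsupp.lsum_single _ _ _ _).trans ?_
  rw [sumFinsuppEquivProdFinsupp_mapDomain_add]
  exact Pairing.univ_map _ _ _ _ _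

theorem FMon.polyPairing_isIso (A : FMon.{r, u, v, t} R X) (hA : A.IsTensorIdempotent) (n : ℕ) :
    (A.polyPairing n).desc.IsIso := by
  intro z
  refine Function.bijective_iff_has_inverse.2 ⟨A.polyPairingInv n z, fun w => ?_, fun w => ?_⟩
  · refine LinearMap.congr_fun (f := A.polyPairingInv n z ∘ₗ (A.polyPairing n).desc.app z)
      (g := LinearMap.id) (DayObj.hom_ext_poly fun x y θ i j a b => ?_) w
    rw [LinearMap.comp_apply, polyPairing_desc_mk, polyPairingInv_monomial, LinearMap.id_apply,
      ← Pairing.univ_map, ← Pairing.univ_map]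
    -- The pairs `(A(θ)(a × b), ε)` and `(a, b)` have the same product along their respective
    -- arrows, so the coefficient can be moved to the left.
    exact hA.pairing_congr ((Pairing.univ _ _).comp (A.monomial i) (A.monomial j)) _ _ _ _ _ _
      (A.mul_one _)
  · refine LinearMap.congr_fun (f := (A.polyPairing n).desc.app z ∘ₗ A.polyPairingInv n z)
      (g := LinearMap.id) (A.poly_hom_ext fun m a => ?_) w
    obtain ⟨c, b, rfl⟩ := eq_mapDomain_add m
    rw [LinearMap.comp_apply, polyPairingInv_monomial, polyPairing_desc_mk, LinearMap.id_apply]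
    exact congrArg _ (A.mul_one a)

theorem FMon.fold_monomial (A : FMon.{r, u, v, t} R X) (n : ℕ) {x : X} (c b : Fin n →₀ ℕ)
    (a : A.obj x) :
    (A.fold n).app x ((A.monomial (c.mapDomain Sum.inl + b.mapDomain Sum.inr)).app x a) =
      (A.monomial (c + b)).app x a := by
  rw [rename_monomial, Finsupp.mapDomain_add, ← Finsupp.mapDomain_comp, ← Finsupp.mapDomain_comp]
  simp

theorem FMon.fold_comp_polyPairing (A : FMon.{r, u, v, t} R X) (n : ℕ) (z : X) :
    (A.fold n).app z ∘ₗ (A.polyPairing n).desc.app z = (A.poly (Fin n)).mul.desc.app z := by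
  refine DayObj.hom_ext_poly fun x y θ i j a b => ?_
  rw [LinearMap.comp_apply, polyPairing_desc_mk, fold_monomial, Pairing.desc_mk]
  refine Eq.trans ?_ (congrArg _ (A.poly_times i j a b)).symm
  rw [LinFun.Hom.naturality]

end Idempotent

/-! ### Isomorphisms from bijective components, and morphisms out of quotients. -/

section IsoOfBijective

variable {R : Type r} [CommRing R] {X : Type u} [Category.{v} X] [Preadditive X] [Linear R X]

/-- A morphism of functors with bijective components is an isomorphism. -/
noncomputable def LinFun.isoOfBijective {F G : LinFun.{r, u, v, t} R X} (f : F ⟶ G)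
    (hf : LinFun.Hom.IsIso f) : F ≅ G where
  hom := f
  inv :=
    { app := fun x => (LinearEquiv.ofBijective (LinFun.Hom.app f x) (hf x)).symm.toLinearMap
      naturality := fun {x y} φ a => by
        apply (LinearEquiv.ofBijective (LinFun.Hom.app f y) (hf y)).injective
        refine (LinearEquiv.apply_symm_apply _ _).trans ?_
        refine Eq.trans ?_ (LinFun.Hom.naturality f φ _).symm
        exact congrArg _ (LinearEquiv.apply_symm_apply
          (LinearEquiv.ofBijective (LinFun.Hom.app f x) (hf x)) a).symm }
  hom_inv_id := LinFun.Hom.ext (funext fun x => LinearMap.ext fun a =>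
    (LinearEquiv.ofBijective (LinFun.Hom.app f x) (hf x)).symm_apply_apply a)
  inv_hom_id := LinFun.Hom.ext (funext fun x => LinearMap.ext fun a =>
    (LinearEquiv.ofBijective (LinFun.Hom.app f x) (hf x)).apply_symm_apply a)

variable [MonoidalCategory X] {A : FMon.{r, u, v, t} R X}

/-- A morphism of modules with bijective components is an isomorphism. -/
noncomputable def FMod.isoOfBijective {M N : FMod.{r, u, v, t, s} A} (f : M ⟶ N)
    (hf : LinFun.Hom.IsIso (FMod.Hom.toHom f)) : M ≅ N where
  hom := f
  inv :=
    { toHom := (LinFun.isoOfBijective (F := M.toLinFun) (G := N.toLinFun) (FMod.Hom.toHom f) hf).inv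
      map_smul := fun {x y} a n => by
        apply (hf (x ⊗ y)).1
        refine (LinearEquiv.apply_symm_apply
          (LinearEquiv.ofBijective (f.app (x ⊗ y)) (hf (x ⊗ y))) _).trans ?_
        refine Eq.trans ?_ (FMod.Hom.map_smul f a _).symm
        exact congrArg _ (LinearEquiv.apply_symm_apply
          (LinearEquiv.ofBijective (f.app y) (hf y)) n).symm }
  hom_inv_id := FMod.Hom.ext (funext fun x => LinearMap.ext fun a =>
    (LinearEquiv.ofBijective (f.app x) (hf x)).symm_apply_apply a)
  inv_hom_id := FMod.Hom.ext (funext fun x => LinearMap.ext fun a =>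
    (LinearEquiv.ofBijective (f.app x) (hf x)).apply_symm_apply a)

/-- The morphism from a quotient induced by a morphism that kills the submodule. -/
def FMod.quotDesc {M N : FMod.{r, u, v, t, s} A} (K : FSub M) (f : M ⟶ N)
    (hf : ∀ x, K.carrier x ≤ LinearMap.ker (f.app x)) : M.quot K ⟶ N where
  app x := (K.carrier x).liftQ (f.app x) (hf x)
  naturality {x y} φ m := by
    obtain ⟨m, rfl⟩ := Submodule.mkQ_surjective (K.carrier x) m
    exact f.naturality φ m
  map_smul {x y} a m := by
    obtain ⟨m, rfl⟩ := Submodule.mkQ_surjective (K.carrier y) m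
    exact f.map_smul a m

end IsoOfBijective

/-! ### Submodules generated by elements of the commutant. -/

section Ideal

variable {R : Type r} [CommRing R] {X : Type u} [Category.{v} X] [Preadditive X] [Linear R X]
  [MonoidalCategory X] (A : FMon.{r, u, v, t} R X)

/-- The submodule with values `∑_{j ∈ J} α_j A`. -/
def FMon.sumRange [BraidedCategory X] {n : ℕ} (α : Fin n → A.obj (𝟙_ X))
    (hα : ∀ i, A.InCommutant (α i)) (J : Set (Fin n)) : FSub A.self where
  carrier x := ⨆ j ∈ J, LinearMap.range (A.L (α j) x)
  map_mem {x y} φ m hm := by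
    have h : ⨆ j ∈ J, LinearMap.range (A.L (α j) x) ≤ Submodule.comap (A.map φ)
      (⨆ j ∈ J, LinearMap.range (A.L (α j) y)) := by
      refine iSup₂_le fun j hj => ?_
      rintro _ ⟨b, rfl⟩
      rw [Submodule.mem_comap, ← A.L_map]
      exact Submodule.mem_iSup_of_mem j (Submodule.mem_iSup_of_mem hj ⟨_, rfl⟩)
    exact h hm
  smul_mem {x y} a m hm := by
    have h : ⨆ j ∈ J, LinearMap.range (A.L (α j) y) ≤ Submodule.comap (A.mul.toFun x y a)
      (⨆ j ∈ J, LinearMap.range (A.L (α j) (x ⊗ y))) := by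
      refine iSup₂_le fun j hj => ?_
      rintro _ ⟨b, rfl⟩
      exact Submodule.mem_iSup_of_mem j (Submodule.mem_iSup_of_mem hj
        ⟨A.times a b, A.L_mul (hα j) a b⟩)
    exact h hm

theorem FMon.L_one_right [BraidedCategory X] (a : A.obj (𝟙_ X)) : A.L a (𝟙_ X) A.one = a := by
  have h := A.mul_one a
  rw [FMon.L, LinearMap.comp_apply]
  rw [← unitors_equal] at h
  exact h

/-- As the `α_j` belong to the commutant, the sums of multiples of the `α_j` already form a
submodule, `FMon.sumRange`. Conversely, a submodule that contains `α_j` contains `b × α_j`, which is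
`α_j × b` up to the symmetry. -/
theorem FMon.ideal_carrier [BraidedCategory X] {n : ℕ} (α : Fin n → A.obj (𝟙_ X))
    (hα : ∀ i, A.InCommutant (α i)) (J : Set (Fin n)) (x : X) :
    (A.ideal α J).carrier x = ⨆ j ∈ J, LinearMap.range (A.L (α j) x) := by
  refine le_antisymm (sInf_le ⟨A.sumRange α hα J, ?_, rfl⟩) (iSup₂_le fun j hj => ?_)
  · rintro _ ⟨j, hj, rfl⟩
    exact Submodule.mem_iSup_of_mem j (Submodule.mem_iSup_of_mem hj ⟨_, A.L_one_right (α j)⟩)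
  · rintro _ ⟨b, rfl⟩
    refine Submodule.mem_sInf.2 ?_
    rintro _ ⟨N, hN, rfl⟩
    have h1 := N.map_mem (ρ_ x).hom _ (N.smul_mem b (α j) (hN ⟨j, hj, rfl⟩))
    have h2 : A.L (α j) x b = A.map (ρ_ x).hom (A.times b (α j)) := by
      rw [hα j x b, ← LinFun.map_comp, FMon.L, LinearMap.comp_apply]
      congr 2
      simp
    rw [h2]
    exact h1

end Ideal

/-! ### Regularity, quotient and split Koszul resolution for `C = A[u, v]`. -/

section PolynomialKoszul

variable {R : Type r} [CommRing R] {X : Type u} [Category.{v} X] [Preadditive X] [Linear R X]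
  [MonoidalCategory X] (A : FMon.{r, u, v, t} R X) (n : ℕ)

theorem FMon.poly_L_polyVar {σ : Type} (i : σ) (x : X) (m : σ →₀ ℕ) (a : A.obj x) :
    (A.poly σ).L (A.polyVar i) x ((A.monomial m).app x a) =
      (A.monomial (Finsupp.single i 1 + m)).app x a := by
  refine (congrArg ((A.poly σ).map (λ_ x).hom)
    (A.poly_times (Finsupp.single i 1) m A.one a)).trans ?_
  rw [← LinFun.Hom.naturality]
  exact congrArg _ (A.one_mul a)

theorem FMon.L_sub (a b : A.obj (𝟙_ X)) (x : X) : A.L (a - b) x = A.L a x - A.L b x := by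
  rw [FMon.L, map_sub, LinearMap.comp_sub]
  rfl

/-- The product by `α_i = u_i - v_i`. -/
noncomputable def FMon.alphaEnd (x : X) (i : Fin n) :
    Module.End R ((A.poly (Fin n ⊕ Fin n)).obj x) :=
  (A.poly (Fin n ⊕ Fin n)).L (A.alpha n i) x

/-- The divided difference in the variables `u_i`, `v_i`. -/
noncomputable def FMon.divDiffEnd (x : X) (i : Fin n) :
    Module.End R ((A.poly (Fin n ⊕ Fin n)).obj x) :=
  divDiff R (A.obj x) i

theorem FMon.alphaEnd_monomial (i : Fin n) (x : X) (m : Fin n ⊕ Fin n →₀ ℕ) (a : A.obj x) :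
    A.alphaEnd n x i ((A.monomial m).app x a) =
      (A.monomial (expU i + m)).app x a - (A.monomial (expV i + m)).app x a := by
  rw [alphaEnd, FMon.alpha, FMon.L_sub, LinearMap.sub_apply, poly_L_polyVar, poly_L_polyVar]

/-- Brings the product by `α_i` in the monoid down to an operator on polynomials over the module
`A(x)`, so that the contraction applies object by object. -/
theorem FMon.alphaEnd_eq (x : X) : A.alphaEnd n x = alphaPoly R (A.obj x) :=
  funext fun i => A.poly_hom_ext fun m a =>
    (A.alphaEnd_monomial n i x m a).trans (alphaPoly_single _ i m a).symm

theorem FMon.isKoszulContraction_alphaEnd (x : X) :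
    IsKoszulContraction (A.alphaEnd n x) (A.divDiffEnd n x) := by
  rw [alphaEnd_eq]
  exact isKoszulContraction_alphaPoly (A.obj x)

theorem FMon.fold_alphaEnd (i : Fin n) (x : X) (f : (A.poly (Fin n ⊕ Fin n)).obj x) :
    (A.fold n).app x (A.alphaEnd n x i f) = 0 := by
  refine LinearMap.congr_fun (f := (A.fold n).app x ∘ₗ A.alphaEnd n x i)
    (g := 0) (A.poly_hom_ext fun m a => ?_) f
  obtain ⟨c, b, rfl⟩ := eq_mapDomain_add m
  rw [LinearMap.comp_apply, alphaEnd_monomial, map_sub, LinearMap.zero_apply, sub_eq_zero]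
  have h1 := A.fold_monomial n (Finsupp.single i 1 + c) b a
  have h2 := A.fold_monomial n c (Finsupp.single i 1 + b) a
  rw [Finsupp.mapDomain_add, Finsupp.mapDomain_single, add_assoc, add_assoc _ c b] at h1
  rw [Finsupp.mapDomain_add, Finsupp.mapDomain_single, add_left_comm] at h2
  rw [add_left_comm c _ b] at h2
  exact h1.trans h2.symm

/-- Factors `P_n` as `C → A_n → C`, the second map `t ↦ v` being a section of the first. Hence `P_n`
and `FMon.fold` have the same kernel. -/
theorem FMon.contractionProd_eq (x : X) (f : (A.poly (Fin n ⊕ Fin n)).obj x) :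
    contractionProd (A.alphaEnd n x) (A.divDiffEnd n x) n f =
      (A.rename Sum.inr).app x ((A.fold n).app x f) := by
  refine LinearMap.congr_fun (f := contractionProd (A.alphaEnd n x) (A.divDiffEnd n x) n)
    (g := (A.rename Sum.inr).app x ∘ₗ (A.fold n).app x) (A.poly_hom_ext fun m a => ?_) f
  obtain ⟨c, b, rfl⟩ := eq_mapDomain_add m
  rw [LinearMap.comp_apply, fold_monomial, rename_monomial, alphaEnd_eq]
  exact contractAll_single _ c b a

theorem FMon.fold_rename_inr (x : X) (p : (A.poly (Fin n)).obj x) :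
    (A.fold n).app x ((A.rename Sum.inr).app x p) = p := by
  refine LinearMap.congr_fun (f := (A.fold n).app x ∘ₗ (A.rename Sum.inr).app x)
    (g := LinearMap.id) (A.poly_hom_ext fun m a => ?_) p
  rw [LinearMap.comp_apply, rename_monomial, rename_monomial, ← Finsupp.mapDomain_comp,
    LinearMap.id_apply, Sum.elim_comp_inr, Finsupp.mapDomain_id]

/-- The product `P_m` kills the multiples of `α_j` for `j < m`, and `sum_prod` writes `f - P_m f` as
a sum of such multiples. -/
theorem FMon.mem_ideal_iff [BraidedCategory X] (x : X)
    (f : (A.poly (Fin n ⊕ Fin n)).obj x) (m : ℕ) (hm : m ≤ n) :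
    f ∈ ((A.poly (Fin n ⊕ Fin n)).ideal (A.alpha n) {j | j.1 < m}).carrier x ↔
      contractionProd (A.alphaEnd n x) (A.divDiffEnd n x) m f = 0 := by
  have hK := A.isKoszulContraction_alphaEnd n x
  rw [ideal_carrier _ _ (A.alpha_inCommutant n)]
  constructor
  · intro hf
    have h : (⨆ j ∈ {j : Fin n | j.1 < m}, LinearMap.range (A.alphaEnd n x j)) ≤
        LinearMap.ker (contractionProd (A.alphaEnd n x) (A.divDiffEnd n x) m) := by
      refine iSup₂_le fun j hj => ?_
      rintro _ ⟨b, rfl⟩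
      exact LinearMap.congr_fun (hK.prod_mul j m hj) b
    exact h hf
  · intro hf
    have h := LinearMap.congr_fun (hK.sum_prod m hm) f
    rw [LinearMap.sub_apply, hf, sub_zero, Module.End.one_apply, LinearMap.sum_apply] at h
    rw [← h]
    refine Submodule.sum_mem _ fun j hj => Submodule.mem_iSup_of_mem j
      (Submodule.mem_iSup_of_mem (by simpa using hj) ⟨_, rfl⟩)

theorem FMon.mem_ideal_univ_iff [BraidedCategory X] (x : X)
    (f : (A.poly (Fin n ⊕ Fin n)).obj x) :
    f ∈ ((A.poly (Fin n ⊕ Fin n)).ideal (A.alpha n) Set.univ).carrier x ↔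
      (A.fold n).app x f = 0 := by
  have e : (Set.univ : Set (Fin n)) = {j | j.1 < n} := by
    ext j
    simp
  rw [e, A.mem_ideal_iff n x f n le_rfl, contractionProd_eq]
  constructor
  · intro h
    rw [← A.fold_rename_inr n x ((A.fold n).app x f), h, map_zero]
  · intro h
    rw [h, map_zero]

/-- If `α_i f` is in the ideal of the earlier elements, then `α_i P_i f = P_i α_i f = 0`; applying
`s_i` gives `P_i f = 0`, so `f` is in that ideal. The full quotient is not zero because `FMon.fold`
keeps constants. -/
theorem FMon.isRegularSequence_alpha [BraidedCategory X] (hA : ∃ (x : X) (a : A.obj x), a ≠ 0) :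
    (A.poly (Fin n ⊕ Fin n)).IsRegularSequence (A.alpha n) where
  commutant := A.alpha_inCommutant n
  regular i x m hm h := by
    have hK := A.isKoszulContraction_alphaEnd n x
    let I := (A.poly (Fin n ⊕ Fin n)).ideal (A.alpha n) {j | j < i}
    obtain ⟨f, rfl⟩ := Submodule.mkQ_surjective (I.carrier x) m
    apply hm
    have h0 : (A.poly (Fin n ⊕ Fin n)).times (A.alpha n i) f ∈ I.carrier (𝟙_ X ⊗ x) :=
      (Submodule.Quotient.mk_eq_zero _).1 h
    -- The product lives over `𝟏 ⋄ x`; the unitor brings it back over `x`, where `α_i` is an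
    -- endomorphism.
    have h1 : A.alphaEnd n x i f ∈ I.carrier x := I.map_mem (λ_ x).hom _ h0
    have h2 := (A.mem_ideal_iff n x _ i i.2.le).1 h1
    have h3 := (LinearMap.congr_fun (hK.commute_prod i i le_rfl).eq f).trans h2
    refine (Submodule.Quotient.mk_eq_zero _).2 ((A.mem_ideal_iff n x _ i i.2.le).2 ?_)
    exact (LinearMap.congr_fun (hK.left_inv i) _).symm.trans
      ((congrArg (A.divDiffEnd n x i) h3).trans (map_zero _))
  ne_zero := by
    obtain ⟨x, a, ha⟩ := hA
    refine ⟨x, (((A.poly (Fin n ⊕ Fin n)).ideal (A.alpha n) Set.univ).carrier x).mkQ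
      ((A.monomial 0).app x a), fun h => ha ?_⟩
    have h1 := (A.mem_ideal_univ_iff n x _).1 ((Submodule.Quotient.mk_eq_zero _).1 h)
    rw [rename_monomial, Finsupp.mapDomain_zero] at h1
    exact Finsupp.single_eq_zero.1 h1

theorem FMon.exists_quot_iso [BraidedCategory X] :
    ∃ e : (A.poly (Fin n ⊕ Fin n)).self.quot
        ((A.poly (Fin n ⊕ Fin n)).ideal (A.alpha n) Set.univ) ≅ A.polyModule n,
      FMod.quotMk _ _ ≫ e.hom = (A.fold n).toModHom := by
  refine ⟨FMod.isoOfBijective (FMod.quotDesc _ (A.fold n).toModHom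
    fun x f hf => (A.mem_ideal_univ_iff n x f).1 hf) fun x => ⟨?_, ?_⟩, rfl⟩
  · refine LinearMap.ker_eq_bot.1 (Submodule.ker_liftQ_eq_bot _ _ _ fun f hf => ?_)
    exact (A.mem_ideal_univ_iff n x f).2 hf
  · intro p
    exact ⟨Submodule.mkQ _ ((A.rename Sum.inr).app x p), A.fold_rename_inr n x p⟩

theorem FMon.divDiffEnd_map {x y : X} (φ : x ⟶ y) (i : Fin n)
    (f : (A.poly (Fin n ⊕ Fin n)).obj x) :
    (A.poly (Fin n ⊕ Fin n)).map φ (A.divDiffEnd n x i f) =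
      A.divDiffEnd n y i ((A.poly (Fin n ⊕ Fin n)).map φ f) :=
  mapRange_divDiff (A.map φ) i f

/-- The splitting, in `𝓕`, of the Koszul complex. -/
noncomputable def FMon.koszulSplit (p : ℕ) :
    LinFun.Hom ((A.poly (Fin n ⊕ Fin n)).koszul n p).toLinFun
      ((A.poly (Fin n ⊕ Fin n)).koszul n (p + 1)).toLinFun where
  app x := koszulHomotopy (A.alphaEnd n x) (A.divDiffEnd n x) p
  naturality φ f :=
    koszulHomotopy_map (g := (A.poly (Fin n ⊕ Fin n)).map φ)
      (fun i w => ((A.poly (Fin n ⊕ Fin n)).L_map (A.alpha n i) φ w).symm)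
      (fun i w => A.divDiffEnd_map n φ i w) p f

/-- The section of the augmentation of the Koszul complex. -/
noncomputable def FMon.koszulSection :
    LinFun.Hom (A.polyModule n).toLinFun ((A.poly (Fin n ⊕ Fin n)).koszul n 0).toLinFun where
  app x := LinearMap.pi fun _ => (A.rename Sum.inr).app x
  naturality φ a := funext fun _ => (A.rename Sum.inr).naturality φ a

/-- The contraction is natural, but divided differences do not in general commute with the product
by `u_i`, so the splitting is taken in `𝓕` and not among `C`-modules. -/
theorem FMon.isFSplitResolution_koszul [BraidedCategory X] :
    IsFSplitResolution ((A.poly (Fin n ⊕ Fin n)).koszul n)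
      ((A.poly (Fin n ⊕ Fin n)).koszulD (A.alpha n) (A.alpha_inCommutant n)) (A.koszulAug n) where
  exact p x := (A.isKoszulContraction_alphaEnd n x).exact_diff p
  exact_zero x := by
    have hK := A.isKoszulContraction_alphaEnd n x
    intro (f : KSub n 0 → (A.poly (Fin n ⊕ Fin n)).obj x)
    constructor
    · intro hf
      refine ⟨koszulHomotopy (A.alphaEnd n x) (A.divDiffEnd n x) 0 f, funext fun S => ?_⟩
      refine (hK.diff_homotopy_zero f S).trans ?_
      have hS : S = ⟨∅, Finset.card_empty⟩ := Subtype.ext (Finset.card_eq_zero.1 S.2)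
      have hf' : (A.fold n).app x (f S) = 0 := by
        rw [hS]
        exact hf
      rw [contractionProd_eq, hf', map_zero, sub_zero]
    · rintro ⟨g, rfl⟩
      refine (congrArg ((A.fold n).app x) (koszulDiff_apply (A.alphaEnd n x) 0 g
        ⟨∅, Finset.card_empty⟩)).trans ?_
      rw [map_sum]
      refine Finset.sum_eq_zero fun i _ => ?_
      rw [map_zsmul, fold_alphaEnd, smul_zero]
  surjective x p := ⟨fun _ => (A.rename Sum.inr).app x p, A.fold_rename_inr n x p⟩
  split := by
    refine ⟨A.koszulSection n, A.koszulSplit n, ?_, fun p => ?_⟩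
    · refine LinFun.Hom.ext (funext fun x => LinearMap.ext fun f => ?_)
      exact A.fold_rename_inr n x _
    · refine LinFun.Hom.ext (funext fun x => LinearMap.ext fun f => ?_)
      exact (A.isKoszulContraction_alphaEnd n x).diff_homotopy_diff p f

end PolynomialKoszul

/-! ### Free modules of finite rank are projective relative to `𝓕`. -/

section RelProjective

variable {R : Type r} [CommRing R] {X : Type u} [Category.{v} X] [Preadditive X] [Linear R X]
  [MonoidalCategory X] (A : FMon.{r, u, v, t} R X)

/-- The map `a ↦ ∑ a_i × e_i`, at the object `x`. -/
noncomputable def FMod.freeDescApp (N : FMod.{r, u, v, t, s} A) {ι : Type} [Fintype ι]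
    (e : ι → N.obj (𝟙_ X)) (x : X) : (ι → A.obj x) →ₗ[R] N.obj x :=
  ∑ i, N.map (ρ_ x).hom ∘ₗ (N.act.toFun x (𝟙_ X)).flip (e i) ∘ₗ
    (LinearMap.proj i : (ι → A.obj x) →ₗ[R] A.obj x)

theorem FMod.freeDescApp_apply (N : FMod.{r, u, v, t, s} A) {ι : Type} [Fintype ι]
    (e : ι → N.obj (𝟙_ X)) (x : X) (a : ι → A.obj x) :
    FMod.freeDescApp A N e x a = ∑ i, N.map (ρ_ x).hom (N.smul (a i) (e i)) := by
  rw [freeDescApp, LinearMap.sum_apply]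
  rfl

/-- The morphism `A^ι ⟶ N` that sends the basis element of index `i` to `e i`. -/
noncomputable def FMod.freeDesc (N : FMod.{r, u, v, t, s} A) {ι : Type} [Fintype ι]
    (e : ι → N.obj (𝟙_ X)) : LinFun.Hom (A.self.copies ι).toLinFun N.toLinFun where
  app := FMod.freeDescApp A N e
  naturality {x y} φ a := by
    refine (FMod.freeDescApp_apply A N e y _).trans ?_
    refine Eq.trans ?_ (congrArg (N.map φ) (FMod.freeDescApp_apply A N e x a).symm)
    rw [map_sum]
    have key : ∀ (b : A.obj x) (c : N.obj (𝟙_ X)), N.map (ρ_ y).hom (N.smul (A.map φ b) c) =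
        N.map φ (N.map (ρ_ x).hom (N.smul b c)) := fun b c => by
      have h := N.act.naturality φ (𝟙 (𝟙_ X)) b c
      rw [N.map_id] at h
      rw [FMod.smul, FMod.smul, h, ← LinFun.map_comp, ← LinFun.map_comp]
      congr 2
      simp
    exact Finset.sum_congr rfl fun i _ => key _ _

theorem FMod.freeDesc_apply (N : FMod.{r, u, v, t, s} A) {ι : Type} [Fintype ι]
    (e : ι → N.obj (𝟙_ X)) (x : X) (a : ι → A.obj x) :
    (FMod.freeDesc A N e).app x a = ∑ i, N.map (ρ_ x).hom (N.smul (a i) (e i)) :=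
  FMod.freeDescApp_apply A N e x a

theorem FMod.map_rightUnitor_smul (N : FMod.{r, u, v, t, s} A) {x y : X} (a : A.obj x)
    (b : A.obj y) (e : N.obj (𝟙_ X)) :
    N.map (ρ_ (x ⊗ y)).hom (N.smul (A.times a b) e) = N.smul a (N.map (ρ_ y).hom (N.smul b e)) := by
  have h1 := N.act.naturality (𝟙 x) (ρ_ y).hom a (N.smul b e)
  rw [A.map_id] at h1
  refine Eq.trans ?_ h1.symm
  rw [← N.act_assoc, ← LinFun.map_comp]
  congr 2
  simp

/-- The morphism of modules `A^ι ⟶ N` that sends the basis element of index `i` to `e i`. -/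
noncomputable def FMod.freeHom (N : FMod.{r, u, v, t, t} A) {ι : Type} [Fintype ι]
    (e : ι → N.obj (𝟙_ X)) : A.self.copies ι ⟶ N where
  toHom := FMod.freeDesc A N e
  map_smul {x y} a b := by
    refine (FMod.freeDesc_apply A N e (x ⊗ y) _).trans ?_
    refine Eq.trans ?_ (congrArg (N.smul a) (FMod.freeDesc_apply A N e y b).symm)
    refine Eq.trans ?_ (map_sum (N.act.toFun x y a) _ _).symm
    exact Finset.sum_congr rfl fun i _ => N.map_rightUnitor_smul A a (b i) (e i)

/-- The basis element of index `i` of a free module. -/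
noncomputable def FMon.basisElement {ι : Type} [Finite ι] (i : ι) :
    (A.self.copies ι).obj (𝟙_ X) := by
  classical
  exact fun j => if j = i then A.one else 0

/-- Every element of `A^ι` is a sum of products of elements of `A` with basis elements, which live
over `𝟏`; linearity then determines the morphism. -/
theorem FMod.hom_app_copies {N : FMod.{r, u, v, t, t} A} {ι : Type} [Fintype ι]
    (f : A.self.copies ι ⟶ N) :
    f = FMod.freeHom A N (fun i => f.app (𝟙_ X) (A.basisElement i)) := by
  classical
  refine FMod.Hom.ext (funext fun x => LinearMap.ext fun a => ?_)
  refine Eq.trans ?_ (FMod.freeDesc_apply A N _ x a).symm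
  have hsmul : ∀ (b : A.obj x) (i : ι), N.map (ρ_ x).hom
      (N.smul b (f.app (𝟙_ X) (A.basisElement i))) =
      f.app x ((A.self.copies ι).map (ρ_ x).hom
        ((A.self.copies ι).smul b (A.basisElement i))) := fun b i => by
    rw [f.naturality, f.map_smul]
  have hbasis : ∀ (b : A.obj x) (i : ι), (A.self.copies ι).map (ρ_ x).hom
      ((A.self.copies ι).smul b (A.basisElement i)) = (Pi.single i b : ι → A.obj x) := fun b i => by
    funext j
    change A.map (ρ_ x).hom (A.times b (if j = i then A.one else 0)) = _
    split_ifs with e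
    · rw [A.mul_one, e, Pi.single_eq_same]
    · rw [FMon.times, map_zero, map_zero, Pi.single_eq_of_ne e]
  have hsum : (∑ i, Pi.single i ((a : ι → A.obj x) i) : ι → A.obj x) = a :=
    Finset.univ_sum_single (a : ι → A.obj x)
  refine (congrArg (f.app x) hsum.symm).trans ((map_sum (f.app x) _ _).trans ?_)
  exact Finset.sum_congr rfl fun i _ =>
    ((hsmul _ i).trans (congrArg (f.app x) (hbasis _ i))).symm

theorem FMon.isRelProjective_copies (ι : Type) [Finite ι] :
    IsRelProjective (FMod.restr A) (A.self.copies ι) := by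
  have := Fintype.ofFinite ι
  intro N Q g hg f
  -- A splitting in `𝓕` is only used for surjectivity over `𝟏`: the images of the basis are lifted
  -- there and extended linearly.
  have hsurj : ∀ q : Q.obj (𝟙_ X), ∃ m : N.obj (𝟙_ X), g.app (𝟙_ X) m = q := fun q => by
    obtain ⟨⟨⟨s, hs⟩⟩⟩ := hg
    exact ⟨LinFun.Hom.app s (𝟙_ X) q,
      LinearMap.congr_fun (congrFun (congrArg LinFun.Hom.app hs) (𝟙_ X)) q⟩
  choose m hm using hsurj
  refine ⟨FMod.freeHom A N fun i => m (f.app (𝟙_ X) (A.basisElement i)), ?_⟩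
  refine Eq.trans ?_ (FMod.hom_app_copies A f).symm
  refine FMod.Hom.ext (funext fun x => LinearMap.ext fun a => ?_)
  refine (congrArg (g.app x) (FMod.freeDesc_apply A N _ x a)).trans ?_
  refine Eq.trans ?_ (FMod.freeDesc_apply A Q _ x a).symm
  rw [map_sum]
  have key : ∀ (b : A.obj x) (q : Q.obj (𝟙_ X)), g.app x (N.map (ρ_ x).hom (N.smul b (m q))) =
      Q.map (ρ_ x).hom (Q.smul b q) := fun b q => by
    rw [g.naturality, g.map_smul, hm]
  exact Finset.sum_congr rfl fun i _ => key _ _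

end RelProjective

/-! ### Comparison of complexes of projective modules with acyclic complexes. -/

section Comparison

variable {S : Type*} [CommRing S]

theorem exists_lift_of_mem_range {P M N : Type*} [AddCommGroup P] [Module S P]
    [Module.Projective S P] [AddCommGroup M] [Module S M] [AddCommGroup N] [Module S N]
    (d : M →ₗ[S] N) (g : P →ₗ[S] N) (h : ∀ x, g x ∈ LinearMap.range d) :
    ∃ f : P →ₗ[S] M, d ∘ₗ f = g := by
  obtain ⟨f, hf⟩ := Module.projective_lifting_property d.rangeRestrict (g.codRestrict _ h)
    d.surjective_rangeRestrict
  refine ⟨f, LinearMap.ext fun x => ?_⟩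
  exact congrArg Subtype.val (LinearMap.congr_fun hf x)

/-- Chain maps and homotopies are built degree by degree, each step needing a property of the
previous map. That property is carried by the type `T p`. -/
theorem exists_dependent_seq {T : ℕ → Type*} (rel : ∀ p, T p → T (p + 1) → Prop) (t₀ : T 0)
    (h : ∀ p (x : T p), ∃ y, rel p x y) : ∃ f : ∀ p, T p, f 0 = t₀ ∧ ∀ p, rel p (f p) (f (p + 1)) := by
  choose g hg using h
  exact ⟨fun p => Nat.rec t₀ (fun p x => g p x) p, rfl, fun p => hg p _⟩

variable {P Q : ℕ → Type*} [∀ p, AddCommGroup (P p)] [∀ p, Module S (P p)]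
  [∀ p, Module.Projective S (P p)] [∀ p, AddCommGroup (Q p)] [∀ p, Module S (Q p)]
  (dP : ∀ p, P (p + 1) →ₗ[S] P p) (dQ : ∀ p, Q (p + 1) →ₗ[S] Q p)

/-- A map in degree `0` from a complex of projective modules to an acyclic complex extends to a
chain map. -/
theorem exists_chainMap (hP : ∀ p x, dP p (dP (p + 1) x) = 0)
    (hQ : ∀ p, Function.Exact (dQ (p + 1)) (dQ p)) (f₀ : P 0 →ₗ[S] Q 0)
    (h₀ : ∀ x, f₀ (dP 0 x) ∈ LinearMap.range (dQ 0)) :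
    ∃ f : ∀ p, P p →ₗ[S] Q p, f 0 = f₀ ∧ ∀ p x, dQ p (f (p + 1) x) = f p (dP p x) := by
  obtain ⟨f, hf0, hf⟩ := exists_dependent_seq
    -- The invariant is what projectivity requires in order to lift `f ∘ d` to the next degree.
    (T := fun p => {f : P p →ₗ[S] Q p // ∀ x, f (dP p x) ∈ LinearMap.range (dQ p)})
    (fun p f g => ∀ x, dQ p (g.1 x) = f.1 (dP p x)) ⟨f₀, h₀⟩ (fun p f => by
      obtain ⟨g, hg⟩ := exists_lift_of_mem_range (dQ p) (f.1 ∘ₗ dP p) f.2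
      refine ⟨⟨g, fun x => (hQ p _).1 ?_⟩, LinearMap.congr_fun hg⟩
      rw [← LinearMap.comp_apply, hg, LinearMap.comp_apply, hP, map_zero])
  exact ⟨fun p => (f p).1, congrArg Subtype.val hf0, hf⟩

/-- A chain map from a complex of projective modules to an acyclic complex that vanishes in degree
`0` is homotopic to `0`. -/
theorem exists_homotopy (hP : ∀ p x, dP p (dP (p + 1) x) = 0)
    (hQ : ∀ p, Function.Exact (dQ (p + 1)) (dQ p)) (f : ∀ p, P p →ₗ[S] Q p)
    (hf : ∀ p x, dQ p (f (p + 1) x) = f p (dP p x)) (h₀ : f 0 = 0) :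
    ∃ h : ∀ p, P p →ₗ[S] Q (p + 1), ∀ p x, f (p + 1) x = dQ (p + 1) (h (p + 1) x) + h p (dP p x) := by
  obtain ⟨h, -, hh⟩ := exists_dependent_seq
    -- The invariant `d h d = f d` makes `f - h d` take its values in the cycles, which are
    -- boundaries. It holds for the initial `h = 0` because `f` vanishes in degree `0`.
    (T := fun p => {h : P p →ₗ[S] Q (p + 1) // ∀ x, dQ p (h (dP p x)) = f p (dP p x)})
    (fun p h h' => ∀ x, f (p + 1) x = dQ (p + 1) (h'.1 x) + h.1 (dP p x))
    ⟨0, fun x => by simp [h₀]⟩ (fun p h => by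
      obtain ⟨g, hg⟩ := exists_lift_of_mem_range (dQ (p + 1)) (f (p + 1) - h.1 ∘ₗ dP p)
        (fun x => (hQ p _).1 (by
          rw [LinearMap.sub_apply, map_sub, hf, LinearMap.comp_apply, h.2, sub_self]))
      have hg' : ∀ x, dQ (p + 1) (g x) = f (p + 1) x - h.1 (dP p x) := LinearMap.congr_fun hg
      refine ⟨⟨g, fun x => ?_⟩, fun x => ?_⟩
      · rw [hg', hP, map_zero, sub_zero]
      · rw [hg', sub_add_cancel])
  exact ⟨fun p => (h p).1, hh⟩

end Comparison

/-! ### The bar resolution of `R[t]` over `R[u, v]`. -/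

section Bar

variable (R : Type*) [CommRing R] (n : ℕ)

/-- The ring `R[u_1, …, u_n, v_1, …, v_n]`. -/
abbrev PolyRing : Type _ := AddMonoidAlgebra R (Fin n ⊕ Fin n →₀ ℕ)

variable {n}

/-- The element `r u^c v^b`. -/
noncomputable def polyMon (c b : Fin n →₀ ℕ) (x : R) : PolyRing R n :=
  AddMonoidAlgebra.single (c.mapDomain Sum.inl + b.mapDomain Sum.inr) x

variable {R}

theorem polyMon_mul (c b c' b' : Fin n →₀ ℕ) (x y : R) :
    polyMon R c b x * polyMon R c' b' y = polyMon R (c + c') (b + b') (x * y) := by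
  rw [polyMon, polyMon, polyMon, AddMonoidAlgebra.single_mul_single, Finsupp.mapDomain_add,
    Finsupp.mapDomain_add, add_add_add_comm]

theorem polyMon_zero_one : polyMon R (0 : Fin n →₀ ℕ) 0 1 = 1 := by
  simp [polyMon, AddMonoidAlgebra.one_def]

theorem polyRing_induction {motive : PolyRing R n → Prop} (z : PolyRing R n) (zero : motive 0)
    (add : ∀ y z, motive y → motive z → motive (y + z))
    (mon : ∀ c b x, motive (polyMon R c b x)) : motive z := by
  induction z using AddMonoidAlgebra.induction_linear with
  | zero => exact zero
  | add y z hy hz => exact add y z hy hz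
  | single m x =>
    obtain ⟨c, b, rfl⟩ := eq_mapDomain_add m
    exact mon c b x

variable (R) in
/-- The element `u^c`. -/
noncomputable abbrev monU (c : Fin n →₀ ℕ) : PolyRing R n := polyMon R c 0 1

variable (R) in
/-- The element `v^b`. -/
noncomputable abbrev monV (b : Fin n →₀ ℕ) : PolyRing R n := polyMon R 0 b 1

/-- Adding an entry in front of a family of exponents. -/
abbrev consExp {p : ℕ} (a : Fin n →₀ ℕ) (γ : Fin p → (Fin n →₀ ℕ)) : Fin (p + 1) → (Fin n →₀ ℕ) :=
  Fin.cons (α := fun _ => Fin n →₀ ℕ) a γ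

/-- The cofaces of the Hochschild cochain complex of the polynomial ring with coefficients in a
bimodule, in terms of the values of the cochains on monomials. -/
noncomputable def coface (R : Type*) [CommRing R] {N : Type*} [AddCommGroup N]
    [Module (PolyRing R n) N] : ∀ p : ℕ, ℕ → ((Fin p → (Fin n →₀ ℕ)) → N) →
      (Fin (p + 1) → (Fin n →₀ ℕ)) → N
  | _, 0, c, γ => monU R (γ 0) • c (Fin.tail γ)
  | 0, _ + 1, c, γ => monV R (γ 0) • c (Fin.tail γ)
  | _ + 1, 1, c, γ => c (consExp (γ 0 + γ 1) (Fin.tail (Fin.tail γ)))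
  -- Freezing the first entry mirrors the recursion of `FBimod.face`, where `LinFun.ihomMap` leaves
  -- the first argument alone.
  | p + 1, i + 2, c, γ => coface R p (i + 1) (fun γ' => c (consExp (γ 0) γ')) (Fin.tail γ)

/-- The differential of the Hochschild cochain complex of the polynomial ring. -/
noncomputable def coDiff (R : Type*) [CommRing R] {N : Type*} [AddCommGroup N]
    [Module (PolyRing R n) N] (p : ℕ) (c : (Fin p → (Fin n →₀ ℕ)) → N)
    (γ : Fin (p + 1) → (Fin n →₀ ℕ)) : N :=
  ∑ i ∈ Finset.range (p + 2), (-1 : ℤ) ^ i • coface R p i c γ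

section Map

variable {N N' : Type*} [AddCommGroup N] [Module (PolyRing R n) N] [AddCommGroup N']
  [Module (PolyRing R n) N']

theorem coface_map (φ : N →ₗ[PolyRing R n] N') (p i : ℕ) (c : (Fin p → (Fin n →₀ ℕ)) → N)
    (γ : Fin (p + 1) → (Fin n →₀ ℕ)) :
    coface R p i (fun γ => φ (c γ)) γ = φ (coface R p i c γ) := by
  induction p generalizing i with
  | zero =>
    rcases i with _ | i
    · simp only [coface, map_smul]
    · simp only [coface, map_smul]
  | succ p ih =>
    rcases i with _ | _ | i
    · simp only [coface, map_smul]
    · simp only [coface]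
    · simp only [coface]
      exact ih (i + 1) (fun γ' => c (consExp (γ 0) γ')) (Fin.tail γ)

theorem coDiff_map (φ : N →ₗ[PolyRing R n] N') (p : ℕ) (c : (Fin p → (Fin n →₀ ℕ)) → N)
    (γ : Fin (p + 1) → (Fin n →₀ ℕ)) :
    coDiff R p (fun γ => φ (c γ)) γ = φ (coDiff R p c γ) := by
  simp only [coDiff, coface_map, map_sum, map_zsmul]

end Map

variable (R n) in
/-- The bar resolution of the polynomial ring. -/
abbrev Bar (p : ℕ) : Type _ := (Fin p → (Fin n →₀ ℕ)) →₀ PolyRing R n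

/-- The basis element of index `γ` of the bar resolution. -/
noncomputable abbrev barBasis (R : Type*) [CommRing R] {p : ℕ} (γ : Fin p → (Fin n →₀ ℕ)) :
    Bar R n p := Finsupp.single γ 1

variable (R n) in
/-- The differential of the bar resolution. -/
noncomputable def barDiff (p : ℕ) : Bar R n (p + 1) →ₗ[PolyRing R n] Bar R n p :=
  Finsupp.linearCombination (PolyRing R n) (coDiff R p (barBasis R))

/-- The family `barBasis` is the universal cochain, and `coDiff` is natural in the coefficients by
`coDiff_map`. So the cochain complex with coefficients in `N` is the complex of linear maps from the
bar resolution to `N`. -/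
theorem linearCombination_barDiff {N : Type*} [AddCommGroup N] [Module (PolyRing R n) N] (p : ℕ)
    (c : (Fin p → (Fin n →₀ ℕ)) → N) (z : Bar R n (p + 1)) :
    Finsupp.linearCombination (PolyRing R n) c (barDiff R n p z) =
      Finsupp.linearCombination (PolyRing R n) (coDiff R p c) z := by
  refine LinearMap.congr_fun (f := Finsupp.linearCombination (PolyRing R n) c ∘ₗ barDiff R n p)
    (Finsupp.lhom_ext fun γ a => ?_) z
  rw [LinearMap.comp_apply, barDiff, Finsupp.linearCombination_single, map_smul, ← coDiff_map,
    Finsupp.linearCombination_single]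
  simp

variable (R n) in
/-- The contraction of the bar resolution. -/
noncomputable def barHomotopy (p : ℕ) : Bar R n p →+ Bar R n (p + 1) :=
  -- The element `u^a v^b [γ]` goes to `v^b [a, γ]`. The `u`-part becomes a new first entry, so the
  -- map is additive but not linear over `R[u, v]`.
  Finsupp.liftAddHom fun γ => (Finsupp.liftAddHom fun m =>
    (Finsupp.singleAddHom (consExp (Finsupp.sumFinsuppEquivProdFinsupp m).1 γ)).comp
      ((AddMonoidAlgebra.coeffAddEquiv (R := R)).symm.toAddMonoidHom.comp
        (Finsupp.singleAddHom ((Finsupp.sumFinsuppEquivProdFinsupp m).2.mapDomain Sum.inr)))).comp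
      (AddMonoidAlgebra.coeffAddEquiv (R := R)).toAddMonoidHom

theorem barHomotopy_single {p : ℕ} (γ : Fin p → (Fin n →₀ ℕ)) (a b : Fin n →₀ ℕ) (x : R) :
    barHomotopy R n p (Finsupp.single γ (polyMon R a b x)) =
      Finsupp.single (consExp a γ) (polyMon R 0 b x) := by
  rw [barHomotopy, Finsupp.liftAddHom_apply_single]
  refine (Finsupp.liftAddHom_apply_single _ _ _).trans ?_
  rw [sumFinsuppEquivProdFinsupp_mapDomain_add]
  simp only [polyMon, Finsupp.mapDomain_zero, zero_add]
  rfl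

/-- The map `[γ] ↦ [a, γ]`. -/
noncomputable def barCons (a : Fin n →₀ ℕ) (p : ℕ) :
    Bar R n p →ₗ[PolyRing R n] Bar R n (p + 1) :=
  Finsupp.lmapDomain _ _ (consExp a)

theorem barCons_single (a : Fin n →₀ ℕ) {p : ℕ} (γ : Fin p → (Fin n →₀ ℕ)) (c : PolyRing R n) :
    barCons a p (Finsupp.single γ c) = Finsupp.single (consExp a γ) c := by
  simp [barCons]

/-- Faces of positive index produce no coefficient in `u`, so on their multiples by `u^a v^b` the
contraction only prepends `a`. -/
theorem coface_barBasis (p i : ℕ) (γ : Fin (p + 1) → (Fin n →₀ ℕ)) :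
    ∃ (γ' : Fin p → (Fin n →₀ ℕ)) (b : Fin n →₀ ℕ),
      coface R p (i + 1) (barBasis R) γ = Finsupp.single γ' (monV R b) := by
  induction p generalizing i with
  | zero => exact ⟨Fin.tail γ, γ 0, by simp [coface]⟩
  | succ p ih =>
    rcases i with _ | i
    · exact ⟨_, 0, by rw [monV, polyMon_zero_one]; rfl⟩
    · obtain ⟨γ', b, h⟩ := ih i (Fin.tail γ)
      refine ⟨consExp (γ 0) γ', b, ?_⟩
      rw [← barCons_single, ← h, ← coface_map]
      simp only [coface, barCons_single]

theorem coface_succ_cons (p i : ℕ) (a : Fin n →₀ ℕ) (γ : Fin (p + 1) → (Fin n →₀ ℕ)) :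
    coface R (p + 1) (i + 2) (barBasis R) (consExp a γ) =
      barCons a p (coface R p (i + 1) (barBasis R) γ) := by
  rw [← coface_map]
  simp only [coface, barCons_single, Fin.tail_cons, Fin.cons_zero]

theorem barDiff_single (p : ℕ) (γ : Fin (p + 1) → (Fin n →₀ ℕ)) (c : PolyRing R n) :
    barDiff R n p (Finsupp.single γ c) = c • coDiff R p (barBasis R) γ :=
  Finsupp.linearCombination_single _ _ _

theorem barHomotopy_smul_coface_zero (p : ℕ) (γ : Fin (p + 1) → (Fin n →₀ ℕ)) (a b : Fin n →₀ ℕ)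
    (x : R) : barHomotopy R n p (polyMon R a b x • coface R p 0 (barBasis R) γ) =
      Finsupp.single (consExp (a + γ 0) (Fin.tail γ)) (polyMon R 0 b x) := by
  have h : coface R p 0 (barBasis R) γ = Finsupp.single (Fin.tail γ) (monU R (γ 0)) := by
    cases p <;> simp [coface]
  rw [h, Finsupp.smul_single, smul_eq_mul, polyMon_mul, add_zero, mul_one, barHomotopy_single]

theorem barHomotopy_smul_coface_succ (p i : ℕ) (γ : Fin (p + 1) → (Fin n →₀ ℕ))
    (a b : Fin n →₀ ℕ) (x : R) :
    barHomotopy R n p (polyMon R a b x • coface R p (i + 1) (barBasis R) γ) =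
      polyMon R 0 b x • barCons a p (coface R p (i + 1) (barBasis R) γ) := by
  obtain ⟨γ', b', h⟩ := coface_barBasis (R := R) p i γ
  rw [h, Finsupp.smul_single, smul_eq_mul, polyMon_mul, add_zero, mul_one, barHomotopy_single,
    barCons_single, Finsupp.smul_single, smul_eq_mul, polyMon_mul, add_zero, mul_one]

/-- Take `u^a v^b [γ]`. The face `0` of `v^b [a, γ]` returns it. The face `1` merges `a` with the
first entry of `γ`, as does contracting the face `0` of `[γ]`. The face `i + 2` matches the face `i
+ 1` of `[γ]`. Matching terms have opposite signs. -/
theorem barDiff_barHomotopy (p : ℕ) (z : Bar R n (p + 1)) :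
    barDiff R n (p + 1) (barHomotopy R n (p + 1) z) + barHomotopy R n p (barDiff R n p z) = z := by
  induction z using Finsupp.induction_linear with
  | zero => simp
  | add y z hy hz =>
    rw [map_add, map_add, map_add, map_add, add_add_add_comm, hy, hz]
  | single γ c =>
    induction c using polyRing_induction with
    | zero => simp
    | add y z hy hz =>
      rw [Finsupp.single_add, map_add, map_add, map_add, map_add, add_add_add_comm, hy, hz]
    | mon a b x =>
      rw [barHomotopy_single, barDiff_single, barDiff_single, coDiff, coDiff,
        Finset.sum_range_succ', Finset.sum_range_succ', Finset.sum_range_succ' _ (p + 1),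
        smul_add, smul_add, smul_add, map_add, Finset.smul_sum, Finset.smul_sum, map_sum]
      have h1 : ∀ i, polyMon R 0 b x • (-1 : ℤ) ^ (i + 1 + 1) •
          coface R (p + 1) (i + 1 + 1) (barBasis R) (consExp a γ) +
          barHomotopy R n p (polyMon R a b x • (-1 : ℤ) ^ (i + 1) •
            coface R p (i + 1) (barBasis R) γ) = 0 := by
        intro i
        rw [coface_succ_cons, smul_comm _ ((-1 : ℤ) ^ (i + 1)), map_zsmul,
          barHomotopy_smul_coface_succ, smul_comm _ ((-1 : ℤ) ^ (i + 1 + 1)), pow_succ _ (i + 1),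
          mul_neg_one, neg_smul, neg_add_cancel]
      have h2 : polyMon R 0 b x • (-1 : ℤ) ^ (0 + 1) •
          coface R (p + 1) (0 + 1) (barBasis R) (consExp a γ) +
          barHomotopy R n p (polyMon R a b x • (-1 : ℤ) ^ 0 • coface R p 0 (barBasis R) γ) = 0 := by
        rw [pow_zero, one_smul, barHomotopy_smul_coface_zero]
        simp [coface]
      have h3 : polyMon R 0 b x • (-1 : ℤ) ^ 0 • coface R (p + 1) 0 (barBasis R) (consExp a γ) =
          Finsupp.single γ (polyMon R a b x) := by
        simp [coface, polyMon_mul]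
      rw [h3]
      have h4 := Finset.sum_eq_zero (s := Finset.range (p + 1)) fun i _ => h1 i
      rw [Finset.sum_add_distrib] at h4
      have key : ∀ {A B C D E : Bar R n (p + 1)}, A + D = 0 → B + E = 0 →
          A + B + C + (D + E) = C := fun {A B C D E} h h' => by
        rw [show A + B + C + (D + E) = (A + D) + (B + E) + C by abel, h, h', zero_add, zero_add]
      exact key h4 h2

theorem barDiff_zero_single (γ : Fin 1 → (Fin n →₀ ℕ)) (c : PolyRing R n) :
    barDiff R n 0 (Finsupp.single γ c) =
      Finsupp.single (Fin.tail γ) (c * (monU R (γ 0) - monV R (γ 0))) := by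
  rw [barDiff_single, coDiff, Finset.sum_range_succ, Finset.sum_range_one]
  simp only [coface, pow_zero, one_smul, pow_one, neg_smul, ← sub_eq_add_neg, Finsupp.smul_single,
    smul_eq_mul, mul_one, ← Finsupp.single_sub]

variable (R n) in
/-- The substitution `u ↦ v` on the bar resolution in degree `0`. -/
noncomputable def barFold : Bar R n 0 →+ Bar R n 0 :=
  Finsupp.liftAddHom fun γ => (Finsupp.liftAddHom fun m =>
    (Finsupp.singleAddHom γ).comp
      ((AddMonoidAlgebra.coeffAddEquiv (R := R)).symm.toAddMonoidHom.comp
        (Finsupp.singleAddHom (((Finsupp.sumFinsuppEquivProdFinsupp m).1 +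
          (Finsupp.sumFinsuppEquivProdFinsupp m).2).mapDomain Sum.inr)))).comp
      (AddMonoidAlgebra.coeffAddEquiv (R := R)).toAddMonoidHom

theorem barFold_single (γ : Fin 0 → (Fin n →₀ ℕ)) (a b : Fin n →₀ ℕ) (x : R) :
    barFold R n (Finsupp.single γ (polyMon R a b x)) =
      Finsupp.single γ (polyMon R 0 (a + b) x) := by
  rw [barFold, Finsupp.liftAddHom_apply_single]
  refine (Finsupp.liftAddHom_apply_single _ _ _).trans ?_
  rw [sumFinsuppEquivProdFinsupp_mapDomain_add]
  simp only [polyMon, Finsupp.mapDomain_zero, zero_add]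
  rfl

theorem barFold_barDiff (z : Bar R n 1) : barFold R n (barDiff R n 0 z) = 0 := by
  induction z using Finsupp.induction_linear with
  | zero => simp
  | add y z hy hz => rw [map_add, map_add, hy, hz, add_zero]
  | single γ c =>
    induction c using polyRing_induction with
    | zero => simp
    | add y z hy hz => rw [Finsupp.single_add, map_add, map_add, hy, hz, add_zero]
    | mon a b x =>
      rw [barDiff_zero_single, mul_sub, polyMon_mul, polyMon_mul, Finsupp.single_sub, map_sub,
        barFold_single, barFold_single, add_zero, add_zero, sub_eq_zero, add_assoc, add_comm b]

/-- In degree `0` the defect is the augmentation `R[u, v] → R[t]` followed by its section `t ↦ v`.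
-/
theorem barDiff_barHomotopy_zero (z : Bar R n 0) :
    barDiff R n 0 (barHomotopy R n 0 z) = z - barFold R n z := by
  induction z using Finsupp.induction_linear with
  | zero => simp
  | add y z hy hz => rw [map_add, map_add, map_add, hy, hz, add_sub_add_comm]
  | single γ c =>
    induction c using polyRing_induction with
    | zero => simp
    | add y z hy hz =>
      rw [Finsupp.single_add, map_add, map_add, map_add, hy, hz, add_sub_add_comm]
    | mon a b x =>
      rw [barHomotopy_single, barDiff_zero_single, mul_sub, polyMon_mul, polyMon_mul,
        barFold_single, Fin.tail_cons, Finsupp.single_sub, show consExp a γ 0 = a from rfl]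
      simp only [add_zero, mul_one, add_comm]

/-- The relation `d² = 0` is deduced from the contraction instead of the simplicial identities. From
`dh + hd = 1` one gets `d d h = d - d h d = h d d`, which is zero by induction; in degree `0` the
term `barFold` kills boundaries. -/
theorem barDiff_comp (p : ℕ) (z : Bar R n (p + 2)) :
    barDiff R n p (barDiff R n (p + 1) z) = 0 := by
  -- The image of `h` generates: each `[γ]` is `h` of `u^{γ_0}` times the basis element of the tail
  -- of `γ`.
  have ext : ∀ p, (∀ y : Bar R n (p + 1),
      barDiff R n p (barDiff R n (p + 1) (barHomotopy R n (p + 1) y)) = 0) →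
      ∀ z : Bar R n (p + 2), barDiff R n p (barDiff R n (p + 1) z) = 0 := fun p h z => by
    refine LinearMap.congr_fun (f := barDiff R n p ∘ₗ barDiff R n (p + 1)) (g := 0)
      (Finsupp.lhom_ext fun γ c => ?_) z
    have h' := h (Finsupp.single (Fin.tail γ) (monU R (γ 0)))
    rw [barHomotopy_single, consExp, Fin.cons_self_tail, polyMon_zero_one] at h'
    rw [← mul_one c, ← smul_eq_mul, ← Finsupp.smul_single, map_smul, LinearMap.comp_apply, h',
      smul_zero, LinearMap.zero_apply]
  induction p with
  | zero =>
    refine ext 0 (fun y => ?_) z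
    have h := congrArg (barDiff R n 0) (barDiff_barHomotopy 0 y)
    rw [map_add, barDiff_barHomotopy_zero, barFold_barDiff, sub_zero] at h
    exact add_eq_right.1 h
  | succ p ih =>
    refine ext (p + 1) (fun y => ?_) z
    have h := congrArg (barDiff R n (p + 1)) (barDiff_barHomotopy (p + 1) y)
    have h' := barDiff_barHomotopy p (barDiff R n (p + 1) y)
    rw [ih, map_zero, add_zero] at h'
    rw [map_add, h'] at h
    exact add_eq_right.1 h

theorem barDiff_exact (p : ℕ) : Function.Exact (barDiff R n (p + 1)) (barDiff R n p) := by
  intro z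
  constructor
  · intro hz
    have h := barDiff_barHomotopy p z
    rw [hz, map_zero, add_zero] at h
    exact ⟨_, h⟩
  · rintro ⟨y, rfl⟩
    exact barDiff_comp p y

end Bar

/-! ### The Koszul resolution of `R[t]` over `R[u, v]`. -/

section KoszulResolution

variable (R : Type*) [CommRing R] (n : ℕ)

/-- The element `u_i - v_i`. -/
noncomputable def polyAlpha (i : Fin n) : PolyRing R n :=
  monU R (Finsupp.single i 1) - monV R (Finsupp.single i 1)

/-- The differential of the Koszul resolution of the polynomial ring. -/
noncomputable def polyKoszulDiff (p : ℕ) :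
    (KSub n (p + 1) → PolyRing R n) →ₗ[PolyRing R n] (KSub n p → PolyRing R n) :=
  koszulDiff (fun i => algebraMap (PolyRing R n) _ (polyAlpha R n i)) p

variable {R n}

theorem IsKoszulContraction.map {k W k' W' : Type*} [CommRing k] [AddCommGroup W] [Module k W]
    [CommRing k'] [AddCommGroup W'] [Module k' W'] {α s : Fin n → Module.End k W}
    (h : IsKoszulContraction α s) (Φ : Module.End k W →+* Module.End k' W') :
    IsKoszulContraction (fun i => Φ (α i)) (fun i => Φ (s i)) where
  left_inv i := by rw [← map_mul, h.left_inv, map_one]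
  comm i j := (h.comm i j).map Φ
  comm_of_ne i j hij := (h.comm_of_ne i j hij).map Φ

theorem polyKoszulDiff_eq (p : ℕ) (f : KSub n (p + 1) → PolyRing R n) :
    polyKoszulDiff R n p f = koszulDiff (fun i =>
      LinearEquiv.conjRingEquiv (AddMonoidAlgebra.coeffLinearEquiv R).symm (alphaPoly R R i)) p f := by
  have h : ∀ (i : Fin n) (z : PolyRing R n), polyAlpha R n i * z =
      LinearEquiv.conjRingEquiv (AddMonoidAlgebra.coeffLinearEquiv R).symm (alphaPoly R R i) z := by
    intro i z
    induction z using AddMonoidAlgebra.induction_linear with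
    | zero => simp
    | add y z hy hz => rw [mul_add, map_add, hy, hz]
    | single m x =>
      rw [polyAlpha, sub_mul, monU, monV, polyMon, polyMon, AddMonoidAlgebra.single_mul_single,
        AddMonoidAlgebra.single_mul_single]
      refine Eq.trans ?_ (congrArg (AddMonoidAlgebra.coeffLinearEquiv R).symm
        (alphaPoly_single R i m x)).symm
      rw [map_sub]
      simp
  funext S
  rw [polyKoszulDiff, koszulDiff_apply, koszulDiff_apply]
  refine Finset.sum_congr rfl fun i _ => ?_
  rw [← h]
  rfl

/-- The contraction is linear over `R` but not over `R[u, v]`. Exactness concerns the underlying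
functions only, so it may be transported from the `R`-linear complex on coefficients. -/
theorem polyKoszulDiff_exact (p : ℕ) :
    Function.Exact (polyKoszulDiff R n (p + 1)) (polyKoszulDiff R n p) := by
  have h := (((isKoszulContraction_alphaPoly (R := R) (n := n) R).map
    (LinearEquiv.conjRingEquiv (AddMonoidAlgebra.coeffLinearEquiv R).symm).toRingHom).exact_diff p)
  have e : ∀ p, (polyKoszulDiff R n p : (KSub n (p + 1) → PolyRing R n) → _) = _ :=
    fun p => funext (polyKoszulDiff_eq (R := R) (n := n) p)
  rw [e, e]
  exact h

theorem polyKoszulDiff_comp (p : ℕ) (f : KSub n (p + 2) → PolyRing R n) :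
    polyKoszulDiff R n p (polyKoszulDiff R n (p + 1) f) = 0 :=
  (polyKoszulDiff_exact p _).2 ⟨f, rfl⟩

end KoszulResolution

/-! ### Homotopy equivalence of the two resolutions and its effect on cochains. -/

section BarKoszul

variable (R : Type*) [CommRing R] (n : ℕ)

/-- The Koszul resolution of the polynomial ring, in degree `p`. -/
abbrev PolyKoszul (p : ℕ) : Type _ := KSub n p → PolyRing R n

/-- A homotopy equivalence between the bar resolution and the Koszul resolution. -/
structure BarKoszulEquiv where
  toKoszul : ∀ p, Bar R n p →ₗ[PolyRing R n] PolyKoszul R n p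
  toBar : ∀ p, PolyKoszul R n p →ₗ[PolyRing R n] Bar R n p
  barHtpy : ∀ p, Bar R n p →ₗ[PolyRing R n] Bar R n (p + 1)
  koszulHtpy : ∀ p, PolyKoszul R n p →ₗ[PolyRing R n] PolyKoszul R n (p + 1)
  toKoszul_comm : ∀ p x, polyKoszulDiff R n p (toKoszul (p + 1) x) = toKoszul p (barDiff R n p x)
  toBar_comm : ∀ p x, barDiff R n p (toBar (p + 1) x) = toBar p (polyKoszulDiff R n p x)
  -- Both resolutions are free of rank one in degree `0`, so the composites there can be identities
  -- with no homotopy term.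
  bar_zero : ∀ x, toBar 0 (toKoszul 0 x) = x
  koszul_zero : ∀ x, toKoszul 0 (toBar 0 x) = x
  bar_succ : ∀ p x, toBar (p + 1) (toKoszul (p + 1) x) - x =
    barDiff R n (p + 1) (barHtpy (p + 1) x) + barHtpy p (barDiff R n p x)
  koszul_succ : ∀ p x, toKoszul (p + 1) (toBar (p + 1) x) - x =
    polyKoszulDiff R n (p + 1) (koszulHtpy (p + 1) x) + koszulHtpy p (polyKoszulDiff R n p x)

variable {R n}

theorem polyKoszulDiff_apply (p : ℕ) (f : PolyKoszul R n (p + 1)) (S : KSub n p) :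
    polyKoszulDiff R n p f S = ∑ i ∈ S.1ᶜ, (-1 : ℤ) ^ (S.1.filter (· < i)).card •
      (polyAlpha R n i * extendKSub f (insert i S.1)) :=
  koszulDiff_apply _ p f S

/-- The identity `u^(γ+δ) - v^(γ+δ) = u^γ (u^δ - v^δ) + v^δ (u^γ - v^γ)` reduces to a single
variable, where `u_i - v_i` is the boundary of a basis element. It lets the identification in degree
`0` extend to a chain map. -/
theorem const_mem_range_polyKoszulDiff (γ : Fin n →₀ ℕ) (c : PolyRing R n) :
    (fun _ => c * (monU R γ - monV R γ) : PolyKoszul R n 0) ∈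
      LinearMap.range (polyKoszulDiff R n 0) := by
  have hadd : ∀ γ δ : Fin n →₀ ℕ, monU R (γ + δ) - monV R (γ + δ) =
      monU R γ * (monU R δ - monV R δ) + monV R δ * (monU R γ - monV R γ) := fun γ δ => by
    simp only [mul_sub, polyMon_mul, add_zero, zero_add, mul_one, add_comm δ γ]
    abel
  have hzero : monU R (0 : Fin n →₀ ℕ) - monV R 0 = 0 := sub_self _
  have hsum : ∀ {γ δ : Fin n →₀ ℕ},
      (∀ c, (fun _ => c * (monU R γ - monV R γ) : PolyKoszul R n 0) ∈
        LinearMap.range (polyKoszulDiff R n 0)) →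
      (∀ c, (fun _ => c * (monU R δ - monV R δ) : PolyKoszul R n 0) ∈
        LinearMap.range (polyKoszulDiff R n 0)) → ∀ c,
      (fun _ => c * (monU R (γ + δ) - monV R (γ + δ)) : PolyKoszul R n 0) ∈
        LinearMap.range (polyKoszulDiff R n 0) := fun {γ δ} hγ hδ c => by
    convert Submodule.add_mem _ (hδ (c * monU R γ)) (hγ (c * monV R δ)) using 1
    funext S
    rw [hadd, Pi.add_apply]
    ring
  induction γ using Finsupp.induction_linear generalizing c with
  | zero =>
    convert Submodule.zero_mem _ using 1
    funext S
    rw [hzero, mul_zero, Pi.zero_apply]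
  | add γ δ hγ hδ => exact hsum hγ hδ c
  | single i q =>
    induction q generalizing c with
    | zero =>
      convert Submodule.zero_mem _ using 1
      funext S
      rw [Finsupp.single_zero, hzero, mul_zero, Pi.zero_apply]
    | succ q ih =>
      rw [Finsupp.single_add]
      refine hsum ih (fun c => ⟨Pi.single ⟨{i}, Finset.card_singleton i⟩ c, ?_⟩) c
      funext S
      have hS : S.1 = ∅ := Finset.card_eq_zero.1 S.2
      rw [polyKoszulDiff_apply, Finset.sum_eq_single i]
      · simp only [hS, Finset.filter_empty, Finset.card_empty, pow_zero, one_smul]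
        rw [extendKSub_of_card _ (T := insert i ∅) (by simp)]
        have e : (⟨insert i ∅, by simp⟩ : KSub n 1) = ⟨{i}, Finset.card_singleton i⟩ :=
          Subtype.ext (by simp)
        rw [e, Pi.single_eq_same, mul_comm]
        rfl
      · intro j _ hj
        rw [hS, extendKSub_of_card _ (T := insert j ∅) (by simp), Pi.single_eq_of_ne, mul_zero,
          smul_zero]
        intro h
        exact hj (by simpa using congrArg Subtype.val h)
      · simp [hS]

theorem single_mem_range_barDiff (i : Fin n) (c : PolyRing R n) (γ : Fin 0 → (Fin n →₀ ℕ)) :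
    (Finsupp.single γ (polyAlpha R n i * c) : Bar R n 0) ∈ LinearMap.range (barDiff R n 0) := by
  refine ⟨Finsupp.single (fun _ => Finsupp.single i 1) c, ?_⟩
  rw [barDiff_zero_single, mul_comm, Subsingleton.elim (Fin.tail _) γ]
  rfl

theorem kSub_zero_eq (S : KSub n 0) : S = ⟨∅, Finset.card_empty⟩ :=
  Subtype.ext (Finset.card_eq_zero.1 S.2)

variable (R n) in
/-- The identification of the bar resolution with the Koszul resolution in degree `0`. -/
noncomputable def toKoszulZero : Bar R n 0 →ₗ[PolyRing R n] PolyKoszul R n 0 :=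
  LinearMap.pi fun _ => Finsupp.lapply Fin.elim0

variable (R n) in
/-- The identification of the Koszul resolution with the bar resolution in degree `0`. -/
noncomputable def toBarZero : PolyKoszul R n 0 →ₗ[PolyRing R n] Bar R n 0 :=
  Finsupp.lsingle Fin.elim0 ∘ₗ LinearMap.proj ⟨∅, Finset.card_empty⟩

theorem toBarZero_toKoszulZero (x : Bar R n 0) : toBarZero R n (toKoszulZero R n x) = x := by
  refine Finsupp.ext fun γ => ?_
  rw [Subsingleton.elim γ Fin.elim0]
  exact Finsupp.single_eq_same

theorem toKoszulZero_toBarZero (x : PolyKoszul R n 0) :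
    toKoszulZero R n (toBarZero R n x) = x := by
  funext S
  rw [kSub_zero_eq S]
  exact Finsupp.single_eq_same

theorem toKoszulZero_mem_range (x : Bar R n 1) :
    toKoszulZero R n (barDiff R n 0 x) ∈ LinearMap.range (polyKoszulDiff R n 0) := by
  induction x using Finsupp.induction_linear with
  | zero => simp
  | add x y hx hy =>
    rw [map_add, map_add]
    exact Submodule.add_mem _ hx hy
  | single γ c =>
    convert const_mem_range_polyKoszulDiff (γ 0) c using 1
    rw [barDiff_zero_single, Subsingleton.elim (Fin.tail γ) Fin.elim0]
    exact funext fun _ => Finsupp.single_eq_same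

theorem toBarZero_mem_range (x : PolyKoszul R n 1) :
    toBarZero R n (polyKoszulDiff R n 0 x) ∈ LinearMap.range (barDiff R n 0) := by
  change Finsupp.lsingle (R := PolyRing R n) Fin.elim0
    (polyKoszulDiff R n 0 x ⟨∅, Finset.card_empty⟩) ∈ _
  rw [polyKoszulDiff_apply, map_sum]
  refine Submodule.sum_mem _ fun i _ => ?_
  rw [map_zsmul]
  exact zsmul_mem (single_mem_range_barDiff i _ _) _

theorem exists_barHtpy (f : ∀ p, Bar R n p →ₗ[PolyRing R n] PolyKoszul R n p)
    (g : ∀ p, PolyKoszul R n p →ₗ[PolyRing R n] Bar R n p)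
    (hf : ∀ p x, polyKoszulDiff R n p (f (p + 1) x) = f p (barDiff R n p x))
    (hg : ∀ p x, barDiff R n p (g (p + 1) x) = g p (polyKoszulDiff R n p x))
    (h0 : ∀ x, g 0 (f 0 x) = x) : ∃ h : ∀ p, Bar R n p →ₗ[PolyRing R n] Bar R n (p + 1),
      ∀ p x, g (p + 1) (f (p + 1) x) - x =
        barDiff R n (p + 1) (h (p + 1) x) + h p (barDiff R n p x) :=
  exists_homotopy (barDiff R n) (barDiff R n) barDiff_comp barDiff_exact
    (fun p => g p ∘ₗ f p - LinearMap.id)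
    (fun p x => by
      rw [LinearMap.sub_apply, map_sub, LinearMap.comp_apply, hg, hf]
      rfl)
    (LinearMap.ext fun x => sub_eq_zero.2 (h0 x))

theorem exists_koszulHtpy (f : ∀ p, Bar R n p →ₗ[PolyRing R n] PolyKoszul R n p)
    (g : ∀ p, PolyKoszul R n p →ₗ[PolyRing R n] Bar R n p)
    (hf : ∀ p x, polyKoszulDiff R n p (f (p + 1) x) = f p (barDiff R n p x))
    (hg : ∀ p x, barDiff R n p (g (p + 1) x) = g p (polyKoszulDiff R n p x))
    (h0 : ∀ x, f 0 (g 0 x) = x) :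
    ∃ k : ∀ p, PolyKoszul R n p →ₗ[PolyRing R n] PolyKoszul R n (p + 1),
      ∀ p x, f (p + 1) (g (p + 1) x) - x =
        polyKoszulDiff R n (p + 1) (k (p + 1) x) + k p (polyKoszulDiff R n p x) :=
  exists_homotopy (polyKoszulDiff R n) (polyKoszulDiff R n) polyKoszulDiff_comp
    polyKoszulDiff_exact (fun p => f p ∘ₗ g p - LinearMap.id)
    (fun p x => by
      rw [LinearMap.sub_apply, map_sub, LinearMap.comp_apply, hf, hg]
      rfl)
    (LinearMap.ext fun x => sub_eq_zero.2 (h0 x))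

variable (R n) in
theorem exists_toKoszul : ∃ f : ∀ p, Bar R n p →ₗ[PolyRing R n] PolyKoszul R n p,
    f 0 = toKoszulZero R n ∧
      ∀ p x, polyKoszulDiff R n p (f (p + 1) x) = f p (barDiff R n p x) :=
  exists_chainMap (barDiff R n) (polyKoszulDiff R n) barDiff_comp
    polyKoszulDiff_exact (toKoszulZero R n) toKoszulZero_mem_range

variable (R n) in
theorem exists_toBar : ∃ g : ∀ p, PolyKoszul R n p →ₗ[PolyRing R n] Bar R n p,
    g 0 = toBarZero R n ∧
      ∀ p x, barDiff R n p (g (p + 1) x) = g p (polyKoszulDiff R n p x) :=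
  exists_chainMap (polyKoszulDiff R n) (barDiff R n) polyKoszulDiff_comp
    barDiff_exact (toBarZero R n) toBarZero_mem_range

variable (R n) in
theorem nonempty_barKoszulEquiv : Nonempty (BarKoszulEquiv R n) := by
  obtain ⟨f, hf0, hf⟩ := exists_toKoszul R n
  obtain ⟨g, hg0, hg⟩ := exists_toBar R n
  have hgf : ∀ x, g 0 (f 0 x) = x := fun x => by
    rw [hf0, hg0]
    exact toBarZero_toKoszulZero x
  have hfg : ∀ x, f 0 (g 0 x) = x := fun x => by
    rw [hf0, hg0]
    exact toKoszulZero_toBarZero x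
  obtain ⟨h, hh⟩ := exists_barHtpy f g hf hg hgf
  obtain ⟨k, hk⟩ := exists_koszulHtpy f g hf hg hfg
  exact ⟨⟨f, g, h, k, hf, hg, hgf, hfg, hh, hk⟩⟩

variable (R n) in
/-- A homotopy equivalence between the bar resolution and the Koszul resolution. -/
noncomputable def barKoszulEquiv : BarKoszulEquiv R n := Classical.choice (nonempty_barKoszulEquiv R n)

variable {N : Type*} [AddCommGroup N] [Module (PolyRing R n) N]

open Classical in
/-- The values of a Hochschild cochain of the polynomial ring on the Koszul resolution. -/
noncomputable def koszulEval (R : Type*) [CommRing R] {N : Type*} [AddCommGroup N]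
    [Module (PolyRing R n) N] {p : ℕ} (c : (Fin p → (Fin n →₀ ℕ)) → N) (S : KSub n p) : N :=
  Finsupp.linearCombination (PolyRing R n) c ((barKoszulEquiv R n).toBar p (Pi.single S 1))

theorem linearCombination_toBar_of_koszulEval {p : ℕ} (c : (Fin p → (Fin n →₀ ℕ)) → N)
    (hc : ∀ S, koszulEval R c S = 0) (x : PolyKoszul R n p) :
    Finsupp.linearCombination (PolyRing R n) c ((barKoszulEquiv R n).toBar p x) = 0 := by
  classical
  refine LinearMap.congr_fun (f := Finsupp.linearCombination (PolyRing R n) c ∘ₗ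
    (barKoszulEquiv R n).toBar p) (g := 0) (LinearMap.pi_ext' fun S => LinearMap.ext_ring ?_) x
  have h := hc S
  rw [koszulEval] at h
  simp only [LinearMap.comp_apply, LinearMap.zero_apply, LinearMap.coe_single]
  convert h

theorem coDiff_eq (p : ℕ) (c : (Fin p → (Fin n →₀ ℕ)) → N) (γ : Fin (p + 1) → (Fin n →₀ ℕ)) :
    coDiff R p c γ =
      Finsupp.linearCombination (PolyRing R n) c (barDiff R n p (barBasis R γ)) := by
  rw [linearCombination_barDiff, Finsupp.linearCombination_single, one_smul]

/-- Let `φ` be the linear map that extends `c`. It vanishes on boundaries and on the image of the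
Koszul resolution, so applying it to the homotopy relation gives `-φ = φ h d`. The primitive is
therefore `-φ h`. -/
theorem exists_coDiff_eq {p : ℕ} (c : (Fin (p + 1) → (Fin n →₀ ℕ)) → N)
    (hc : coDiff R (p + 1) c = 0) (hS : ∀ S, koszulEval R c S = 0) :
    ∃ b : (Fin p → (Fin n →₀ ℕ)) → N, coDiff R p b = c := by
  let φ := Finsupp.linearCombination (PolyRing R n) c
  have hb : Finsupp.linearCombination (PolyRing R n)
      (fun γ => -φ ((barKoszulEquiv R n).barHtpy p (barBasis R γ))) =
      -(φ ∘ₗ (barKoszulEquiv R n).barHtpy p) :=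
    Finsupp.lhom_ext' fun γ => LinearMap.ext_ring (by simp)
  refine ⟨fun γ => -φ ((barKoszulEquiv R n).barHtpy p (barBasis R γ)), funext fun γ => ?_⟩
  have h := congrArg φ ((barKoszulEquiv R n).bar_succ p (barBasis R γ))
  rw [map_sub, linearCombination_toBar_of_koszulEval c hS, map_add, linearCombination_barDiff, hc,
    Finsupp.linearCombination_single, one_smul] at h
  rw [coDiff_eq, hb, LinearMap.neg_apply, LinearMap.comp_apply]
  simp only [Finsupp.linearCombination_zero, LinearMap.zero_apply, zero_add, zero_sub] at h
  rw [← h, neg_neg]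

theorem eq_zero_of_koszulEval (c : (Fin 0 → (Fin n →₀ ℕ)) → N)
    (hS : ∀ S, koszulEval R c S = 0) : c = 0 := by
  funext γ
  have h := linearCombination_toBar_of_koszulEval c hS
    ((barKoszulEquiv R n).toKoszul 0 (barBasis R γ))
  rwa [(barKoszulEquiv R n).bar_zero, Finsupp.linearCombination_single, one_smul] at h

/-- All matrix coefficients of the Koszul differential are, up to sign, elements `u_i - v_i` or
zero, and these act by zero on `N`. -/
theorem map_polyKoszulDiff_eq_zero
    (hN : ∀ (i : Fin n) (x : N), polyAlpha R n i • x = 0) {p : ℕ}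
    (ψ : PolyKoszul R n p →ₗ[PolyRing R n] N) (x : PolyKoszul R n (p + 1)) :
    ψ (polyKoszulDiff R n p x) = 0 := by
  classical
  rw [pi_eq_sum_univ' (polyKoszulDiff R n p x), map_sum]
  refine Finset.sum_eq_zero fun S _ => ?_
  rw [map_smul, polyKoszulDiff_apply, Finset.sum_smul]
  refine Finset.sum_eq_zero fun i _ => ?_
  rw [smul_assoc, mul_smul, hN, smul_zero]

theorem koszulEval_coDiff (hN : ∀ (i : Fin n) (x : N), polyAlpha R n i • x = 0) {p : ℕ}
    (b : (Fin p → (Fin n →₀ ℕ)) → N) (S : KSub n (p + 1)) : koszulEval R (coDiff R p b) S = 0 := by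
  rw [koszulEval, ← linearCombination_barDiff, BarKoszulEquiv.toBar_comm]
  exact map_polyKoszulDiff_eq_zero hN
    (Finsupp.linearCombination (PolyRing R n) b ∘ₗ (barKoszulEquiv R n).toBar p) _

/-- Extend `κ` linearly to `ψ` and pull it back to the bar resolution. The pullback is a cocycle
because `ψ` kills boundaries, and its values are those of `ψ` because `ψ` kills both terms `d k` and
`k d` of the homotopy on the Koszul side. -/
theorem exists_koszulEval_eq (hN : ∀ (i : Fin n) (x : N), polyAlpha R n i • x = 0) {p : ℕ}
    (κ : KSub n p → N) : ∃ c : (Fin p → (Fin n →₀ ℕ)) → N,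
      coDiff R p c = 0 ∧ ∀ S, koszulEval R c S = κ S := by
  classical
  let ψ : PolyKoszul R n p →ₗ[PolyRing R n] N := Fintype.linearCombination (PolyRing R n) κ
  let c : (Fin p → (Fin n →₀ ℕ)) → N := fun γ => ψ ((barKoszulEquiv R n).toKoszul p (barBasis R γ))
  have hc : Finsupp.linearCombination (PolyRing R n) c = ψ ∘ₗ (barKoszulEquiv R n).toKoszul p :=
    Finsupp.lhom_ext' fun γ => LinearMap.ext_ring (by simp [c])
  refine ⟨c, funext fun γ => ?_, fun S => ?_⟩
  · rw [coDiff_eq, hc, LinearMap.comp_apply, ← BarKoszulEquiv.toKoszul_comm]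
    exact map_polyKoszulDiff_eq_zero hN ψ _
  · rw [koszulEval, hc, LinearMap.comp_apply]
    have hψ : ψ (Pi.single S 1) = κ S := by
      simp only [ψ]
      rw [Fintype.linearCombination_apply_single, one_smul]
    rw [← hψ]
    cases p with
    | zero => rw [BarKoszulEquiv.koszul_zero]
    | succ p =>
      have h := congrArg ψ ((barKoszulEquiv R n).koszul_succ p (Pi.single S 1))
      rw [map_add, map_polyKoszulDiff_eq_zero hN, zero_add] at h
      have h' := map_polyKoszulDiff_eq_zero hN (ψ ∘ₗ (barKoszulEquiv R n).koszulHtpy p)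
        (Pi.single S 1)
      rw [LinearMap.comp_apply] at h'
      rw [h', map_sub, sub_eq_zero] at h
      convert h

end BarKoszul

/-! ### Morphisms out of `A_n` are determined by their values on monomials. -/

section Evaluation

variable {R : Type r} [CommRing R] {X : Type u} [Category.{v} X] [Preadditive X] [Linear R X]
  [MonoidalCategory X]

/-- The map `m ↦ b × m`, for `b` in the value at `𝟏` of the monoid. -/
def FMod.L {B : FMon.{r, u, v, t} R X} (G : FMod.{r, u, v, t, s} B) (b : B.obj (𝟙_ X)) (x : X) :
    G.obj x →ₗ[R] G.obj x :=
  G.map (λ_ x).hom ∘ₗ G.act.toFun (𝟙_ X) x b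

theorem FMod.L_map {B : FMon.{r, u, v, t} R X} (G : FMod.{r, u, v, t, s} B) (b : B.obj (𝟙_ X))
    {x y : X} (φ : x ⟶ y) (m : G.obj x) : G.L b y (G.map φ m) = G.map φ (G.L b x m) := by
  have h := G.act.naturality (𝟙 (𝟙_ X)) φ b m
  rw [B.map_id] at h
  simp only [FMod.L, LinearMap.comp_apply, h, ← LinFun.map_comp]
  simp

/-- The element `ε t^γ` of the value at `𝟏` of the monoid of polynomials. -/
noncomputable abbrev FMon.varMonomial (A : FMon.{r, u, v, t} R X) {σ : Type} (γ : σ →₀ ℕ) :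
    (A.poly σ).obj (𝟙_ X) :=
  (A.monomial γ).app (𝟙_ X) A.one

theorem FMon.varMonomial_times (A : FMon.{r, u, v, t} R X) {σ : Type} (γ δ : σ →₀ ℕ) :
    (A.poly σ).times (A.varMonomial γ) (A.varMonomial δ) =
      (A.poly σ).map (λ_ (𝟙_ X)).inv (A.varMonomial (γ + δ)) := by
  refine (A.poly_times γ δ A.one A.one).trans ?_
  rw [← LinFun.Hom.naturality]
  congr 1
  conv_rhs => rw [← A.one_mul A.one]
  rw [← LinFun.map_comp, Iso.hom_inv_id, LinFun.map_id]

variable [MonoidalPreadditive X] [MonoidalLinear R X]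

/-- The shifted functor `G_x : y ↦ G(x ⋄ y)`. -/
def LinFun.shift (G : LinFun.{r, u, v, s} R X) (x : X) : LinFun.{r, u, v, s} R X :=
  LinFun.of (fun y => G.obj (x ⊗ y)) (fun φ => G.map (x ◁ φ))
    (fun y a => by rw [whiskerLeft_id, G.map_id])
    (fun φ ψ a => by rw [whiskerLeft_comp, G.map_comp])
    (fun φ ψ a => by rw [MonoidalPreadditive.whiskerLeft_add, G.map_add])
    (fun c φ a => by rw [MonoidalLinear.whiskerLeft_smul, G.map_smul])

variable {A : FMon.{r, u, v, t} R X} {n : ℕ} (G : FMod.{r, u, v, t, s} (A.poly (Fin n)))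

/-- The values on monomials of an element of the internal hom out of a monoid of polynomials. -/
noncomputable def FMod.evalMonomial (x : X) :
    G.ihom.obj x →ₗ[R] ((Fin n →₀ ℕ) → G.obj x) where
  toFun f γ := G.map (ρ_ x).hom (f.1 (𝟙_ X) (A.varMonomial γ))
  map_add' _ _ := funext fun _ => map_add (G.map (ρ_ x).hom) _ _
  map_smul' c _ := funext fun _ => map_smul (G.map (ρ_ x).hom) c _

theorem FMod.evalMonomial_apply (x : X) (f : G.ihom.obj x) (γ : Fin n →₀ ℕ) :
    G.evalMonomial x f γ = G.map (ρ_ x).hom (f.1 (𝟙_ X) (A.varMonomial γ)) := rfl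

theorem FMod.evalMonomial_map {x y : X} (φ : x ⟶ y) (f : G.ihom.obj x) (γ : Fin n →₀ ℕ) :
    G.evalMonomial y (G.ihom.map φ f) γ = G.map φ (G.evalMonomial x f γ) := by
  change G.map (ρ_ y).hom (G.map (φ ▷ 𝟙_ X) (f.1 (𝟙_ X) (A.varMonomial γ))) = _
  rw [evalMonomial_apply, ← LinFun.map_comp, ← LinFun.map_comp]
  congr 2
  simp

theorem FMod.evalMonomial_L (b : (A.poly (Fin n)).obj (𝟙_ X)) (x : X) (f : G.ihom.obj x)
    (γ : Fin n →₀ ℕ) : G.evalMonomial x (G.ihom.L b x f) γ = G.L b x (G.evalMonomial x f γ) := by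
  rw [evalMonomial_apply, evalMonomial_apply, FMod.L_map]
  congr 1
  change G.map ((λ_ x).hom ▷ 𝟙_ X) (G.map (α_ (𝟙_ X) x (𝟙_ X)).inv
    (G.act.toFun _ _ b (f.1 (𝟙_ X) (A.varMonomial γ)))) = _
  rw [← LinFun.map_comp, FMod.L, LinearMap.comp_apply]
  congr 2
  monoidal

theorem FMod.evalMonomial_ihomMap {G G' : FMod.{r, u, v, t, s} (A.poly (Fin n))}
    (h : LinFun.Hom G.toLinFun G'.toLinFun) (x : X) (f : G.ihom.obj x) (γ : Fin n →₀ ℕ) :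
    G'.evalMonomial x (((A.poly (Fin n)).toLinFun.ihomMap h).app x f) γ =
      h.app x (G.evalMonomial x f γ) := by
  exact (h.naturality (ρ_ x).hom (f.1 (𝟙_ X) (A.varMonomial γ))).symm

/-- The middle face multiplies two arguments, and `ε t^γ × ε t^δ` is `ε t^(γ+δ)` up to a unitor. -/
theorem FMod.evalMonomial_middleFace (x : X) (f : G.ihom.obj x) (γ δ : Fin n →₀ ℕ) :
    G.evalMonomial x (G.ihom.evalMonomial x
      (((A.poly (Fin n)).middleFace G.toLinFun).app x f) γ) δ = G.evalMonomial x f (γ + δ) := by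
  rw [evalMonomial_apply]
  change G.map (ρ_ x).hom (G.map ((ρ_ x).hom ▷ 𝟙_ X) (G.map (α_ x (𝟙_ X) (𝟙_ X)).inv
    (f.1 _ ((A.poly (Fin n)).times (A.varMonomial γ) (A.varMonomial δ))))) = _
  rw [A.varMonomial_times, f.2, evalMonomial_apply, ← LinFun.map_comp, ← LinFun.map_comp, ← LinFun.map_comp]
  congr 2
  simp

section Braided

variable [BraidedCategory X]

theorem FMod.evalMonomial_leftFace (x : X) (m : G.obj x) (γ : Fin n →₀ ℕ) :
    G.evalMonomial x (G.leftFace.app x m) γ = G.L (A.varMonomial γ) x m := by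
  rw [evalMonomial_apply]
  change G.map (ρ_ x).hom (G.map (β_ (𝟙_ X) x).hom (G.act.toFun (𝟙_ X) x (A.varMonomial γ) m)) = _
  rw [← LinFun.map_comp, FMod.L, LinearMap.comp_apply]
  congr 2
  simp

/-- The pairing `(a, b) ↦ a × f(b t^γ)`. -/
noncomputable def FMod.shiftPairing (x : X) (f : G.ihom.obj x) (γ : Fin n →₀ ℕ) :
    Pairing A.toLinFun A.toLinFun (G.toLinFun.shift x) where
  toFun y z := ((G.act.toFun y (x ⊗ z)).compl₁₂ ((A.monomial 0).app y)
    (f.1 z ∘ₗ (A.monomial γ).app z)).compr₂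
      -- The symmetry moves `y` past `x`, so that the value lies in the shifted functor at `y ⋄ z`.
      (G.map ((α_ y x z).inv ≫ (β_ y x).hom ▷ z ≫ (α_ x y z).hom))
  naturality {y y' z z'} φ ψ a b := by
    have h1 := f.2 z z' ψ ((A.monomial γ).app z b)
    have h2 := G.act.naturality φ (x ◁ ψ) ((A.monomial 0).app y a)
      (f.1 z ((A.monomial γ).app z b))
    change G.map _ (G.act.toFun y' (x ⊗ z') ((A.monomial 0).app y' (A.map φ a))
      (f.1 z' ((A.monomial γ).app z' (A.map ψ b)))) =
      G.map (x ◁ (φ ⊗ₘ ψ)) (G.map _ (G.act.toFun y (x ⊗ z) ((A.monomial 0).app y a)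
        (f.1 z ((A.monomial γ).app z b))))
    rw [LinFun.Hom.naturality, LinFun.Hom.naturality, h1, h2, ← LinFun.map_comp, ← LinFun.map_comp]
    congr 2
    rw [MonoidalCategory.tensorHom_def, MonoidalCategory.tensorHom_def,
      MonoidalCategory.whiskerLeft_comp]
    simp only [Category.assoc]
    rw [associator_inv_naturality_right_assoc, whisker_exchange_assoc,
      associator_inv_naturality_left_assoc, ← comp_whiskerRight_assoc,
      BraidedCategory.braiding_naturality_left]
    simp

/-- The pairing `(a, b) ↦ a × f(b t^γ)` takes the same value on `(a, ε)` and `(ε, a)`, since both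
products are `a` up to unitors. The first value is `a × f(ε t^γ)` and the second is `f(a t^γ)`. So
naturality alone forces linearity over `A`. -/
theorem FMod.apply_monomial (hA : A.IsTensorIdempotent) (x : X) (f : G.ihom.obj x)
    (γ : Fin n →₀ ℕ) (y : X) (a : A.obj y) : f.1 y ((A.monomial γ).app y a) =
      G.map (β_ y x).hom (G.smul ((A.monomial 0).app y a) (G.evalMonomial x f γ)) := by
  have h := hA.pairing_congr (G.shiftPairing x f γ) (ρ_ y).hom (λ_ y).hom a A.one A.one a
    ((A.mul_one a).trans (A.one_mul a).symm)
  change G.map (x ◁ (ρ_ y).hom) (G.map _ (G.act.toFun y (x ⊗ 𝟙_ X) ((A.monomial 0).app y a)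
      (f.1 (𝟙_ X) (A.varMonomial γ)))) =
    G.map (x ◁ (λ_ y).hom) (G.map _ (G.act.toFun (𝟙_ X) (x ⊗ y) (A.poly (Fin n)).one
      (f.1 y ((A.monomial γ).app y a)))) at h
  have h1 : G.map (x ◁ (λ_ y).hom) (G.map ((α_ (𝟙_ X) x y).inv ≫ (β_ (𝟙_ X) x).hom ▷ y ≫
      (α_ x (𝟙_ X) y).hom) (G.act.toFun (𝟙_ X) (x ⊗ y) (A.poly (Fin n)).one
      (f.1 y ((A.monomial γ).app y a)))) = f.1 y ((A.monomial γ).app y a) := by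
    refine Eq.trans ?_ (G.one_act _)
    rw [← LinFun.map_comp]
    congr 2
    simp
  rw [← h1, ← h, evalMonomial_apply]
  have h2 := G.act.naturality (𝟙 y) (ρ_ x).hom ((A.monomial 0).app y a)
    (f.1 (𝟙_ X) (A.varMonomial γ))
  rw [LinFun.map_id] at h2
  rw [FMod.smul, h2, ← LinFun.map_comp, ← LinFun.map_comp]
  congr 2
  simp

theorem FMod.evalMonomial_bijective (hA : A.IsTensorIdempotent) (x : X) :
    Function.Bijective (G.evalMonomial x) := by
  constructor
  · intro f g h
    refine Subtype.ext (funext fun y => A.poly_hom_ext fun γ a => ?_)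
    rw [G.apply_monomial hA, G.apply_monomial hA, h]
  · intro g
    -- The formula of `FMod.apply_monomial`, read as a definition: `a t^γ` goes to `a × g_γ`, up to
    -- the symmetry.
    let f : ∀ y, (A.poly (Fin n)).obj y →ₗ[R] G.obj (x ⊗ y) := fun y =>
      Finsupp.lsum R fun γ => G.map (β_ y x).hom ∘ₗ (G.act.toFun y x).flip (g γ) ∘ₗ
        (A.monomial 0).app y
    have hf : ∀ y γ (a : A.obj y), f y ((A.monomial γ).app y a) =
        G.map (β_ y x).hom (G.smul ((A.monomial 0).app y a) (g γ)) := fun y γ a =>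
      Finsupp.lsum_single _ _ _ _
    refine ⟨⟨f, fun y y' ψ p => ?_⟩, funext fun γ => ?_⟩
    · refine LinearMap.congr_fun (f := f y' ∘ₗ (A.poly (Fin n)).map ψ)
        (g := G.map (x ◁ ψ) ∘ₗ f y) (A.poly_hom_ext fun γ a => ?_) p
      rw [LinearMap.comp_apply, LinearMap.comp_apply, ← LinFun.Hom.naturality, hf, hf,
        LinFun.Hom.naturality]
      have h := G.act.naturality ψ (𝟙 x) ((A.monomial 0).app y a) (g γ)
      rw [LinFun.map_id] at h
      rw [FMod.smul, FMod.smul, h, ← LinFun.map_comp, ← LinFun.map_comp]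
      congr 2
      simp
    · change G.map (ρ_ x).hom (f (𝟙_ X) ((A.monomial γ).app (𝟙_ X) A.one)) = g γ
      rw [hf, ← LinFun.map_comp]
      refine Eq.trans ?_ (G.one_act (g γ))
      change _ = G.map _ (G.smul ((A.monomial 0).app (𝟙_ X) A.one) (g γ))
      congr 2
      simp

end Braided

end Evaluation

/-! ### Bimodules over `A_n` as families of modules over `R[u, v]`. -/

section PolynomialBimodules

variable {R : Type r} [CommRing R] {X : Type u} [Category.{v} X] [Preadditive X] [Linear R X]
  [MonoidalCategory X]

section Actions

variable {B : FMon.{r, u, v, t} R X}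

theorem FMod.L_L (G : FMod.{r, u, v, t, s} B) {b c d : B.obj (𝟙_ X)}
    (h : B.times b c = B.map (λ_ (𝟙_ X)).inv d) (x : X) (m : G.obj x) :
    G.L b x (G.L c x m) = G.L d x m := by
  have h1 := G.act.naturality (𝟙 (𝟙_ X)) (λ_ x).hom b (G.smul c m)
  have h2 := G.act.naturality (λ_ (𝟙_ X)).inv (𝟙 x) d m
  rw [LinFun.map_id] at h1 h2
  change G.map (λ_ x).hom (G.act.toFun (𝟙_ X) x b (G.map (λ_ x).hom (G.smul c m))) =
    G.map (λ_ x).hom (G.act.toFun (𝟙_ X) x d m)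
  rw [h1, ← G.act_assoc, h, h2, ← LinFun.map_comp, ← LinFun.map_comp, ← LinFun.map_comp]
  congr 2
  monoidal

theorem FMod.L_one (G : FMod.{r, u, v, t, s} B) (x : X) (m : G.obj x) : G.L B.one x m = m :=
  G.one_act m

/-- The map `m ↦ m × b`, for `b` in the value at `𝟏` of the monoid. -/
def FBimod.rightMul (M : FBimod.{r, u, v, t, s} B) (b : B.obj (𝟙_ X)) (x : X) :
    M.obj x →ₗ[R] M.obj x :=
  M.map (ρ_ x).hom ∘ₗ (M.ract.toFun x (𝟙_ X)).flip b

theorem FBimod.rightMul_rightMul (M : FBimod.{r, u, v, t, s} B) {b c d : B.obj (𝟙_ X)}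
    (h : B.times b c = B.map (λ_ (𝟙_ X)).inv d) (x : X) (m : M.obj x) :
    M.rightMul c x (M.rightMul b x m) = M.rightMul d x m := by
  have h1 := M.ract.naturality (ρ_ x).hom (𝟙 (𝟙_ X)) (M.ract.toFun x (𝟙_ X) m b) c
  have h2 := M.ract.naturality (𝟙 x) (λ_ (𝟙_ X)).inv m d
  have h3 := M.ract_assoc m b c
  rw [LinFun.map_id] at h1 h2
  change M.map (ρ_ x).hom (M.ract.toFun x (𝟙_ X) (M.map (ρ_ x).hom (M.ract.toFun x (𝟙_ X) m b)) c) =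
    M.map (ρ_ x).hom (M.ract.toFun x (𝟙_ X) m d)
  rw [h, h2] at h3
  have h4 := congrArg (M.map (α_ x (𝟙_ X) (𝟙_ X)).inv) h3
  rw [← LinFun.map_comp, Iso.hom_inv_id, LinFun.map_id] at h4
  rw [h1, h4, ← LinFun.map_comp, ← LinFun.map_comp, ← LinFun.map_comp]
  congr 2
  monoidal

theorem FBimod.rightMul_one (M : FBimod.{r, u, v, t, s} B) (x : X) (m : M.obj x) :
    M.rightMul B.one x m = m :=
  M.ract_one m

theorem FBimod.rightMul_map (M : FBimod.{r, u, v, t, s} B) (b : B.obj (𝟙_ X)) {x y : X}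
    (φ : x ⟶ y) (m : M.obj x) : M.rightMul b y (M.map φ m) = M.map φ (M.rightMul b x m) := by
  have h := M.ract.naturality φ (𝟙 (𝟙_ X)) m b
  rw [LinFun.map_id] at h
  change M.map (ρ_ y).hom (M.ract.toFun y (𝟙_ X) (M.map φ m) b) =
    M.map φ (M.map (ρ_ x).hom (M.ract.toFun x (𝟙_ X) m b))
  rw [h, ← LinFun.map_comp, ← LinFun.map_comp]
  congr 2
  simp

/-- Compatibility of the two actions of a bimodule; with it, left and right monomials assemble into
one action of a commutative ring. -/
theorem FBimod.L_rightMul (M : FBimod.{r, u, v, t, s} B) (b c : B.obj (𝟙_ X)) (x : X)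
    (m : M.obj x) : M.L b x (M.rightMul c x m) = M.rightMul c x (M.L b x m) := by
  have h1 := M.act.naturality (𝟙 (𝟙_ X)) (ρ_ x).hom b (M.ract.toFun x (𝟙_ X) m c)
  have h2 := M.ract.naturality (λ_ x).hom (𝟙 (𝟙_ X)) (M.smul b m) c
  have h3 := M.act_ract b m c
  rw [LinFun.map_id] at h1 h2
  change M.map (λ_ x).hom (M.act.toFun (𝟙_ X) x b (M.map (ρ_ x).hom (M.ract.toFun x (𝟙_ X) m c))) =
    M.map (ρ_ x).hom (M.ract.toFun x (𝟙_ X) (M.map (λ_ x).hom (M.smul b m)) c)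
  rw [h1, h2, ← h3, ← LinFun.map_comp, ← LinFun.map_comp, ← LinFun.map_comp]
  congr 2
  monoidal

end Actions

variable {A : FMon.{r, u, v, t} R X} {n : ℕ} (M : FBimod.{r, u, v, t, s} (A.poly (Fin n)))

/-- The action of the monomials `u^c v^b` on a bimodule over the monoid of polynomials: the
variables `u` act on the left and the variables `v` on the right. -/
noncomputable def FBimod.monomialEnd (x : X) :
    Multiplicative (Fin n ⊕ Fin n →₀ ℕ) →* Module.End R (M.obj x) where
  toFun m := M.L (A.varMonomial (Finsupp.sumFinsuppAddEquivProdFinsupp m.toAdd).1) x ∘ₗ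
    M.rightMul (A.varMonomial (Finsupp.sumFinsuppAddEquivProdFinsupp m.toAdd).2) x
  map_one' := by
    rw [toAdd_one, map_zero]
    exact LinearMap.ext fun m => (M.L_one x _).trans (M.rightMul_one x m)
  map_mul' m m' := by
    rw [toAdd_mul, map_add]
    refine LinearMap.ext fun a => ?_
    change M.L (A.varMonomial (_ + _)) x (M.rightMul (A.varMonomial (_ + _)) x a) =
      M.L _ x (M.rightMul _ x (M.L _ x (M.rightMul _ x a)))
    -- Right products compose in the reverse order, which is corrected by commutativity of the
    -- addition of exponents.
    rw [← M.L_rightMul, M.L_L (A.varMonomial_times _ _),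
      M.rightMul_rightMul (A.varMonomial_times _ _), add_comm (Prod.snd _)]

/-- This structure turns `M(x)` into a coefficient module for the bar and Koszul resolutions over
`R[u, v]`. -/
noncomputable instance FBimod.polyModule (x : X) : Module (PolyRing R n) (M.obj x) :=
  Module.compHom _ (AddMonoidAlgebra.lift R (Module.End R (M.obj x)) (Fin n ⊕ Fin n →₀ ℕ)
    (M.monomialEnd x)).toRingHom

theorem FBimod.smul_def (x : X) (z : PolyRing R n) (m : M.obj x) :
    z • m = AddMonoidAlgebra.lift R (Module.End R (M.obj x)) (Fin n ⊕ Fin n →₀ ℕ)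
      (M.monomialEnd x) z m := rfl

instance FBimod.smulCommClass_polyModule (x : X) : SMulCommClass R (PolyRing R n) (M.obj x) where
  smul_comm c z m := by rw [M.smul_def, M.smul_def, LinearMap.map_smul]

theorem FBimod.polyMon_smul (x : X) (c b : Fin n →₀ ℕ) (k : R) (m : M.obj x) :
    polyMon R c b k • m =
      k • M.L (A.varMonomial c) x (M.rightMul (A.varMonomial b) x m) := by
  have h : Finsupp.sumFinsuppAddEquivProdFinsupp (c.mapDomain Sum.inl + b.mapDomain Sum.inr) =
    (c, b) := sumFinsuppEquivProdFinsupp_mapDomain_add c b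
  have h1 : M.monomialEnd x (Multiplicative.ofAdd (c.mapDomain Sum.inl + b.mapDomain Sum.inr)) m =
      M.L (A.varMonomial c) x (M.rightMul (A.varMonomial b) x m) :=
    congrArg (fun q : (Fin n →₀ ℕ) × (Fin n →₀ ℕ) =>
      M.L (A.varMonomial q.1) x (M.rightMul (A.varMonomial q.2) x m)) h
  rw [← h1]
  exact LinearMap.congr_fun (AddMonoidAlgebra.lift_single (M.monomialEnd x) _ k) m

theorem FBimod.monU_smul (x : X) (c : Fin n →₀ ℕ) (m : M.obj x) :
    monU R c • m = M.L (A.varMonomial c) x m := by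
  rw [M.polyMon_smul, one_smul]
  exact congrArg _ (M.rightMul_one x m)

theorem FBimod.monV_smul (x : X) (b : Fin n →₀ ℕ) (m : M.obj x) :
    monV R b • m = M.rightMul (A.varMonomial b) x m := by
  rw [M.polyMon_smul, one_smul]
  exact M.L_one x _

/-- The maps `M(φ)` are linear over the ring of polynomials. -/
noncomputable def FBimod.polyMap {x y : X} (φ : x ⟶ y) : M.obj x →ₗ[PolyRing R n] M.obj y where
  toFun := M.map φ
  map_add' := map_add _
  map_smul' z m := by
    induction z using polyRing_induction with
    | zero => rw [zero_smul, map_zero, RingHom.id_apply, zero_smul]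
    | add z z' hz hz' =>
      rw [RingHom.id_apply] at hz hz' ⊢
      rw [add_smul, map_add, hz, hz', add_smul]
    | mon c b k =>
      rw [RingHom.id_apply, M.polyMon_smul, M.polyMon_smul, map_smul, M.rightMul_map, M.L_map]

/-- Variables lie in the commutant, so left and right products by `t_i` agree on `A_n`. -/
theorem FMon.polyAlpha_smul_selfBimod [BraidedCategory X] (A : FMon.{r, u, v, t} R X) {n : ℕ}
    (i : Fin n) (x : X) (m : (A.poly (Fin n)).selfBimod.obj x) : polyAlpha R n i • m = 0 := by
  rw [polyAlpha, sub_smul, FBimod.monU_smul, FBimod.monV_smul, sub_eq_zero]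
  have h := A.polyVar_inCommutant i x m
  change (A.poly (Fin n)).map (λ_ x).hom ((A.poly (Fin n)).times (A.polyVar i) m) =
    (A.poly (Fin n)).map (ρ_ x).hom ((A.poly (Fin n)).times m (A.polyVar i))
  rw [h, ← LinFun.map_comp]
  congr 2
  simp

end PolynomialBimodules

/-! ### Hochschild cohomology computed on the Koszul resolution. -/

section CochainEvaluation

variable {R : Type r} [CommRing R] {X : Type u} [Category.{v} X] [Preadditive X] [Linear R X]
  [MonoidalCategory X] [MonoidalPreadditive X] [MonoidalLinear R X]
  {A : FMon.{r, u, v, t} R X} {n : ℕ} (M : FBimod.{r, u, v, t, s} (A.poly (Fin n)))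

/-- The values on monomials of a Hochschild cochain. -/
noncomputable def FBimod.cochainEval (M : FBimod.{r, u, v, t, s} (A.poly (Fin n))) :
    ∀ (p : ℕ) (x : X), (M.cochains p).obj x →ₗ[R] ((Fin p → (Fin n →₀ ℕ)) → M.obj x)
  | 0, x => LinearMap.pi fun _ => (ULift.moduleEquiv (R := R) (M := M.obj x)).toLinearMap
  | p + 1, x => (LinearMap.pi fun γ : Fin (p + 1) → (Fin n →₀ ℕ) =>
      (LinearMap.proj (R := R) (φ := fun _ : Fin p → (Fin n →₀ ℕ) => M.obj x) (Fin.tail γ)) ∘ₗ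
        (FBimod.cochainEval M p x) ∘ₗ
      (LinearMap.proj (R := R) (φ := fun _ : Fin n →₀ ℕ => (M.cochains p).obj x) (γ 0))) ∘ₗ
    (M.cochains p).evalMonomial x

theorem FBimod.cochainEval_succ (p : ℕ) (x : X) (f : (M.cochains (p + 1)).obj x)
    (γ : Fin (p + 1) → (Fin n →₀ ℕ)) : M.cochainEval (p + 1) x f γ =
      M.cochainEval p x ((M.cochains p).evalMonomial x f (γ 0)) (Fin.tail γ) := rfl

theorem FBimod.cochainEval_of_evalMonomial {p : ℕ} {x : X} {f : (M.cochains (p + 1)).obj x}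
    {γ : Fin (p + 1) → (Fin n →₀ ℕ)} {g : (M.cochains p).obj x}
    (h : (M.cochains p).evalMonomial x f (γ 0) = g) :
    M.cochainEval (p + 1) x f γ = M.cochainEval p x g (Fin.tail γ) := by
  rw [cochainEval_succ, h]

theorem FBimod.cochainEval_L (b : (A.poly (Fin n)).obj (𝟙_ X)) (p : ℕ) (x : X)
    (f : (M.cochains p).obj x) (γ : Fin p → (Fin n →₀ ℕ)) :
    M.cochainEval p x ((M.cochains p).L b x f) γ = M.L b x (M.cochainEval p x f γ) := by
  induction p with
  | zero => rfl
  | succ p ih =>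
    rw [cochainEval_succ M p x f, ← ih]
    exact M.cochainEval_of_evalMonomial ((M.cochains p).evalMonomial_L b x f _)

theorem FBimod.cochainEval_map (p : ℕ) {x y : X} (φ : x ⟶ y) (f : (M.cochains p).obj x)
    (γ : Fin p → (Fin n →₀ ℕ)) :
    M.cochainEval p y ((M.cochains p).map φ f) γ = M.map φ (M.cochainEval p x f γ) := by
  induction p with
  | zero => rfl
  | succ p ih =>
    rw [cochainEval_succ M p x f, ← ih]
    exact M.cochainEval_of_evalMonomial ((M.cochains p).evalMonomial_map φ f _)

/-- The values of a Hochschild cochain on the Koszul resolution. -/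
noncomputable def FBimod.koszulEvalCochain (p : ℕ) (x : X) :
    (M.cochains p).obj x →ₗ[R] (KSub n p → M.obj x) where
  toFun f := koszulEval R (M.cochainEval p x f)
  map_add' f g := by
    funext S
    rw [map_add, Pi.add_apply]
    simp only [koszulEval, Finsupp.linearCombination_apply, Finsupp.sum, Pi.add_apply, smul_add,
      Finset.sum_add_distrib]
  map_smul' c f := by
    funext S
    rw [map_smul, RingHom.id_apply, Pi.smul_apply]
    simp only [koszulEval, Finsupp.linearCombination_apply, Finsupp.sum, Pi.smul_apply,
      Finset.smul_sum, smul_comm c]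

theorem koszulEval_map {N N' : Type*} [AddCommGroup N] [Module (PolyRing R n) N] [AddCommGroup N']
    [Module (PolyRing R n) N'] (φ : N →ₗ[PolyRing R n] N') {p : ℕ}
    (c : (Fin p → (Fin n →₀ ℕ)) → N) (S : KSub n p) :
    koszulEval R (fun γ => φ (c γ)) S = φ (koszulEval R c S) :=
  (Finsupp.apply_linearCombination _ φ c _).symm

theorem FBimod.koszulEvalCochain_map (p : ℕ) {x y : X} (φ : x ⟶ y) (f : (M.cochains p).obj x)
    (S : KSub n p) : M.koszulEvalCochain p y ((M.cochains p).map φ f) S =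
      M.map φ (M.koszulEvalCochain p x f S) := by
  refine Eq.trans ?_ (koszulEval_map (M.polyMap φ) (M.cochainEval p x f) S)
  exact congrFun (congrArg (koszulEval R) (funext fun γ => M.cochainEval_map p φ f γ)) S

variable [BraidedCategory X]

/-- Iterates `FMod.evalMonomial_bijective`, one argument of the cochain at a time. -/
theorem FBimod.cochainEval_bijective (hA : A.IsTensorIdempotent) (p : ℕ) (x : X) :
    Function.Bijective (M.cochainEval p x) := by
  induction p with
  | zero =>
    refine ⟨fun f g h => ULift.ext _ _ (congrFun h Fin.elim0), fun g => ⟨⟨g Fin.elim0⟩, ?_⟩⟩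
    funext γ
    exact congrArg g (Subsingleton.elim _ _)
  | succ p ih =>
    constructor
    · intro f g h
      refine ((M.cochains p).evalMonomial_bijective hA x).1 (funext fun a => ih.1 (funext fun γ => ?_))
      have h1 := congrFun h (consExp a γ)
      rw [cochainEval_succ, cochainEval_succ] at h1
      simpa using h1
    · intro g
      choose c hc using fun a => ih.2 (fun γ => g (consExp a γ))
      obtain ⟨f, hf⟩ := ((M.cochains p).evalMonomial_bijective hA x).2 c
      refine ⟨f, funext fun γ => ?_⟩
      refine (M.cochainEval_of_evalMonomial (congrFun hf (γ 0))).trans ?_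
      rw [hc]
      exact congrArg g (Fin.cons_self_tail γ)

theorem FBimod.cochainEval_face (p i : ℕ) (x : X) (f : (M.cochains p).obj x)
    (γ : Fin (p + 1) → (Fin n →₀ ℕ)) :
    M.cochainEval (p + 1) x ((M.face p i).app x f) γ = coface R p i (M.cochainEval p x f) γ := by
  -- The face of index `0` has the same form in every degree, and its proof needs no induction.
  have hzero : ∀ (p : ℕ) (f : (M.cochains p).obj x) (γ : Fin (p + 1) → (Fin n →₀ ℕ)),
      M.cochainEval (p + 1) x ((M.cochains p).leftFace.app x f) γ =
        monU R (γ 0) • M.cochainEval p x f (Fin.tail γ) := by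
    intro p f γ
    rw [M.monU_smul, ← M.cochainEval_L]
    exact M.cochainEval_of_evalMonomial ((M.cochains p).evalMonomial_leftFace x f _)
  induction p generalizing i with
  | zero =>
    rcases i with _ | i
    · rw [face, coface]
      exact hzero 0 f γ
    · rw [face, coface, M.monV_smul]
      rfl
  | succ p ih =>
    rcases i with _ | _ | i
    · rw [face, coface]
      exact hzero (p + 1) f γ
    · rw [face, coface]
      exact congrFun (congrArg (M.cochainEval p x)
        ((M.cochains p).evalMonomial_middleFace x f (γ 0) (γ 1))) _
    · rw [face, coface]
      refine (M.cochainEval_of_evalMonomial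
        (FMod.evalMonomial_ihomMap (M.face p (i + 1)) x f (γ 0))).trans ?_
      rw [ih]
      rfl

theorem FBimod.cochainEval_diff (p : ℕ) (x : X) (f : (M.cochains p).obj x) :
    M.cochainEval (p + 1) x (M.diff p x f) = coDiff R p (M.cochainEval p x f) := by
  funext γ
  rw [diff, coDiff, LinearMap.sum_apply, map_sum, Finset.sum_apply]
  refine Finset.sum_congr rfl fun i _ => ?_
  rw [LinearMap.smul_apply, map_zsmul, Pi.smul_apply, M.cochainEval_face]

/-- For `p > n` there is no subset with `p` elements, so the condition on Koszul values in
`exists_coDiff_eq` is vacuous and every cocycle is a coboundary. -/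
theorem FBimod.subsingleton_HHObj (hA : A.IsTensorIdempotent) {p : ℕ} (hp : n < p) (x : X) :
    Subsingleton (M.HHObj p x) := by
  obtain _ | p := p
  · exact absurd hp (Nat.not_lt_zero n)
  rw [Submodule.Quotient.subsingleton_iff, Submodule.comap_subtype_eq_top]
  intro f hf
  have hf' : M.diff (p + 1) x f = 0 := hf
  obtain ⟨b, hb⟩ := exists_coDiff_eq (M.cochainEval (p + 1) x f)
    (by rw [← M.cochainEval_diff, hf', map_zero])
    (fun S => absurd (Finset.card_le_univ S.1) (by rw [S.2, Fintype.card_fin]; omega))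
  obtain ⟨g, rfl⟩ := (M.cochainEval_bijective hA p x).2 b
  exact ⟨g, (M.cochainEval_bijective hA (p + 1) x).1 ((M.cochainEval_diff p x g).trans hb)⟩

/-- One direction makes evaluation on the Koszul resolution well defined on cohomology, the other
makes it injective. In degree `0` there are no coboundaries and evaluation is itself injective. -/
theorem FBimod.koszulEvalCochain_eq_zero_iff (hA : A.IsTensorIdempotent)
    (hM : ∀ x (i : Fin n) (m : M.obj x), polyAlpha R n i • m = 0) (p : ℕ) (x : X)
    (f : (M.cochains p).obj x) (hf : f ∈ M.cocycles p x) :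
    M.koszulEvalCochain p x f = 0 ↔ f ∈ M.coboundaries x p := by
  have hf' : M.diff p x f = 0 := hf
  cases p with
  | zero =>
    constructor
    · intro h
      refine (M.cochainEval_bijective hA 0 x).1 ?_
      rw [map_zero]
      exact eq_zero_of_koszulEval _ (congrFun h)
    · intro h
      have h0 : f = 0 := h
      rw [h0, map_zero]
  | succ p =>
    constructor
    · intro h
      obtain ⟨b, hb⟩ := exists_coDiff_eq (M.cochainEval (p + 1) x f)
        (by rw [← M.cochainEval_diff, hf', map_zero]) (congrFun h)
      obtain ⟨g, rfl⟩ := (M.cochainEval_bijective hA p x).2 b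
      exact ⟨g, (M.cochainEval_bijective hA (p + 1) x).1 ((M.cochainEval_diff p x g).trans hb)⟩
    · rintro ⟨g, rfl⟩
      funext S
      refine (congrFun (congrArg (koszulEval R) (M.cochainEval_diff p x g)) S).trans ?_
      exact koszulEval_coDiff (hM x) _ S

/-- The values of Hochschild cohomology classes on the Koszul resolution. -/
noncomputable def FBimod.hhToCopies (hA : A.IsTensorIdempotent)
    (hM : ∀ x (i : Fin n) (m : M.obj x), polyAlpha R n i • m = 0) (p : ℕ) :
    LinFun.Hom (M.HH p) (LinFun.ulift.{r, u, v, s, max u t} (M.toLinFun.copies (KSub n p))) where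
  app x := Submodule.liftQ _ ((ULift.moduleEquiv.{r, s, max u t} (R := R)
      (M := KSub n p → M.obj x)).symm.toLinearMap ∘ₗ
      M.koszulEvalCochain p x ∘ₗ (M.cocycles p x).subtype) fun f hf =>
    ULift.ext _ _ ((M.koszulEvalCochain_eq_zero_iff hA hM p x f.1 f.2).2 hf)
  naturality {x y} φ f := by
    obtain ⟨c, hc⟩ : ∃ c : M.cocycles p x, Submodule.Quotient.mk c = f :=
      Submodule.Quotient.mk_surjective _ f
    rw [← hc]
    exact ULift.ext _ _ (funext fun S => M.koszulEvalCochain_map p φ c.1 S)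

theorem FBimod.hhToCopies_isIso (hA : A.IsTensorIdempotent)
    (hM : ∀ x (i : Fin n) (m : M.obj x), polyAlpha R n i • m = 0) (p : ℕ) :
    (M.hhToCopies hA hM p).IsIso := by
  intro x
  constructor
  · refine LinearMap.ker_eq_bot.1 (Submodule.ker_liftQ_eq_bot _ _ _ fun f hf => ?_)
    exact (M.koszulEvalCochain_eq_zero_iff hA hM p x f.1 f.2).1 (congrArg ULift.down hf)
  · rintro ⟨κ⟩
    -- Surjectivity: the zero differential on the Koszul side makes every family of values come from
    -- a cocycle.
    obtain ⟨c, hc, hκ⟩ := exists_koszulEval_eq (hM x) κ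
    obtain ⟨f, rfl⟩ := (M.cochainEval_bijective hA p x).2 c
    refine ⟨Submodule.mkQ _ ⟨f, (M.cochainEval_bijective hA (p + 1) x).1 ?_⟩,
      ULift.ext _ _ (funext hκ)⟩
    rw [M.cochainEval_diff, hc, map_zero]

end CochainEvaluation

end FunctorMonoid

theorem theorem4p7 {R : Type r} [CommRing R] {X : Type u} [Category.{v} X] [Preadditive X]
    [Linear R X] [MonoidalCategory X] [MonoidalPreadditive X] [MonoidalLinear R X]
    [SymmetricCategory X] (A : FMon.{r, u, v, t} R X) (hidem : A.IsTensorIdempotent)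
    (hcomm : A.IsCommutative) (n : ℕ) :
    -- the sequence `α` is regular for `C = A[u, v]`
    ((∃ (x : X) (a : A.obj x), a ≠ 0) →
      (A.poly (Fin n ⊕ Fin n)).IsRegularSequence (A.alpha n)) ∧
    -- `C` is `Aₙ ⊗ Aₙ`, and `C ⟶ Aₙ` is the product of `Aₙ`
    ((A.polyPairing n).desc.IsIso ∧
      ∀ z : X, (A.fold n).app z ∘ₗ (A.polyPairing n).desc.app z =
        (A.poly (Fin n)).mul.desc.app z) ∧
    -- `C ⟶ Aₙ` induces an isomorphism from `C / C⟨α⟩` to `Aₙ`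
    (∃ e : (A.poly (Fin n ⊕ Fin n)).self.quot
        ((A.poly (Fin n ⊕ Fin n)).ideal (A.alpha n) Set.univ) ≅ A.polyModule n,
      FMod.quotMk _ _ ≫ e.hom = (A.fold n).toModHom) ∧
    -- the Koszul complex is an `𝓕`-split resolution of `Aₙ` by `𝓕`-projective `C`-modules
    IsFSplitResolution ((A.poly (Fin n ⊕ Fin n)).koszul n)
      ((A.poly (Fin n ⊕ Fin n)).koszulD (A.alpha n) (A.alpha_inCommutant n)) (A.koszulAug n) ∧
    (∀ p, IsRelProjective (FMod.restr (A.poly (Fin n ⊕ Fin n)))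
      ((A.poly (Fin n ⊕ Fin n)).koszul n p)) ∧
    -- the Hochschild cohomology
    (∀ M : FBimod.{r, u, v, t, s} (A.poly (Fin n)), ∀ p > n, ∀ x : X,
      Subsingleton ((M.HH p).obj x)) ∧
    (∀ p ≤ n, Nonempty ((A.poly (Fin n)).selfBimod.HH p ≅
      LinFun.ulift.{r, u, v, t, max u t} ((A.poly (Fin n)).toLinFun.copies (KSub n p)))) := by
  refine ⟨A.isRegularSequence_alpha n, ⟨A.polyPairing_isIso hidem n, A.fold_comp_polyPairing n⟩,
    A.exists_quot_iso n, A.isFSplitResolution_koszul n,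
    fun p => FMon.isRelProjective_copies _ (KSub n p),
    fun M p hp x => M.subsingleton_HHObj hidem hp x, fun p _ => ⟨?_⟩⟩
  exact LinFun.isoOfBijective _ ((A.poly (Fin n)).selfBimod.hhToCopies_isIso hidem
    (fun x i m => A.polyAlpha_smul_selfBimod i x m) p)
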